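/- **Setting.** All schemes are families indexed by the security parameter $n$, with algorithms that run in time polynomial in $n$ and the input size. Let $\mathsf{MAC}$ be a message authentication code, $\mathsf{Sign}$ a signature scheme, $(\mathsf{Gen}_{\mathsf{pub}},\mathsf{Enc}_{pk},\mathsf{Dec}_{sk})$ a public-key encryption scheme with ciphertexts of fixed length, $(\mathsf{Enc}_k,\mathsf{Dec}_k)$ a symmetric encryption scheme, $g$ the generator of a cyclic group, and $n_{\max}\in\mathbb N$. The parties are a user, webservers, an honest distress coordination point (DCP) and an honest certificate authority (CA). The CA certifies a public key for an identity $B$ only for the owner of $B$. TLS is an ideal secure channel. Keys for $\mathsf{MAC}$ and symmetric encryption are derived from Diffie–Hellman keys by key derivation functions. *Server enrolment* (in a TLS session with the DCP). The webserver $B$ sends $g^b$, $B$, its certificate, a fresh encryption key $pk_B$ and $\mathsf{Sign}_B(g^b,B,pk_B)$. The DCP verifies certificate and signature, stores $B$, $pk_B$ and the key $k_{BC}$ derived from $g^{bc}$, and returns $g^c$. *User enrolment* (in a TLS session with the DCP, and unobserved). The user sends $g^a$, an initial sequence number $\mathrm{sqn}$, the chosen websites, and an instruction on how to be sent the confirmation.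 The DCP returns $g^c$, a random unused identifier $\mathrm{id}$, and the public keys of the chosen websites. Both store $\mathrm{id}$, $\mathrm{sqn}$ and the key $k_{AC}$ derived from $g^{ac}$. *Distress protocol.* 1. To signal distress to a chosen website $B$, the user computes $\mathrm{tag}=\mathsf{MAC}_{k_{AC}}(\mathrm{id},m)$ for its current sequence number $m$, increments that number, and opens a TLS connection to $B$ with client nonce $\mathsf{Enc}_{pk_B}(1\cdots1\,\|\,\mathrm{id}\,\|\,\mathrm{tag})$. 2. The webserver $B$ decodes the nonce, forms $c_{BC}=\mathsf{Enc}_{k_{BC}}(\mathrm{id},\mathrm{tag})$, chooses $\mathrm{nonce}_B$, and sends $B,c_{BC},\mathrm{nonce}_B,\mathsf{MAC}_{k_{BC}}(B,c_{BC},\mathrm{nonce}_B)$ to the DCP. 3. The DCP verifies that $B$ is enrolled and this MAC, decrypts, and verifies that $\mathrm{id}$ is registered and that $\mathrm{tag}$ is valid for $(\mathrm{id},m)$ for some $m\in\{\mathrm{sqn},\dots,\mathrm{sqn}+n_{\max}\}$, where $\mathrm{sqn}$ is the number it has stored for $\mathrm{id}$. It takes the first such $m$ and stores $m+1$. At this moment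 *the DCP receives the distress $(\mathrm{id},m)$*. It replies with $c_{CB}=\mathsf{Enc}_{k_{BC}}(\mathrm{instruction})$, $s=\mathsf{MAC}_{k_{AC}}(m)$, a nonce $\mathrm{nonce}_C$ and $\mathsf{MAC}_{k_{BC}}(c_{CB},s,\mathrm{nonce}_B,\mathrm{nonce}_C)$. 4. The webserver verifies this MAC and sends $s$ to its TLS peer within the page content. 5. The protocol *completes successfully* when the user accepts $s$ as a valid MAC under $k_{AC}$ of the sequence number of its current distress session. **Adversaries.** An adversary is a probabilistic polynomial-time program that schedules all steps of the honest parties, carries (and may read, change, drop, replay and inject) all messages outside TLS, sees the client nonces, opens TLS connections to webservers, and enrols users of its own; it also makes the choices of the user. Moreover: * a *network adversary* has no further capabilities; * a *local adversary* also reads and chooses the application-layer content of the user's TLS sessions with webservers; * a *malicious webserver adversary* also owns webservers with certificates of the CA, and takes part in the user's sessions with them. **Assumptions.** $\mathsf{Sign}$ and $\mathsf{MAC}$ are existentially unforgeable under chosen-message attacks (for $\mathsf{MAC}$ with a verification oracle, and with keys derived from $g^{ac}$ for uniformly random exponent strings $a,c$): each probabilistic polynomial-time adversary forges with negligible probability.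 For each polynomial $q$, the probability that an honest party picks the same nonce twice in $q(n)$ choices is negligible. **Guarantee.** For each of the three kinds of adversaries and each adversary of that kind, the following holds except with negligible probability in $n$. Whenever the user successfully completes the distress protocol in a session started with website $B$ and sequence number $m$, the user with identifier $\mathrm{id}$ has signalled distress to $B$ with sequence number $m$ earlier, this was the user's last distress signal before the completion, and the DCP has received the distress $(\mathrm{id},m)$ after that signal and before the completion. -/

import Mathlib

/-!
# A computational model of a distress-signalling protocol

1. a small deterministic programming language with a step count, polynomial time, and
   probabilistic polynomial-time adversaries that interact with an experiment;
2. the cryptographic schemes used by the parties, and their security notions;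
3. the two enrolment protocols and the distress signal protocol, run by honest parties while the
   adversary schedules everything and controls the network.
-/

namespace Distress

noncomputable section

/-! ## Programs with a step count -/

/-- The data types programs work on. -/
inductive Ty : Type
  | unit : Ty
  | bool : Ty
  | nat : Ty
  | prod : Ty → Ty → Ty
  | opt : Ty → Ty
  | list : Ty → Ty

/-- The values of a data type. -/
@[reducible] def Ty.den : Ty → Type
  | .unit => Unit
  | .bool => Bool
  | .nat => ℕ
  | .prod a b => a.den × b.den
  | .opt a => Option a.den
  | .list a => List a.den

/-- Equality of values is decidable. -/
def Ty.decEq : (a : Ty) → DecidableEq a.den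
  | .unit => inferInstanceAs (DecidableEq Unit)
  | .bool => inferInstanceAs (DecidableEq Bool)
  | .nat => inferInstanceAs (DecidableEq ℕ)
  | .prod a b =>
    have := a.decEq
    have := b.decEq
    inferInstanceAs (DecidableEq (a.den × b.den))
  | .opt a =>
    have := a.decEq
    inferInstanceAs (DecidableEq (Option a.den))
  | .list a =>
    have := a.decEq
    inferInstanceAs (DecidableEq (List a.den))

instance (a : Ty) : DecidableEq a.den := a.decEq

/-- The size of a value; numbers are measured in binary. -/
def Ty.size : (a : Ty) → a.den → ℕ
  | .unit, _ => 1
  | .bool, _ => 1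
  | .nat, k => 1 + Nat.size k
  | .prod a b, x => 1 + a.size x.1 + b.size x.2
  | .opt a, x => 1 + (x.map a.size).getD 0
  | .list a, x => 1 + (x.map fun y => 1 + a.size y).sum

/-- Bit strings, as a data type and as values. -/
abbrev bits : Ty := .list .bool

/-- Bit strings. -/
abbrev Str : Type := List Bool

/-- The number with the given binary digits, least significant digit first. -/
def toNat (x : Str) : ℕ := x.foldr Nat.bit 0

/-- The operations that a program may call, with their argument and result types. -/
structure Interface where
  Op : Type
  dom : Op → Ty
  cod : Op → Ty

/-- First-order programs. `call` invokes an operation of the surrounding experiment and `fold` is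
the only loop. -/
inductive Code (I : Interface) : Ty → Ty → Type
  | id {a : Ty} : Code I a a
  | comp {a b c : Ty} : Code I b c → Code I a b → Code I a c
  | star {a : Ty} : Code I a .unit
  | pair {a b c : Ty} : Code I a b → Code I a c → Code I a (.prod b c)
  | fst {a b : Ty} : Code I (.prod a b) a
  | snd {a b : Ty} : Code I (.prod a b) b
  | true {a : Ty} : Code I a .bool
  | false {a : Ty} : Code I a .bool
  | cond {a b : Ty} : Code I a .bool → Code I a b → Code I a b → Code I a b
  | eq {a : Ty} : Code I (.prod a a) .bool
  | none {a b : Ty} : Code I a (.opt b)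
  | some {a : Ty} : Code I a (.opt a)
  | elim {a b c : Ty} : Code I a c → Code I (.prod a b) c → Code I (.prod a (.opt b)) c
  | nil {a b : Ty} : Code I a (.list b)
  | cons {a : Ty} : Code I (.prod a (.list a)) (.list a)
  | uncons {a : Ty} : Code I (.list a) (.opt (.prod a (.list a)))
  | append {a : Ty} : Code I (.prod (.list a) (.list a)) (.list a)
  | length {a : Ty} : Code I (.list a) .nat
  | take {a : Ty} : Code I (.prod .nat (.list a)) (.list a)
  | drop {a : Ty} : Code I (.prod .nat (.list a)) (.list a)
  | lookup {a b : Ty} : Code I (.prod a (.list (.prod a b))) (.opt b)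
  | fold {a b c : Ty} : Code I (.prod c (.prod a b)) b → Code I (.prod c (.prod (.list a) b)) b
  | succ : Code I .nat .nat
  | digits : Code I .nat bits
  | ofDigits : Code I bits .nat
  | call (i : I.Op) : Code I (I.dom i) (I.cod i)

/-- A basic instruction: it costs one step plus the sizes of what it reads and writes. -/
def basic {S : Type} {a b : Ty} (f : a.den → b.den) (x : a.den) (s : S) : b.den × S × ℕ :=
  (f x, s, 1 + a.size x + b.size (f x))

/-- Execution of a program on an input, where the operations are answered by `h`, which acts on a
state `s`. The outcome is the output, the final state and the number of steps. -/
def Code.run {I : Interface} {S : Type} (h : (i : I.Op) → (I.dom i).den → S → (I.cod i).den × S) :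
    {a b : Ty} → Code I a b → a.den → S → b.den × S × ℕ
  | _, _, .id (a := a), x, s => basic (a := a) (b := a) (fun y => y) x s
  | _, _, .comp g f, x, s =>
    let u := f.run h x s
    let v := g.run h u.1 u.2.1
    (v.1, v.2.1, 1 + u.2.2 + v.2.2)
  | _, _, .star (a := a), x, s => basic (a := a) (b := .unit) (fun _ => ()) x s
  | _, _, .pair (a := a) f g, x, s =>
    let u := f.run h x s
    let v := g.run h x u.2.1
    ((u.1, v.1), v.2.1, 1 + a.size x + u.2.2 + v.2.2)
  | _, _, .fst (a := a) (b := b), x, s => basic (a := .prod a b) (b := a) (fun y => y.1) x s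
  | _, _, .snd (a := a) (b := b), x, s => basic (a := .prod a b) (b := b) (fun y => y.2) x s
  | _, _, .true (a := a), x, s => basic (a := a) (b := .bool) (fun _ => Bool.true) x s
  | _, _, .false (a := a), x, s => basic (a := a) (b := .bool) (fun _ => Bool.false) x s
  | _, _, .cond (a := a) t f g, x, s =>
    let u := t.run h x s
    let v := match u.1 with
      | Bool.true => f.run h x u.2.1
      | Bool.false => g.run h x u.2.1
    (v.1, v.2.1, 1 + a.size x + u.2.2 + v.2.2)
  | _, _, .eq (a := a), x, s =>
    basic (a := .prod a a) (b := .bool) (fun y => decide (y.1 = y.2)) x s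
  | _, _, .none (a := a) (b := b), x, s =>
    basic (a := a) (b := .opt b) (fun _ => Option.none) x s
  | _, _, .some (a := a), x, s => basic (a := a) (b := .opt a) (fun y => Option.some y) x s
  | _, _, .elim (a := a) (b := b) f g, x, s =>
    let v := match x.2 with
      | Option.none => f.run h x.1 s
      | Option.some y => g.run h (x.1, y) s
    (v.1, v.2.1, 1 + Ty.size (.prod a (.opt b)) x + v.2.2)
  | _, _, .nil (a := a) (b := b), x, s => basic (a := a) (b := .list b) (fun _ => []) x s
  | _, _, .cons (a := a), x, s =>
    basic (a := .prod a (.list a)) (b := .list a) (fun y => y.1 :: y.2) x s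
  | _, _, .uncons (a := a), x, s =>
    basic (a := .list a) (b := .opt (.prod a (.list a)))
      (fun y => match y with
        | [] => Option.none
        | z :: zs => Option.some (z, zs)) x s
  | _, _, .append (a := a), x, s =>
    basic (a := .prod (.list a) (.list a)) (b := .list a) (fun y => y.1 ++ y.2) x s
  | _, _, .length (a := a), x, s =>
    basic (a := .list a) (b := .nat) (fun y => List.length y) x s
  | _, _, .take (a := a), x, s =>
    basic (a := .prod .nat (.list a)) (b := .list a) (fun y => List.take y.1 y.2) x s
  | _, _, .drop (a := a), x, s =>
    basic (a := .prod .nat (.list a)) (b := .list a) (fun y => List.drop y.1 y.2) x s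
  | _, _, .lookup (a := a) (b := b), x, s =>
    basic (a := .prod a (.list (.prod a b))) (b := .opt b)
      (fun y => (y.2.find? fun e => decide (e.1 = y.1)).map fun e => e.2) x s
  | _, _, .fold (a := a) (b := b) (c := c) f, x, s =>
    x.2.1.foldl
      (fun r e =>
        let u := f.run h (x.1, e, r.1) r.2.1
        (u.1, u.2.1, r.2.2 + 1 + Ty.size (.prod c (.prod a b)) (x.1, e, r.1) + u.2.2))
      (x.2.2, s, 1 + Ty.size (.prod c (.prod (.list a) b)) x)
  | _, _, .succ, x, s => basic (a := .nat) (b := .nat) (fun y => y + 1) x s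
  | _, _, .digits, x, s => basic (a := .nat) (b := bits) Nat.bits x s
  | _, _, .ofDigits, x, s => basic (a := bits) (b := .nat) toNat x s
  | _, _, .call i, x, s =>
    ((h i x s).1, (h i x s).2, 1 + (I.dom i).size x + (I.cod i).size (h i x s).1)

/-- The interface without operations. -/
def Interface.empty : Interface where
  Op := Empty
  dom := Empty.elim
  cod := Empty.elim

/-- `f` is computable in time polynomial in the security parameter and the size of its argument;
the security parameter is given to the program in unary. -/
def PolyTime {a b : Ty} (f : ℕ → a.den → b.den) : Prop :=
  ∃ (c : Code .empty (.prod (.list .unit) a) b) (p : Polynomial ℕ), ∀ n x,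
    let r := c.run (S := Unit) (fun i => Empty.elim i) (List.replicate n (), x) ()
    r.1 = f n x ∧ r.2.2 ≤ p.eval (n + a.size x)

/-! ## Experiments and adversaries -/

/-- The probability of an event under the uniform distribution on a finite type. -/
def prob (Ω : Type) [Fintype Ω] (E : Ω → Prop) : ℝ :=
  (Nat.card {ω : Ω // E ω} : ℝ) / (Nat.card Ω : ℝ)

/-- Negligible functions of the security parameter. -/
def Negligible (f : ℕ → ℝ) : Prop :=
  Asymptotics.SuperpolynomialDecay Filter.atTop (fun n : ℕ => (n : ℝ)) f

/-- An experiment that answers the calls of an adversary. `Seed n t` holds the coins of the honest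
parties at security parameter `n` in a run with at most `t` calls. `Won` says that the adversary
has been successful. -/
structure Experiment (I : Interface) where
  State : Type
  Seed : ℕ → ℕ → Type
  [seedFintype : ∀ n t, Fintype (Seed n t)]
  start : (n t : ℕ) → Seed n t → State
  handle : ℕ → (i : I.Op) → (I.dom i).den → State → (I.cod i).den × State
  Won : State → Prop

attribute [instance] Experiment.seedFintype

/-- An adversary: a program which is given the security parameter in unary and a string of coins
of polynomial length, with a polynomial that is meant to bound its running time. -/
structure Adversary (I : Interface) where
  prog : Code I (.prod (.list .unit) bits) .unit
  coins : Polynomial ℕ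
  time : Polynomial ℕ

/-- Final state and number of steps of the adversary in a run of the experiment. -/
def Adversary.exec {I : Interface} (A : Adversary I) (E : Experiment I) (n : ℕ)
    (ω : E.Seed n (A.time.eval n) × (Fin (A.coins.eval n) → Bool)) : E.State × ℕ :=
  (A.prog.run (E.handle n) (List.replicate n (), List.ofFn ω.2)
    (E.start n (A.time.eval n) ω.1)).2

/-- The adversary runs in (strict) polynomial time in the experiment. Every call costs at least
one step, so that its running time also bounds the number of its calls. -/
def Adversary.IsPPT {I : Interface} (A : Adversary I) (E : Experiment I) : Prop :=
  ∀ n ω, (A.exec E n ω).2 ≤ A.time.eval n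

/-- The probability that the adversary is successful. -/
def Adversary.success {I : Interface} (A : Adversary I) (E : Experiment I) (n : ℕ) : ℝ :=
  prob (E.Seed n (A.time.eval n) × (Fin (A.coins.eval n) → Bool)) fun ω =>
    E.Won (A.exec E n ω).1

/-- Every probabilistic polynomial-time adversary is successful with negligible probability. -/
def Experiment.Secure {I : Interface} (E : Experiment I) : Prop :=
  ∀ A : Adversary I, A.IsPPT E → Negligible (A.success E)

/-! ## Cryptographic schemes

Messages that are authenticated are tuples of bit strings. Probabilistic algorithms take a string
of coins as an argument. -/

/-- `ℓ.eval n` independent uniform coins. -/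
abbrev Coins (ℓ : Polynomial ℕ) (n : ℕ) : Type := Fin (ℓ.eval n) → Bool

/-- A family of cyclic groups with generators, an encoding of the elements as bit strings, and
exponentiation in polynomial time. -/
structure DHGroup where
  G : ℕ → Type
  [group : ∀ n, Group (G n)]
  gen : ∀ n, G n
  gen_spec : ∀ n (x : G n), x ∈ Subgroup.zpowers (gen n)
  encode : ∀ n, G n → Str
  decode : ∀ n, Str → Option (G n)
  decode_encode : ∀ n x, decode n (encode n x) = some x
  gen_poly : PolyTime (a := .unit) (b := bits) fun n _ => encode n (gen n)
  pow_poly : PolyTime (a := .prod bits bits) (b := .opt bits) fun n (x : Str × Str) =>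
    (decode n x.1).map fun y => encode n (y ^ toNat x.2)

attribute [instance] DHGroup.group

/-- The encoding of the generator. -/
def DHGroup.base (D : DHGroup) (n : ℕ) : Str := D.encode n (D.gen n)

/-- Exponentiation on encodings; it fails if `x` does not encode a group element. -/
def DHGroup.pow (D : DHGroup) (n : ℕ) (x e : Str) : Option Str :=
  (D.decode n x).map fun y => D.encode n (y ^ toNat e)

/-- The algorithms of a message authentication code with tags of length `tagLen`. -/
structure MAC where
  tagLen : ℕ → ℕ
  tag : ℕ → Str → List Str → Str
  vrfy : ℕ → Str → List Str → Str → Bool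
  tag_length : ∀ n k m, (tag n k m).length = tagLen n
  vrfy_tag : ∀ n k m, vrfy n k m (tag n k m) = true
  tag_poly : PolyTime (a := .prod bits (.list bits)) (b := bits)
    fun n (x : Str × List Str) => tag n x.1 x.2
  vrfy_poly : PolyTime (a := .prod bits (.prod (.list bits) bits)) (b := .bool)
    fun n (x : Str × List Str × Str) => vrfy n x.1 x.2.1 x.2.2

/-- Operations of the forgery experiment for MACs: tagging and verification. -/
inductive MACOp : Type
  | tag : MACOp
  | vrfy : MACOp

/-- The interface of the forgery experiment for MACs. -/
def macInterface : Interface where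
  Op := MACOp
  dom
    | .tag => .list bits
    | .vrfy => .prod (.list bits) bits
  cod
    | .tag => bits
    | .vrfy => .bool

/-- State of the forgery experiment: the messages tagged so far and whether there was a forgery. -/
structure MACState where
  key : Str
  tagged : List (List Str)
  forged : Prop

/-- Existential unforgeability under chosen-message attacks with a verification oracle, for keys
`key n s` where `s` is uniformly distributed. -/
def MAC.forgery (M : MAC) (S : ℕ → Type) [∀ n, Fintype (S n)] (key : ∀ n, S n → Str) :
    Experiment macInterface where
  State := MACState
  Seed n _ := S n
  start n _ s := ⟨key n s, [], False⟩
  handle n i := match i with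
    | .tag => fun (m : List Str) σ => (M.tag n σ.key m, { σ with tagged := m :: σ.tagged })
    | .vrfy => fun (x : List Str × Str) σ =>
      (M.vrfy n σ.key x.1 x.2,
        { σ with forged := σ.forged ∨ (M.vrfy n σ.key x.1 x.2 = true ∧ x.1 ∉ σ.tagged) })
  Won σ := σ.forged

/-- The algorithms of a signature scheme. -/
structure Signature where
  gen : ℕ → Str → Str × Str -- public key, secret key
  sign : ℕ → Str → Str → List Str → Str -- secret key, coins, message
  vrfy : ℕ → Str → List Str → Str → Bool
  vrfy_sign : ∀ n r r' m, vrfy n (gen n r).1 m (sign n (gen n r).2 r' m) = true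
  gen_poly : PolyTime (a := bits) (b := .prod bits bits) fun n (r : Str) => gen n r
  sign_poly : PolyTime (a := .prod bits (.prod bits (.list bits))) (b := bits)
    fun n (x : Str × Str × List Str) => sign n x.1 x.2.1 x.2.2
  vrfy_poly : PolyTime (a := .prod bits (.prod (.list bits) bits)) (b := .bool)
    fun n (x : Str × List Str × Str) => vrfy n x.1 x.2.1 x.2.2

/-- Operations of the forgery experiment for signatures. -/
inductive SigOp : Type
  | publicKey : SigOp
  | sign : SigOp
  | submit : SigOp

/-- The interface of the forgery experiment for signatures. -/
def sigInterface : Interface where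
  Op := SigOp
  dom
    | .publicKey => .unit
    | .sign => .list bits
    | .submit => .prod (.list bits) bits
  cod
    | .publicKey => bits
    | .sign => bits
    | .submit => .bool

/-- State of the forgery experiment for signatures. -/
structure SigState where
  pk : Str
  sk : Str
  tape : ℕ → Str
  signed : List (List Str)
  forged : Prop

/-- Existential unforgeability of signatures under chosen-message attacks. -/
def Signature.forgery (D : Signature) (ℓ : Polynomial ℕ) : Experiment sigInterface where
  State := SigState
  Seed n t := Coins ℓ n × (Fin t → Coins ℓ n)
  start n t s := ⟨(D.gen n (List.ofFn s.1)).1, (D.gen n (List.ofFn s.1)).2,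
    fun j => if h : j < t then List.ofFn (s.2 ⟨j, h⟩) else [], [], False⟩
  handle n i := match i with
    | .publicKey => fun _ σ => (σ.pk, σ)
    | .sign => fun (m : List Str) σ =>
      (D.sign n σ.sk (σ.tape 0) m,
        { σ with signed := m :: σ.signed, tape := fun j => σ.tape (j + 1) })
    | .submit => fun (x : List Str × Str) σ =>
      (D.vrfy n σ.pk x.1 x.2,
        { σ with forged := σ.forged ∨ (D.vrfy n σ.pk x.1 x.2 = true ∧ x.1 ∉ σ.signed) })
  Won σ := σ.forged

/-- A public-key encryption scheme for plaintexts of length `ptLen` with ciphertexts of the fixed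
length `ctLen`, correct up to a negligible decryption error. -/
structure PKE (ℓ : Polynomial ℕ) where
  ptLen : ℕ → ℕ
  ctLen : ℕ → ℕ
  gen : ℕ → Str → Str × Str -- public key, secret key
  enc : ℕ → Str → Str → Str → Str -- public key, coins, plaintext
  dec : ℕ → Str → Str → Option Str
  enc_length : ∀ n r r' m, m.length = ptLen n → (enc n (gen n r).1 r' m).length = ctLen n
  dec_enc : ∃ ε : ℕ → ℝ, Negligible ε ∧ ∀ n m, m.length = ptLen n →
    prob (Coins ℓ n × Coins ℓ n) (fun ω =>
      dec n (gen n (List.ofFn ω.1)).2 (enc n (gen n (List.ofFn ω.1)).1 (List.ofFn ω.2) m)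
        ≠ some m) ≤ ε n
  gen_poly : PolyTime (a := bits) (b := .prod bits bits) fun n (r : Str) => gen n r
  enc_poly : PolyTime (a := .prod bits (.prod bits bits)) (b := bits)
    fun n (x : Str × Str × Str) => enc n x.1 x.2.1 x.2.2
  dec_poly : PolyTime (a := .prod bits bits) (b := .opt bits)
    fun n (x : Str × Str) => dec n x.1 x.2

/-- A symmetric encryption scheme for tuples of bit strings. -/
structure SymEnc where
  enc : ℕ → Str → Str → List Str → Str -- key, coins, plaintext
  dec : ℕ → Str → Str → Option (List Str)
  dec_enc : ∀ n k r m, dec n k (enc n k r m) = some m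
  enc_poly : PolyTime (a := .prod bits (.prod bits (.list bits))) (b := bits)
    fun n (x : Str × Str × List Str) => enc n x.1 x.2.1 x.2.2
  dec_poly : PolyTime (a := .prod bits bits) (b := .opt (.list bits))
    fun n (x : Str × Str) => dec n x.1 x.2

/-- The public parameters of the system. -/
structure Scheme where
  /-- the number of coins given to each invocation of a probabilistic algorithm -/
  ℓ : Polynomial ℕ
  dh : DHGroup
  mac : MAC
  sig : Signature
  pke : PKE ℓ
  sym : SymEnc
  /-- derivation of MAC keys and of encryption keys from encoded group elements -/
  kdfMac : ℕ → Str → Str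
  kdfEnc : ℕ → Str → Str
  kdfMac_poly : PolyTime (a := bits) (b := bits) fun n (x : Str) => kdfMac n x
  kdfEnc_poly : PolyTime (a := bits) (b := bits) fun n (x : Str) => kdfEnc n x
  /-- the algorithm with which honest parties choose nonces -/
  nonce : ℕ → Str → Str
  nonce_poly : PolyTime (a := bits) (b := bits) fun n (r : Str) => nonce n r
  /-- the lengths of the distress marker and of user identifiers -/
  md : ℕ → ℕ
  mi : ℕ → ℕ
  md_poly : PolyTime (a := .unit) (b := .list .unit) fun n _ => List.replicate (md n) ()
  mi_poly : PolyTime (a := .unit) (b := .list .unit) fun n _ => List.replicate (mi n) ()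
  mi_le : ∀ n, mi n ≤ ℓ.eval n
  length_eq : ∀ n, md n + mi n + mac.tagLen n = pke.ptLen n
  /-- how far the sequence number of the user may be ahead of the one the DCP has stored -/
  nMax : ℕ

namespace Scheme

variable (P : Scheme) (n : ℕ)

/-- The MAC key agreed on by parties with Diffie-Hellman exponents `a` and `c`. -/
def dhMacKey (s : Coins P.ℓ n × Coins P.ℓ n) : Str :=
  P.kdfMac n (P.dh.encode n ((P.dh.gen n ^ toNat (List.ofFn s.1)) ^ toNat (List.ofFn s.2)))

/-- The MAC is secure with the keys that the parties use: a key is derived from a Diffie-Hellman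
key with independent uniform exponents. -/
def MACSecure : Prop :=
  (P.mac.forgery (fun n => Coins P.ℓ n × Coins P.ℓ n) P.dhMacKey).Secure

/-- The signature scheme is secure. -/
def SignatureSecure : Prop := (P.sig.forgery P.ℓ).Secure

/-- The probability that an honest party picks the same nonce twice, in polynomially many choices,
is negligible. -/
def NoncesFresh : Prop :=
  ∀ q : Polynomial ℕ, Negligible fun n =>
    prob (Fin (q.eval n) → Coins P.ℓ n) fun ω =>
      ∃ i j, i ≠ j ∧ P.nonce n (List.ofFn (ω i)) = P.nonce n (List.ofFn (ω j))

/-- The distress nonce with identifier `id` and tag `tag`. -/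
def encodeDistress (pk r id tag : Str) : Str :=
  P.pke.enc n pk r (List.replicate (P.md n) true ++ id ++ tag)

/-- Identifier and tag if the nonce decrypts to a string that starts with the distress marker. -/
def decodeDistress (sk x : Str) : Option (Str × Str) :=
  match P.pke.dec n sk x with
  | none => none
  | some r =>
    if r.take (P.md n) = List.replicate (P.md n) true then
      some ((r.drop (P.md n)).take (P.mi n), r.drop (P.md n + P.mi n))
    else none

end Scheme

/-! ## The parties and their state -/

/-- What an honest webserver keeps after its enrolment: its decryption key and the encryption and
MAC keys it shares with the DCP. -/
structure ServerKeys where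
  decKey : Str
  encKey : Str
  macKey : Str

/-- An honest webserver: its signature key pair, the certificate on its public key, and the
outcome of its enrolment. -/
structure WebServer where
  pk : Str
  sk : Str
  cert : Str
  keys : Option ServerKeys

/-- A TLS session of an honest webserver in which it has detected a distress signal. -/
structure TLSSession where
  /-- whether the TLS peer is the user (or else the adversary) -/
  withUser : Bool
  /-- the client nonce -/
  hello : Str
  /-- the confirmation from the DCP, once it has arrived -/
  reply : Option Str

/-- An entry of the server database of the DCP. -/
structure ServerRecord where
  pk : Str
  encKey : Str
  macKey : Str

/-- An entry of the user database of the DCP. -/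
structure UserRecord where
  key : Str
  sqn : ℕ
  instruction : Str

/-- The user's current distress session: the website, the sequence number and the client nonce. -/
structure UserSession where
  site : Str
  sqn : ℕ
  hello : Str

/-- What the enrolled user stores. -/
structure User where
  id : Str
  key : Str
  sqn : ℕ
  pks : List (Str × Str)
  session : Option UserSession

/-- The events of a run that the guarantee speaks about. -/
inductive Event : Type
  /-- user `id` signals distress to website `B` with sequence number `m` -/
  | signalled (id B : Str) (m : ℕ)
  /-- the DCP receives through `B` the distress of user `id` with sequence number `m`, and all its
  checks succeed -/
  | received (id B : Str) (m : ℕ)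
  /-- user `id` successfully completes the distress protocol, started with website `B` and
  sequence number `m` -/
  | completed (id B : Str) (m : ℕ)

/-- The state of a run. -/
structure State where
  /-- the coins of the next calls -/
  tape : ℕ → Fin 4 → Str
  /-- the coins of the user and of the DCP for the exponents in the user's enrolment -/
  aUser : Str
  cUser : Str
  /-- the key pair of the certificate authority -/
  caPk : Str
  caSk : Str
  /-- the honest webservers, and the identities of the malicious ones -/
  honest : Str → Option WebServer
  corrupt : Str → Bool
  /-- the sessions of honest webservers, by webserver and `nonce_B` -/
  tls : Str × Str → Option TLSSession
  serverDB : Str → Option ServerRecord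
  userDB : Str → Option UserRecord
  user : Option User
  /-- the events so far, the oldest first -/
  trace : List Event

/-- The three kinds of adversaries: the network adversary, the local adversary, and malicious
webservers. -/
inductive Kind : Type
  | net : Kind
  | loc : Kind
  | web : Kind
  deriving DecidableEq

/-! ## The steps of the protocols

Each step returns an answer to the adversary and the next state, and is aborted by `none`. The
argument `r` holds fresh coins. The channels of the two enrolments are TLS sessions with the DCP:
an honest party's messages in them are neither visible to the adversary nor under its control. The
messages between webservers and the DCP in the distress protocol go over the network, that is
through the adversary. -/

namespace Scheme

variable (P : Scheme) (κ : Kind) (n : ℕ) (r : Fin 4 → Str)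

/-- The certificate authority certifies an honest webserver, unless the identity is taken. -/
def registerHonest (B : Str) (σ : State) : Option ((Str × Str) × State) :=
  if (σ.honest B).isSome || σ.corrupt B then none
  else
    let k := P.sig.gen n (r 0)
    let cert := P.sig.sign n σ.caSk (r 1) [B, k.1]
    some ((k.1, cert),
      { σ with honest := Function.update σ.honest B (some ⟨k.1, k.2, cert, none⟩) })

/-- The certificate authority certifies a public key of a malicious webserver, unless the identity
belongs to an honest webserver. -/
def registerCorrupt (B pk : Str) (σ : State) : Option (Str × State) :=
  if κ ≠ .web || (σ.honest B).isSome then none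
  else some (P.sig.sign n σ.caSk (r 0) [B, pk],
    { σ with corrupt := Function.update σ.corrupt B true })

/-- The DCP's part of the server enrolment, on `g^b, B, Cert_B, pk_B'` and the signature. -/
def dcpEnrolServer (c : Str) (gb B certPk cert pk' s : Str) (σ : State) :
    Option (Str × State) := do
  guard (P.sig.vrfy n σ.caPk [B, certPk] cert)
  guard (P.sig.vrfy n certPk [gb, B, pk'] s)
  let z ← P.dh.pow n gb c
  let gc ← P.dh.pow n (P.dh.base n) c
  pure (gc, { σ with
    serverDB := Function.update σ.serverDB B (some ⟨pk', P.kdfEnc n z, P.kdfMac n z⟩) })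

/-- Server enrolment of an honest webserver. Its new public key is public. -/
def enrolServer (B : Str) (σ : State) : Option (Str × State) := do
  let w ← σ.honest B
  let k := P.pke.gen n (r 0)
  let gb ← P.dh.pow n (P.dh.base n) (r 1)
  let s := P.sig.sign n w.sk (r 2) [gb, B, k.1]
  let (gc, σ') ← P.dcpEnrolServer n (r 3) gb B w.pk w.cert k.1 s σ
  let z ← P.dh.pow n gc (r 1)
  pure (k.1, { σ' with
    honest := Function.update σ'.honest B
      (some { w with keys := some ⟨k.2, P.kdfEnc n z, P.kdfMac n z⟩ }) })

/-- The adversary runs the server enrolment with the DCP. -/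
def enrolServerAs (gb B certPk cert pk' s : Str) (σ : State) : Option (Str × State) :=
  P.dcpEnrolServer n (r 0) gb B certPk cert pk' s σ

/-- The list of the public keys of those of the given websites that are enrolled. -/
def publicKeys (db : Str → Option ServerRecord) (sites : List Str) : List (Str × Str) :=
  sites.filterMap fun B => (db B).map fun e => (B, e.pk)

/-- The DCP's part of the user enrolment; the new identifier is random and not yet in use. -/
def dcpEnrolUser (rid c ga : Str) (sqn : ℕ) (instruction : Str) (sites : List Str) (σ : State) :
    Option ((Str × List (Str × Str) × Str) × State) := do
  let id := rid.take (P.mi n)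
  guard (σ.userDB id).isNone
  let z ← P.dh.pow n ga c
  let gc ← P.dh.pow n (P.dh.base n) c
  pure ((id, publicKeys σ.serverDB sites, gc),
    { σ with userDB := Function.update σ.userDB id (some ⟨P.kdfMac n z, sqn, instruction⟩) })

/-- The enrolment of the user, with the websites and the kind of confirmation that the user
chooses. -/
def enrolUser (sites : List Str) (instruction : Str) (σ : State) : Option (Unit × State) := do
  guard σ.user.isNone
  let sqn := toNat (r 0)
  let ga ← P.dh.pow n (P.dh.base n) σ.aUser
  let ((id, pks, gc), σ') ← P.dcpEnrolUser n (r 1) σ.cUser ga sqn instruction sites σ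
  let z ← P.dh.pow n gc σ.aUser
  pure ((), { σ' with user := some ⟨id, P.kdfMac n z, sqn, pks, none⟩ })

/-- The adversary enrols as a further user. -/
def enrolUserAs (ga : Str) (sqn : ℕ) (instruction : Str) (sites : List Str) (σ : State) :
    Option ((Str × List (Str × Str) × Str) × State) :=
  P.dcpEnrolUser n (r 0) (r 1) ga sqn instruction sites σ

/-- The user signals distress to website `B` and sends the distress nonce as its client nonce. -/
def signal (B : Str) (σ : State) : Option (Str × State) := do
  let u ← σ.user
  let pk ← u.pks.lookup B
  let tag := P.mac.tag n u.key [u.id, u.sqn.bits]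
  let nonceA := P.encodeDistress n pk (r 0) u.id tag
  pure (nonceA, { σ with
    user := some { u with sqn := u.sqn + 1, session := some ⟨B, u.sqn, nonceA⟩ }
    trace := σ.trace ++ [.signalled u.id B u.sqn] })

/-- The honest webserver `B` gets the client nonce `x` in a TLS handshake; if it decodes to a
distress signal, then `B` forwards it to the DCP. -/
def serverHello (withUser : Bool) (B x : Str) (σ : State) :
    Option ((Str × Str × Str × Str) × State) := do
  let w ← σ.honest B
  let k ← w.keys
  let (id, tag) ← P.decodeDistress n k.decKey x
  let c := P.sym.enc n k.encKey (r 0) [id, tag]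
  let nonceB := P.nonce n (r 1)
  pure ((B, c, nonceB, P.mac.tag n k.macKey [B, c, nonceB]),
    { σ with tls := Function.update σ.tls (B, nonceB) (some ⟨withUser, x, none⟩) })

/-- The client nonce of the user reaches the honest website of the user's current session. -/
def hello (σ : State) : Option ((Str × Str × Str × Str) × State) := do
  let u ← σ.user
  let v ← u.session
  P.serverHello n r true v.site v.hello σ

/-- The adversary opens a TLS connection of its own with an honest webserver. -/
def helloAs (B x : Str) (σ : State) : Option ((Str × Str × Str × Str) × State) :=
  P.serverHello n r false B x σ

/-- The DCP gets a message from the network that claims to come from webserver `B`. -/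
def toDCP (B c nonceB t : Str) (σ : State) : Option ((Str × Str × Str × Str) × State) := do
  let e ← σ.serverDB B
  guard (P.mac.vrfy n e.macKey [B, c, nonceB] t)
  match P.sym.dec n e.encKey c with
  | some [id, tag] => do
    let u ← σ.userDB id
    let i ← (List.range (P.nMax + 1)).find? fun i =>
      P.mac.vrfy n u.key [id, (u.sqn + i).bits] tag
    let m := u.sqn + i
    let s := P.mac.tag n u.key [m.bits]
    let c' := P.sym.enc n e.encKey (r 0) [u.instruction]
    let nonceC := P.nonce n (r 1)
    pure ((c', s, nonceC, P.mac.tag n e.macKey [c', s, nonceB, nonceC]),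
      { σ with
        userDB := Function.update σ.userDB id (some { u with sqn := m + 1 })
        trace := σ.trace ++ [.received id B m] })
  | _ => none

/-- The honest webserver `B` gets a reply from the network, in its session with `nonceB`. -/
def toServer (B nonceB c s nonceC t : Str) (σ : State) : Option (Unit × State) := do
  let w ← σ.honest B
  let k ← w.keys
  let v ← σ.tls (B, nonceB)
  guard (P.mac.vrfy n k.macKey [c, s, nonceB, nonceC] t)
  let _ ← P.sym.dec n k.encKey c
  pure ((), { σ with tls := Function.update σ.tls (B, nonceB) (some { v with reply := some s }) })

/-- The user gets page content with the value `s` in the current session and verifies it. -/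
def userCheck (s : Str) (σ : State) : State :=
  match σ.user with
  | none => σ
  | some u =>
    match u.session with
    | none => σ
    | some v =>
      if P.mac.vrfy n u.key [v.sqn.bits] s then
        { σ with
          user := some { u with session := none }
          trace := σ.trace ++ [.completed u.id v.site v.sqn] }
      else σ

/-- The honest webserver `B` sends the confirmation to its TLS peer. The TLS session between the
user and the webserver hides it from the adversary, except from the local one. -/
def page (B nonceB : Str) (σ : State) : Option (Option Str × State) := do
  let v ← σ.tls (B, nonceB)
  let s ← v.reply
  if v.withUser then do
    let u ← σ.user
    let w ← u.session
    guard (w.site = B ∧ w.hello = v.hello)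
    pure (if κ = .loc then some s else none, P.userCheck n s σ)
  else pure (some s, σ)

/-- The adversary chooses the page content that the user gets in the current session: the local
adversary always, and malicious webservers in a session with one of them. -/
def inject (s : Str) (σ : State) : Option (Unit × State) := do
  let u ← σ.user
  let v ← u.session
  guard (κ = .loc ∨ (κ = .web ∧ σ.corrupt v.site = true))
  pure ((), P.userCheck n s σ)

end Scheme

/-! ## The experiment -/

/-- The calls of the adversary. -/
inductive Call : Type
  | caPublicKey
  | registerHonest
  | registerCorrupt
  | enrolServer
  | enrolServerAs
  | enrolUser
  | enrolUserAs
  | signal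
  | hello
  | helloAs
  | toDCP
  | toServer
  | page
  | inject

/-- The interface between the adversary and the honest parties. -/
def protocolInterface : Interface where
  Op := Call
  dom
    | .caPublicKey => .unit
    | .registerHonest => bits
    | .registerCorrupt => .prod bits bits
    | .enrolServer => bits
    | .enrolServerAs => .prod bits (.prod bits (.prod bits (.prod bits (.prod bits bits))))
    | .enrolUser => .prod (.list bits) bits
    | .enrolUserAs => .prod bits (.prod .nat (.prod bits (.list bits)))
    | .signal => bits
    | .hello => .unit
    | .helloAs => .prod bits bits
    | .toDCP => .prod bits (.prod bits (.prod bits bits))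
    | .toServer => .prod bits (.prod bits (.prod bits (.prod bits (.prod bits bits))))
    | .page => .prod bits bits
    | .inject => bits
  cod
    | .caPublicKey => .opt bits
    | .registerHonest => .opt (.prod bits bits)
    | .registerCorrupt => .opt bits
    | .enrolServer => .opt bits
    | .enrolServerAs => .opt bits
    | .enrolUser => .opt .unit
    | .enrolUserAs => .opt (.prod bits (.prod (.list (.prod bits bits)) bits))
    | .signal => .opt bits
    | .hello => .opt (.prod bits (.prod bits (.prod bits bits)))
    | .helloAs => .opt (.prod bits (.prod bits (.prod bits bits)))
    | .toDCP => .opt (.prod bits (.prod bits (.prod bits bits)))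
    | .toServer => .opt .unit
    | .page => .opt (.opt bits)
    | .inject => .opt .unit

/-- Execution of a step: it uses up its coins, and nothing else changes if it is aborted. -/
def perform {α : Type} (f : (Fin 4 → Str) → State → Option (α × State)) (σ : State) :
    Option α × State :=
  let σ' : State := { σ with tape := fun j => σ.tape (j + 1) }
  match f (σ.tape 0) σ' with
  | none => (none, σ')
  | some (y, σ'') => (some y, σ'')

/-- The guarantee, for a sequence of events: whenever the user completes a distress session, the
DCP has received this very distress after the user signalled it; and this was the last signal. -/
def Assured (tr : List Event) : Prop :=
  ∀ (pre post : List Event) (id B : Str) (m : ℕ), tr = pre ++ .completed id B m :: post →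
    ∃ past recent : List Event, pre = past ++ .signalled id B m :: recent ∧
      (∃ B', .received id B' m ∈ recent) ∧
      ∀ id' B' m', .signalled id' B' m' ∉ recent

namespace Scheme

/-- The coins of the honest parties: the exponents of user and DCP in the user's enrolment, the
key generation of the certificate authority, and the coins of the calls. -/
abbrev Seed (P : Scheme) (n t : ℕ) : Type :=
  (Coins P.ℓ n × Coins P.ℓ n) × Coins P.ℓ n × (Fin t → Fin 4 → Coins P.ℓ n)

/-- The initial state. -/
def start (P : Scheme) (n t : ℕ) (s : P.Seed n t) : State where
  tape j l := if h : j < t then List.ofFn (s.2.2 ⟨j, h⟩ l) else []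
  aUser := List.ofFn s.1.1
  cUser := List.ofFn s.1.2
  caPk := (P.sig.gen n (List.ofFn s.2.1)).1
  caSk := (P.sig.gen n (List.ofFn s.2.1)).2
  honest _ := none
  corrupt _ := false
  tls _ := none
  serverDB _ := none
  userDB _ := none
  user := none
  trace := []

/-- The experiment in which an adversary of kind `κ` attacks the protocols. It wins if, at some
point, the user has successfully completed the distress protocol without the DCP having recently
received the distress. -/
def attack (P : Scheme) (κ : Kind) : Experiment protocolInterface where
  State := State
  Seed := P.Seed
  start := P.start
  handle n i := match i with
    | .caPublicKey => fun _ => perform fun _ σ => some (σ.caPk, σ)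
    | .registerHonest => fun (B : Str) => perform fun r => P.registerHonest n r B
    | .registerCorrupt => fun (x : Str × Str) =>
      perform fun r => P.registerCorrupt κ n r x.1 x.2
    | .enrolServer => fun (B : Str) => perform fun r => P.enrolServer n r B
    | .enrolServerAs => fun (x : Str × Str × Str × Str × Str × Str) =>
      perform fun r =>
        P.enrolServerAs n r x.1 x.2.1 x.2.2.1 x.2.2.2.1 x.2.2.2.2.1 x.2.2.2.2.2
    | .enrolUser => fun (x : List Str × Str) => perform fun r => P.enrolUser n r x.1 x.2
    | .enrolUserAs => fun (x : Str × ℕ × Str × List Str) =>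
      perform fun r => P.enrolUserAs n r x.1 x.2.1 x.2.2.1 x.2.2.2
    | .signal => fun (B : Str) => perform fun r => P.signal n r B
    | .hello => fun _ => perform fun r => P.hello n r
    | .helloAs => fun (x : Str × Str) => perform fun r => P.helloAs n r x.1 x.2
    | .toDCP => fun (x : Str × Str × Str × Str) =>
      perform fun r => P.toDCP n r x.1 x.2.1 x.2.2.1 x.2.2.2
    | .toServer => fun (x : Str × Str × Str × Str × Str × Str) =>
      perform fun _ => P.toServer n x.1 x.2.1 x.2.2.1 x.2.2.2.1 x.2.2.2.2.1 x.2.2.2.2.2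
    | .page => fun (x : Str × Str) => perform fun _ => P.page κ n x.1 x.2
    | .inject => fun (s : Str) => perform fun _ => P.inject κ n s
  Won σ := ¬ Assured σ.trace

end Scheme

end

end Distress

/-!
The guarantee reduces to the security of the MAC, for the key that the user shares with the DCP.

**Runs without a forgery are safe.** In a run, the key of the user is used only by the user, who
tags `(id, m)` when it signals distress number `m`, and by the DCP, which tags `m` when it
receives the distress `(id, m)`. As long as nobody presents a valid tag for another message, the
DCP receives `(id, m)` only after the user has signalled it, and the user accepts a confirmation
of `m` only after the DCP has received `(id, m)`. The sequence number of the user increases with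
every signal, so that `(id, m)` cannot have been received before the signal that started the
current session, which is also the last signal. This is the invariant `Safe`, preserved by
signals, receptions and completions (`Safe.signal`, `Safe.toDCP`, `Safe.complete`). Whatever the
adversary does to the messages between the parties, it cannot make a tag.

**Reduction.** An adversary against the protocols is turned into one against the MAC, which runs
the given program and plays all honest parties itself, except that it asks its oracles for the
tags under the key of the user and for their verification (`simHandle`). The state of the
protocols is a function of the state of this simulator and the events (`Sim.toState`), each answer
is exactly that of the protocols, and a run remains safe unless a forgery is submitted to the
verification oracle (`simHandle_spec`). The coins of the two experiments correspond bijectively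
(`splitCoins_bijective`), so that success against the protocols is at most as likely as a forgery.

**Running time.** The reduction has to be a program that runs in polynomial time. `Comp` and
`CompIn` are closed under the constructions that the simulated parties use, without and with calls
to the oracles. `Code.simulate` replaces the calls of a program by programs that carry a state
along, and `Code.simulates` bounds its cost by that of the original program times the size of the
state. This size is polynomial because every step adds boundedly many entries to the tables of the
simulator, each longer than the previous ones by a bounded amount (`Small.simHandle`).
-/

namespace Distress

/-! ### Programs without calls -/

theorem eval_mono (p : Polynomial ℕ) {a b : ℕ} (h : a ≤ b) : p.eval a ≤ p.eval b := by
  rw [Polynomial.eval_eq_sum, Polynomial.eval_eq_sum]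
  exact Finset.sum_le_sum fun i _ => Nat.mul_le_mul_left _ (Nat.pow_le_pow_left h i)

/-- A program has to write its output, so that the number of steps bounds the size of the output. -/
theorem Code.size_le_cost {I : Interface} {S : Type}
    (h : (i : I.Op) → (I.dom i).den → S → (I.cod i).den × S) {a b : Ty} (c : Code I a b) :
    ∀ x s, b.size (c.run h x s).1 ≤ (c.run h x s).2.2 := by
  induction c with
  | comp g f ihg ihf =>
    intro x s
    have := ihg (f.run h x s).1 (f.run h x s).2.1
    simp only [Code.run]; omega
  | pair f g ihf ihg =>
    intro x s
    have h1 := ihf x s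
    have h2 := ihg x (f.run h x s).2.1
    simp only [Code.run, Ty.size]; omega
  | cond t f g iht ihf ihg =>
    intro x s
    have h1 := ihf x (t.run h x s).2.1
    have h2 := ihg x (t.run h x s).2.1
    simp only [Code.run]
    cases (t.run h x s).1 <;> simp only <;> omega
  | elim f g ihf ihg =>
    rintro ⟨x, _ | y⟩ s
    · have h1 := ihf x s
      simp only [Code.run]; omega
    · have h1 := ihg (x, y) s
      simp only [Code.run]; omega
  | @fold a b c f ih =>
    rintro ⟨x, l, y⟩ s
    rcases List.eq_nil_or_concat l with rfl | ⟨l', e, rfl⟩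
    · simp only [Code.run, List.foldl_nil, Ty.size]; omega
    · simp only [Code.run, List.concat_eq_append, List.foldl_append, List.foldl_cons,
        List.foldl_nil]
      refine (ih _ _).trans ?_
      omega
  | call i => intro x s; simp only [Code.run]; omega
  | _ => intro x s; simp only [Code.run, basic]; omega

/-- A program without calls runs in every experiment. -/
def Code.lift {I : Interface} : {a b : Ty} → Code .empty a b → Code I a b
  | _, _, .id => .id
  | _, _, .comp g f => .comp g.lift f.lift
  | _, _, .star => .star
  | _, _, .pair f g => .pair f.lift g.lift
  | _, _, .fst => .fst
  | _, _, .snd => .snd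
  | _, _, .true => .true
  | _, _, .false => .false
  | _, _, .cond t f g => .cond t.lift f.lift g.lift
  | _, _, .eq => .eq
  | _, _, .none => .none
  | _, _, .some => .some
  | _, _, .elim f g => .elim f.lift g.lift
  | _, _, .nil => .nil
  | _, _, .cons => .cons
  | _, _, .uncons => .uncons
  | _, _, .append => .append
  | _, _, .length => .length
  | _, _, .take => .take
  | _, _, .drop => .drop
  | _, _, .lookup => .lookup
  | _, _, .fold f => .fold f.lift
  | _, _, .succ => .succ
  | _, _, .digits => .digits
  | _, _, .ofDigits => .ofDigits
  | _, _, .call i => Empty.elim i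

/-- Execution of a program without calls. -/
abbrev Code.exec {a b : Ty} (c : Code .empty a b) (x : a.den) : b.den × Unit × ℕ :=
  c.run (S := Unit) (fun i => Empty.elim i) x ()

theorem Code.run_lift {I : Interface} {S : Type}
    (h : (i : I.Op) → (I.dom i).den → S → (I.cod i).den × S) {a b : Ty} (c : Code .empty a b) :
    ∀ x s, c.lift.run h x s = ((c.exec x).1, s, (c.exec x).2.2) := by
  induction c with
  | comp g f ihg ihf => intro x s; simp only [Code.lift, Code.exec, Code.run, ihf, ihg]
  | pair f g ihf ihg => intro x s; simp only [Code.lift, Code.exec, Code.run, ihf, ihg]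
  | cond t f g iht ihf ihg =>
    intro x s
    simp only [Code.lift, Code.exec, Code.run, iht]
    cases (t.run (S := Unit) (fun i => Empty.elim i) x ()).1 <;> simp only [ihf, ihg]
  | elim f g ihf ihg =>
    rintro ⟨x, _ | y⟩ s <;> simp only [Code.lift, Code.exec, Code.run, ihf, ihg]
  | @fold a b c f ih =>
    rintro ⟨x, l, y⟩ s
    simp only [Code.lift, Code.exec, Code.run]
    generalize 1 + Ty.size (.prod c (.prod (.list a) b)) (x, l, y) = t
    induction l generalizing y t with
    | nil => rfl
    | cons e l ihl => simp only [List.foldl_cons, ih] at ihl ⊢; exact ihl _ _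
  | call i => exact Empty.elim i
  | _ => intro x s; simp only [Code.lift, Code.exec, Code.run, basic]

/-! ### Functions computable in polynomial time -/

/-- A type that is the type of values of a data type, which is recorded. The equality of the two is
definitional in all instances below; lemmas about an arbitrary `α` eliminate it by `obtain`. -/
class Data (α : Type) where
  ty : Ty
  den_eq : ty.den = α

instance : Data Unit := ⟨.unit, rfl⟩
instance : Data Bool := ⟨.bool, rfl⟩
instance : Data ℕ := ⟨.nat, rfl⟩
instance {α β : Type} [Data α] [Data β] : Data (α × β) :=
  ⟨.prod (Data.ty α) (Data.ty β), congrArg₂ Prod Data.den_eq Data.den_eq⟩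
instance {α : Type} [Data α] : Data (Option α) := ⟨.opt (Data.ty α), congrArg Option Data.den_eq⟩
instance {α : Type} [Data α] : Data (List α) := ⟨.list (Data.ty α), congrArg List Data.den_eq⟩

/-- A value, as a value of the data type. -/
abbrev Data.enc {α : Type} [Data α] (x : α) : (Data.ty α).den := cast Data.den_eq.symm x

/-- The size of a value. -/
def dsize {α : Type} [Data α] (x : α) : ℕ := (Data.ty α).size (Data.enc x)

section

variable {α β γ δ : Type} [iα : Data α] [iβ : Data β] [iγ : Data γ] [iδ : Data δ]

theorem dsize_unit (x : Unit) : dsize x = 1 := rfl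

theorem dsize_bool (x : Bool) : dsize x = 1 := rfl

theorem dsize_nat (x : ℕ) : dsize x = 1 + Nat.size x := rfl

theorem dsize_prod (x : α) (y : β) : dsize (x, y) = 1 + dsize x + dsize y := by
  obtain ⟨a, rfl⟩ := iα
  obtain ⟨b, rfl⟩ := iβ
  rfl

theorem dsize_none : dsize (none : Option α) = 1 := by
  obtain ⟨a, rfl⟩ := iα
  rfl

theorem dsize_some (x : α) : dsize (some x) = 1 + dsize x := by
  obtain ⟨a, rfl⟩ := iα
  rfl

theorem dsize_list (l : List α) : dsize l = 1 + (l.map fun y => 1 + dsize y).sum := by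
  obtain ⟨a, rfl⟩ := iα
  rfl

theorem dsize_nil : dsize ([] : List α) = 1 := by simp [dsize_list]

theorem dsize_cons (x : α) (l : List α) : dsize (x :: l) = 1 + dsize x + dsize l := by
  simp [dsize_list]; omega

theorem dsize_append (l l' : List α) : dsize (l ++ l') + 1 = dsize l + dsize l' := by
  simp [dsize_list]; omega

theorem dsize_sublist {l l' : List α} (h : l.Sublist l') : dsize l ≤ dsize l' := by
  simp only [dsize_list]
  have := (h.map fun y => 1 + dsize y).sum_le_sum (by simp)
  omega

theorem dsize_mem {x : α} {l : List α} (h : x ∈ l) : dsize x < dsize l := by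
  have := dsize_sublist (List.singleton_sublist.2 h)
  rw [dsize_cons, dsize_nil] at this
  omega

theorem length_lt_dsize (l : List α) : l.length < dsize l := by
  induction l with
  | nil => simp [dsize_nil]
  | cons x l ih => rw [dsize_cons, List.length_cons]; omega

theorem dsize_list_le {l : List α} {k m : ℕ} (hl : l.length ≤ k) (hm : ∀ x ∈ l, dsize x ≤ m) :
    dsize l ≤ 1 + k * (1 + m) := by
  induction l generalizing k with
  | nil => simp [dsize_nil]
  | cons x l ih =>
    obtain ⟨k, rfl⟩ : ∃ j, k = j + 1 := ⟨k - 1, by simp at hl; omega⟩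
    have h1 := ih (k := k) (by simpa using hl) fun y hy => hm y (by simp [hy])
    have h2 := hm x (by simp)
    rw [dsize_cons]
    linarith [add_mul k 1 (1 + m)]

theorem dsize_replicate_unit (n : ℕ) : dsize (List.replicate n ()) = 1 + 2 * n := by
  simp [dsize_list, dsize_unit]; omega

theorem dsize_str (x : Str) : dsize x = 1 + 2 * x.length := by
  simp [dsize_list, dsize_bool]; omega

/-- A function that can be computed, without calls, in time polynomial in the size of the
argument. -/
@[fun_prop]
def Comp (f : α → β) : Prop :=
  ∃ (c : Code .empty (Data.ty α) (Data.ty β)) (p : Polynomial ℕ), ∀ x,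
    (c.exec (Data.enc x)).1 = Data.enc (f x) ∧ (c.exec (Data.enc x)).2.2 ≤ p.eval (dsize x)

/-- The output has polynomial size, since a program has to write it. -/
protected theorem Comp.dsize_le {f : α → β} (hf : Comp f) :
    ∃ p : Polynomial ℕ, ∀ x, dsize (f x) ≤ p.eval (dsize x) := by
  obtain ⟨c, p, h⟩ := hf
  refine ⟨p, fun x => le_trans ?_ (h x).2⟩
  unfold dsize
  rw [← (h x).1]
  exact c.size_le_cost _ _ _

protected theorem Comp.of_basic {f : α → β} (c : Code .empty (Data.ty α) (Data.ty β))
    (p : Polynomial ℕ)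
    (hc : ∀ x, c.exec (Data.enc x) = (Data.enc (f x), (), 1 + dsize x + dsize (f x)))
    (hp : ∀ x, dsize (f x) ≤ p.eval (dsize x)) : Comp f := by
  refine ⟨c, 1 + .X + p, fun x => ?_⟩
  rw [hc]
  have := hp x
  simpa using this

protected theorem Comp.congr {f g : α → β} (hf : Comp f) (h : ∀ x, f x = g x) : Comp g :=
  funext h ▸ hf

@[fun_prop]
protected theorem Comp.id : Comp fun x : α => x :=
  .of_basic .id .X (fun _ => rfl) (by simp)

@[fun_prop]
protected theorem Comp.comp {g : β → γ} {f : α → β} (hg : Comp g) (hf : Comp f) :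
    Comp fun x => g (f x) := by
  obtain ⟨q, hq⟩ := hf.dsize_le
  obtain ⟨c, p, h⟩ := hf
  obtain ⟨c', p', h'⟩ := hg
  refine ⟨.comp c' c, 1 + p + p'.comp q, fun x => ?_⟩
  have h1 := (h' (f x)).2.trans (eval_mono p' (hq x))
  have h2 := (h x).2
  simp only [Code.exec, Code.run] at *
  rw [(h x).1]
  refine ⟨(h' _).1, ?_⟩
  simp only [Polynomial.eval_add, Polynomial.eval_one, Polynomial.eval_comp]
  exact Nat.add_le_add (Nat.add_le_add le_rfl h2) h1

@[fun_prop]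
protected theorem Comp.prodMk {f : α → β} {g : α → γ} (hf : Comp f) (hg : Comp g) :
    Comp fun x => (f x, g x) := by
  obtain ⟨c, p, h⟩ := hf
  obtain ⟨c', p', h'⟩ := hg
  obtain ⟨a, rfl⟩ := iα
  let _ := Data.mk a rfl
  obtain ⟨b, rfl⟩ := iβ
  let _ := Data.mk b rfl
  obtain ⟨d, rfl⟩ := iγ
  let _ := Data.mk d rfl
  refine ⟨.pair c c', 1 + .X + p + p', fun x => ⟨Prod.ext (h x).1 (h' x).1, ?_⟩⟩
  simp only [Polynomial.eval_add, Polynomial.eval_one, Polynomial.eval_X]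
  exact Nat.add_le_add (Nat.add_le_add le_rfl (h x).2) (h' x).2

@[fun_prop]
protected theorem Comp.fst : Comp (Prod.fst : α × β → α) := by
  obtain ⟨a, rfl⟩ := iα
  let _ := Data.mk a rfl
  obtain ⟨b, rfl⟩ := iβ
  let _ := Data.mk b rfl
  refine .of_basic .fst .X (fun _ => rfl) ?_
  rintro ⟨x, y⟩
  simp [dsize_prod]; omega

@[fun_prop]
protected theorem Comp.snd : Comp (Prod.snd : α × β → β) := by
  obtain ⟨a, rfl⟩ := iα
  let _ := Data.mk a rfl
  obtain ⟨b, rfl⟩ := iβ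
  let _ := Data.mk b rfl
  refine .of_basic .snd .X (fun _ => rfl) ?_
  rintro ⟨x, y⟩
  simp [dsize_prod]

@[fun_prop]
protected theorem Comp.some {f : α → β} (hf : Comp f) : Comp fun x => Option.some (f x) := by
  refine Comp.comp (g := Option.some) ?_ hf
  obtain ⟨b, rfl⟩ := iβ
  let _ := Data.mk b rfl
  exact .of_basic .some (1 + .X) (fun _ => rfl) (by simp [dsize_some])

@[fun_prop]
protected theorem Comp.cons {f : α → β} {g : α → List β} (hf : Comp f) (hg : Comp g) :
    Comp fun x => f x :: g x := by
  refine Comp.comp (g := fun y : β × List β => y.1 :: y.2) ?_ (hf.prodMk hg)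
  obtain ⟨b, rfl⟩ := iβ
  let _ := Data.mk b rfl
  refine .of_basic .cons .X (fun _ => rfl) ?_
  rintro ⟨x, y⟩
  simp [dsize_prod, dsize_cons]

@[fun_prop]
protected theorem Comp.succ {f : α → ℕ} (hf : Comp f) : Comp fun x => f x + 1 := by
  refine Comp.comp (g := fun k => k + 1) ?_ hf
  refine .of_basic .succ (1 + .X) (fun _ => rfl) fun k => ?_
  have : Nat.size (k + 1) ≤ Nat.size k + 1 := by
    rw [Nat.size_le, pow_succ]
    have := Nat.lt_size_self k
    omega
  simp [dsize_nat]; omega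

@[fun_prop]
protected theorem Comp.add_const {f : α → ℕ} (hf : Comp f) (j : ℕ) : Comp fun x => f x + j := by
  induction j with
  | zero => exact hf
  | succ j ih => exact ih.succ

@[fun_prop]
protected theorem Comp.append {f g : α → List β} (hf : Comp f) (hg : Comp g) :
    Comp fun x => f x ++ g x := by
  refine Comp.comp (g := fun y : List β × List β => y.1 ++ y.2) ?_ (hf.prodMk hg)
  obtain ⟨b, rfl⟩ := iβ
  let _ := Data.mk b rfl
  refine .of_basic .append .X (fun _ => rfl) ?_
  rintro ⟨x, y⟩
  have := dsize_append x y
  simp [dsize_prod]; omega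

@[fun_prop]
protected theorem Comp.length {f : α → List β} (hf : Comp f) : Comp fun x => (f x).length := by
  refine Comp.comp (g := fun y : List β => y.length) ?_ hf
  obtain ⟨b, rfl⟩ := iβ
  let _ := Data.mk b rfl
  refine .of_basic .length (1 + .X) (fun _ => rfl) fun l => ?_
  have h1 : Nat.size l.length ≤ l.length := Nat.size_le.2 Nat.lt_two_pow_self
  have h2 := length_lt_dsize l
  simp [dsize_nat]; omega

@[fun_prop]
protected theorem Comp.take {f : α → ℕ} {g : α → List β} (hf : Comp f) (hg : Comp g) :
    Comp fun x => (g x).take (f x) := by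
  refine Comp.comp (g := fun y : ℕ × List β => y.2.take y.1) ?_ (hf.prodMk hg)
  obtain ⟨b, rfl⟩ := iβ
  let _ := Data.mk b rfl
  refine .of_basic .take .X (fun _ => rfl) ?_
  rintro ⟨x, y⟩
  have := dsize_sublist (List.take_sublist x y)
  simp [dsize_prod]; omega

@[fun_prop]
protected theorem Comp.drop {f : α → ℕ} {g : α → List β} (hf : Comp f) (hg : Comp g) :
    Comp fun x => (g x).drop (f x) := by
  refine Comp.comp (g := fun y : ℕ × List β => y.2.drop y.1) ?_ (hf.prodMk hg)
  obtain ⟨b, rfl⟩ := iβ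
  let _ := Data.mk b rfl
  refine .of_basic .drop .X (fun _ => rfl) ?_
  rintro ⟨x, y⟩
  have := dsize_sublist (List.drop_sublist x y)
  simp [dsize_prod]; omega

@[fun_prop]
protected theorem Comp.bits {f : α → ℕ} (hf : Comp f) : Comp fun x => (f x).bits := by
  refine Comp.comp (g := Nat.bits) ?_ hf
  refine .of_basic .digits (1 + 2 * .X) (fun _ => rfl) fun k => ?_
  simp [dsize_nat, dsize_str, Nat.size_eq_bits_len]

theorem toNat_lt (x : Str) : toNat x < 2 ^ x.length := by
  induction x with
  | nil => simp [toNat]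
  | cons b x ih =>
    rw [List.length_cons, pow_succ]
    change Nat.bit b (toNat x) < _
    cases b <;> simp only [Nat.bit, cond_true, cond_false] <;> omega

@[fun_prop]
protected theorem Comp.toNat {f : α → Str} (hf : Comp f) : Comp fun x => toNat (f x) := by
  refine Comp.comp (g := Distress.toNat) ?_ hf
  refine .of_basic .ofDigits (1 + .X) (fun _ => rfl) fun x => ?_
  have := Nat.size_le.2 (toNat_lt x)
  simp [dsize_nat, dsize_str]; omega

@[fun_prop]
protected theorem Comp.decide_eq [DecidableEq β] {f g : α → β} (hf : Comp f) (hg : Comp g) :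
    Comp fun x => decide (f x = g x) := by
  refine Comp.comp (g := fun y : β × β => decide (y.1 = y.2)) ?_ (hf.prodMk hg)
  obtain ⟨b, rfl⟩ := iβ
  let _ := Data.mk b rfl
  refine .of_basic .eq 1 (fun x => ?_) (by simp [dsize_bool])
  simp only [Code.exec, Code.run, basic]
  congr 2

/-- Evaluation of an association list: the first entry counts. -/
def assoc [DecidableEq α] (l : List (α × β)) (x : α) : Option β :=
  (l.find? fun e => decide (e.1 = x)).map fun e => e.2

@[fun_prop]
protected theorem Comp.assoc [DecidableEq β] {f : α → β} {g : α → List (β × γ)} (hf : Comp f)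
    (hg : Comp g) : Comp fun x => assoc (g x) (f x) := by
  refine Comp.comp (g := fun y : β × List (β × γ) => Distress.assoc y.2 y.1) ?_ (hf.prodMk hg)
  obtain ⟨b, rfl⟩ := iβ
  let _ := Data.mk b rfl
  obtain ⟨c, rfl⟩ := iγ
  let _ := Data.mk c rfl
  have hd : ∀ x : b.den × List (b.den × c.den),
      dsize (Distress.assoc x.2 x.1) ≤ (1 + .X : Polynomial ℕ).eval (dsize x) := by
    rintro ⟨x, l⟩
    unfold Distress.assoc
    cases h : l.find? fun e => decide (e.1 = x) with
    | none => simp [dsize_none]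
    | some e =>
      have h1 := dsize_mem (List.mem_of_find?_eq_some h)
      obtain ⟨e1, e2⟩ := e
      simp only [Option.map_some, dsize_some, dsize_prod, Polynomial.eval_add,
        Polynomial.eval_one, Polynomial.eval_X] at *
      omega
  refine .of_basic .lookup (1 + .X) (fun x => ?_) hd
  have : Distress.assoc x.2 x.1 =
      (x.2.find? fun e => @decide (e.1 = x.1) (b.decEq e.1 x.1)).map fun e => e.2 := by
    unfold Distress.assoc
    congr!
  rw [this]
  rfl

@[fun_prop]
protected theorem Comp.bif {t : α → Bool} {f g : α → β} (ht : Comp t) (hf : Comp f) (hg : Comp g) :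
    Comp fun x => bif t x then f x else g x := by
  obtain ⟨c, p, h⟩ := ht
  obtain ⟨c', p', h'⟩ := hf
  obtain ⟨c'', p'', h''⟩ := hg
  obtain ⟨a, rfl⟩ := iα
  obtain ⟨b, rfl⟩ := iβ
  refine ⟨.cond c c' c'', 1 + .X + p + (p' + p''), fun x => ?_⟩
  have h1 := (h x).1
  have h2 := (h x).2
  have h3 := (h' x).2
  have h4 := (h'' x).2
  simp only [Code.exec] at h1 h2 h3 h4
  simp only [Code.exec, Code.run, h1, Polynomial.eval_add, Polynomial.eval_one,
    Polynomial.eval_X]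
  simp only [Data.enc, cast_eq] at *
  unfold dsize at *
  simp only [Data.enc, cast_eq] at *
  cases t x with
  | true =>
    exact ⟨(h' x).1, Nat.add_le_add (Nat.add_le_add le_rfl h2) (h3.trans (Nat.le_add_right _ _))⟩
  | false =>
    exact ⟨(h'' x).1, Nat.add_le_add (Nat.add_le_add le_rfl h2) (h4.trans (Nat.le_add_left _ _))⟩

@[fun_prop]
protected theorem Comp.elim {o : α → Option β} {f : α → γ} {g : α → β → γ} (ho : Comp o)
    (hf : Comp f) (hg : Comp fun y : α × β => g y.1 y.2) :
    Comp fun x => (o x).elim (f x) (g x) := by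
  refine Comp.comp (g := fun y : α × Option β => y.2.elim (f y.1) (g y.1)) ?_ (.prodMk .id ho)
  obtain ⟨c, p, h⟩ := hf
  obtain ⟨c', p', h'⟩ := hg
  obtain ⟨a, rfl⟩ := iα
  obtain ⟨b, rfl⟩ := iβ
  obtain ⟨d, rfl⟩ := iγ
  let _ := Data.mk a rfl
  let _ := Data.mk b rfl
  refine ⟨.elim c c', 1 + .X + (p + p'), fun ⟨x, y⟩ => ?_⟩
  simp only [Polynomial.eval_add, Polynomial.eval_one, Polynomial.eval_X]
  cases y with
  | none =>
    refine ⟨(h x).1, ?_⟩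
    have h1 := (h x).2
    have h2 : dsize x ≤ dsize (x, (none : Option b.den)) := by rw [dsize_prod]; omega
    have h3 := eval_mono p h2
    refine Nat.add_le_add (le_refl _) (h1.trans ?_)
    omega
  | some y =>
    refine ⟨(h' (x, y)).1, ?_⟩
    have h1 := (h' (x, y)).2
    have h2 : dsize (x, y) ≤ dsize (x, Option.some y) := by
      rw [dsize_prod, dsize_prod, dsize_some]; omega
    have h3 := eval_mono p' h2
    refine Nat.add_le_add (le_refl _) (h1.trans ?_)
    omega

/-- Every value has a program that builds it; its length does not matter, as the value is fixed. -/
protected theorem Comp.const_den (b : Ty) : ∀ v : b.den,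
    @Comp α b.den iα ⟨b, rfl⟩ fun _ => v := by
  induction b with
  | unit => exact fun v => .of_basic .star 1 (fun _ => rfl) (by simp [dsize_unit])
  | bool =>
    rintro (_ | _)
    · exact .of_basic .false 1 (fun _ => rfl) (by simp [dsize_bool])
    · exact .of_basic .true 1 (fun _ => rfl) (by simp [dsize_bool])
  | prod a b iha ihb =>
    let _ := Data.mk a rfl
    let _ := Data.mk b rfl
    exact fun v => (iha v.1).prodMk (ihb v.2)
  | opt a ih =>
    let _ := Data.mk a rfl
    rintro (_ | v)
    · exact .of_basic .none 1 (fun _ => rfl) (fun x => by simp [dsize_none])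
    · exact (ih v).some
  | list a ih =>
    let _ := Data.mk a rfl
    intro l
    induction l with
    | nil => exact .of_basic .nil 1 (fun _ => rfl) (fun x => by simp [dsize_nil])
    | cons v l ihl => exact (ih v).cons ihl
  | nat =>
    intro k
    induction k with
    | zero =>
      refine Comp.comp (g := fun y : List Unit => y.length) (f := fun _ => [])
        (Comp.length .id) ?_
      exact .of_basic .nil 1 (fun _ => rfl) (fun x => by simp [dsize_nil])
    | succ k ih => exact ih.succ

@[fun_prop]
protected theorem Comp.const (v : β) : Comp fun _ : α => v := by
  obtain ⟨b, rfl⟩ := iβ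
  exact Comp.const_den b v

@[fun_prop]
protected theorem Comp.and {f g : α → Bool} (hf : Comp f) (hg : Comp g) :
    Comp fun x => f x && g x := by
  refine (hf.bif hg (Comp.const false)).congr fun x => ?_
  cases f x <;> rfl

@[fun_prop]
protected theorem Comp.or {f g : α → Bool} (hf : Comp f) (hg : Comp g) :
    Comp fun x => f x || g x := by
  refine (hf.bif (Comp.const true) hg).congr fun x => ?_
  cases f x <;> rfl

@[fun_prop]
protected theorem Comp.isSome {f : α → Option β} (hf : Comp f) : Comp fun x => (f x).isSome := by
  refine Comp.congr (f := fun x => (f x).elim false fun _ => true) (by fun_prop) fun x => ?_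
  cases f x <;> rfl

@[fun_prop]
protected theorem Comp.isNone {f : α → Option β} (hf : Comp f) : Comp fun x => (f x).isNone := by
  refine Comp.congr (f := fun x => (f x).elim true fun _ => false) (by fun_prop) fun x => ?_
  cases f x <;> rfl

@[fun_prop]
protected theorem Comp.option_bind {f : α → Option β} {g : α → β → Option γ} (hf : Comp f)
    (hg : Comp fun y : α × β => g y.1 y.2) : Comp fun x => (f x).bind (g x) := by
  refine Comp.congr (f := fun x => (f x).elim Option.none (g x)) (by fun_prop) fun x => ?_
  cases f x <;> rfl

@[fun_prop]
protected theorem Comp.option_map {f : α → Option β} {g : α → β → γ} (hf : Comp f)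
    (hg : Comp fun y : α × β => g y.1 y.2) : Comp fun x => (f x).map (g x) := by
  refine Comp.congr (f := fun x => (f x).elim Option.none fun y => Option.some (g x y))
    (by fun_prop) fun x => ?_
  cases f x <;> rfl

@[fun_prop]
protected theorem Comp.head? {f : α → List β} (hf : Comp f) : Comp fun x => (f x).head? := by
  refine Comp.comp (g := fun l : List β => l.head?) ?_ hf
  refine Comp.congr (f := fun l => (match l with
    | [] => Option.none
    | z :: zs => Option.some (z, zs) : Option (β × List β)).map fun z => z.1) ?_ fun l => by
      cases l <;> rfl
  refine Comp.option_map (g := fun (_ : List β) (z : β × List β) => z.1) ?_ (by fun_prop)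
  obtain ⟨b, rfl⟩ := iβ
  let _ := Data.mk b rfl
  refine .of_basic .uncons (1 + .X) (fun l => by cases l <;> rfl) fun l => ?_
  cases l with
  | nil => simp [dsize_none]
  | cons x l => simp [dsize_some, dsize_prod, dsize_cons]

/-- A loop takes polynomial time if the values of its variable have polynomial size. -/
protected theorem Comp.foldl {F : γ → α → β → β} (hF : Comp fun z : γ × α × β => F z.1 z.2.1 z.2.2)
    (q : Polynomial ℕ)
    (hq : ∀ c l b l', l' <+: l →
      dsize (l'.foldl (fun r e => F c e r) b) ≤ q.eval (dsize (c, l, b))) :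
    Comp fun z : γ × List α × β => z.2.1.foldl (fun r e => F z.1 e r) z.2.2 := by
  obtain ⟨f, p, h⟩ := hF
  obtain ⟨a, rfl⟩ := iα
  obtain ⟨b, rfl⟩ := iβ
  obtain ⟨c, rfl⟩ := iγ
  let _ := Data.mk a rfl
  let _ := Data.mk b rfl
  let _ := Data.mk c rfl
  refine ⟨.fold f, 1 + .X + .X * (1 + (2 + .X + q) + p.comp (2 + .X + q)), ?_⟩
  rintro ⟨u, l, v⟩
  set N := dsize (u, l, v) with hN
  set K := 1 + (2 + N + q.eval N) + p.eval (2 + N + q.eval N) with hK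
  set step : b.den × Unit × ℕ → a.den → b.den × Unit × ℕ := fun r e =>
    ((f.exec (u, e, r.1)).1, (f.exec (u, e, r.1)).2.1,
      r.2.2 + 1 + dsize (u, e, r.1) + (f.exec (u, e, r.1)).2.2) with hstep
  have key : ∀ l' : List a.den, l' <+: l →
      (l'.foldl step (v, (), 1 + N)).1 = l'.foldl (fun r e => F u e r) v ∧
      (l'.foldl step (v, (), 1 + N)).2.2 ≤ 1 + N + l'.length * K := by
    intro l'
    induction l' using List.reverseRecOn with
    | nil => intro _; simp
    | append_singleton l' e ih =>
      intro hl
      have hl' : l' <+: l := (List.prefix_append _ _).trans hl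
      obtain ⟨h1, h2⟩ := ih hl'
      simp only [List.foldl_append, List.foldl_cons, List.foldl_nil]
      set r := l'.foldl step (v, (), 1 + N)
      have h3 := h (u, e, r.1)
      refine ⟨h3.1.trans ?_, ?_⟩
      · rw [h1]; rfl
      · have h4 := hq u l v l' hl'
        rw [← h1, ← hN] at h4
        have he := dsize_mem (hl.subset (by simp : e ∈ l' ++ [e]))
        have h5 : dsize (u, e, r.1) ≤ 2 + N + q.eval N := by
          rw [dsize_prod, dsize_prod] at hN ⊢
          omega
        have h6 := h3.2.trans (eval_mono p h5)
        have h7 : (step r e).2.2 ≤ r.2.2 + 1 + (2 + N + q.eval N) + p.eval (2 + N + q.eval N) :=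
          Nat.add_le_add (Nat.add_le_add_left h5 _) h6
        rw [List.length_append, List.length_singleton, add_mul]
        omega
  obtain ⟨h1, h2⟩ := key l (List.prefix_refl l)
  refine ⟨h1, le_trans h2 ?_⟩
  simp only [Polynomial.eval_add, Polynomial.eval_one, Polynomial.eval_X, Polynomial.eval_mul,
    Polynomial.eval_comp, Polynomial.eval_ofNat]
  have h3 : l.length ≤ N := by
    have := length_lt_dsize l
    rw [dsize_prod, dsize_prod] at hN
    omega
  exact Nat.add_le_add_left (Nat.mul_le_mul_right _ h3) _

theorem dsize_flatMap_le {ι : Type} {l : List ι} {g : ι → List β} {k : ℕ}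
    (hg : ∀ x ∈ l, dsize (g x) ≤ k) : dsize (l.flatMap g) ≤ 1 + l.length * k := by
  induction l with
  | nil => simp [dsize_nil]
  | cons x l ih =>
    have h1 := ih fun y hy => hg y (by simp [hy])
    have h2 := hg x (by simp)
    have h3 := dsize_append (g x) (l.flatMap g)
    rw [List.flatMap_cons, List.length_cons, add_mul]
    omega

@[fun_prop]
protected theorem Comp.flatMap {f : α → List β} {g : α → β → List γ} (hf : Comp f)
    (hg : Comp fun y : α × β => g y.1 y.2) : Comp fun x => (f x).flatMap (g x) := by
  have hfold : ∀ (x : α) (b : List γ) (l : List β),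
      l.foldl (fun r e => r ++ g x e) b = b ++ l.flatMap (g x) := by
    intro x b l
    induction l generalizing b with
    | nil => simp
    | cons e l ih => simp [ih]
  obtain ⟨p, hp⟩ := hg.dsize_le
  have key := Comp.foldl (γ := α) (α := β) (β := List γ) (F := fun x e r => r ++ g x e)
    (Comp.append (by fun_prop)
      (Comp.comp (g := fun y : α × β => g y.1 y.2)
        (f := fun z : α × β × List γ => (z.1, z.2.1)) hg (by fun_prop)))
    (1 + .X + .X * p.comp (1 + .X)) (by
      intro x l b l' hl
      rw [hfold]
      have h1 := dsize_append b (l'.flatMap (g x))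
      have hs := dsize_prod x (l, b)
      have hs' := dsize_prod l b
      have h2 : dsize (l'.flatMap (g x)) ≤ 1 + l'.length * p.eval (1 + dsize (x, l, b)) := by
        refine dsize_flatMap_le fun e he => (hp (x, e)).trans (eval_mono p ?_)
        have := dsize_mem (hl.subset he)
        rw [dsize_prod x e]
        omega
      have h3 : l'.length ≤ dsize (x, l, b) := by
        have := length_lt_dsize l
        have := hl.length_le
        omega
      have h4 := Nat.mul_le_mul_right (p.eval (1 + dsize (x, l, b))) h3
      simp only [Polynomial.eval_add, Polynomial.eval_one, Polynomial.eval_X,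
        Polynomial.eval_mul, Polynomial.eval_comp]
      omega)
  refine Comp.congr (f := fun x => (f x).foldl (fun r e => r ++ g x e) []) ?_
    fun x => by rw [hfold]; simp
  exact Comp.comp (f := fun x => (x, f x, [])) key (by fun_prop)

@[fun_prop]
protected theorem Comp.filterMap {f : α → List β} {g : α → β → Option γ} (hf : Comp f)
    (hg : Comp fun y : α × β => g y.1 y.2) : Comp fun x => (f x).filterMap (g x) := by
  refine Comp.congr (f := fun x => (f x).flatMap fun y => (g x y).elim [] fun z => [z])
    (by fun_prop) fun x => ?_
  induction f x with
  | nil => rfl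
  | cons y l ih => cases h : g x y <;> simp [h, ih]

@[fun_prop]
protected theorem Comp.replicate (v : β) {f : α → List Unit} (hf : Comp f) :
    Comp fun x => List.replicate (f x).length v := by
  refine Comp.congr (f := fun x => (f x).flatMap fun _ => [v]) (by fun_prop) fun x => ?_
  induction f x with
  | nil => rfl
  | cons y l ih => simp [ih, List.replicate_succ]

theorem replicate_length_unit (l : List Unit) : List.replicate l.length () = l :=
  List.ext_getElem (by simp) fun _ _ _ => rfl

theorem replicate_mul_length (k : ℕ) (l : List Unit) :
    List.replicate (k * l.length) () = (List.replicate k ()).flatMap fun _ => l := by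
  refine List.ext_getElem ?_ fun _ _ _ => rfl
  simp [List.length_flatMap]

/-- The values of a polynomial can be computed in unary. -/
protected theorem Comp.unary_eval (p : Polynomial ℕ) :
    Comp fun l : List Unit => List.replicate (p.eval l.length) () := by
  induction p using Polynomial.induction_on with
  | C a => simpa using Comp.const _
  | add p q hp hq =>
    refine Comp.congr (hp.append hq) fun l => ?_
    rw [List.replicate_append_replicate, Polynomial.eval_add]
  | monomial n a ih =>
    refine Comp.congr (Comp.flatMap (g := fun l _ => l) ih (by fun_prop)) fun l => ?_
    rw [← replicate_mul_length, pow_succ, ← mul_assoc, Polynomial.eval_mul_X]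

@[fun_prop]
protected theorem Comp.eval (p : Polynomial ℕ) {f : α → List Unit} (hf : Comp f) :
    Comp fun x => p.eval (f x).length := by
  refine Comp.congr (f := fun x => (List.replicate (p.eval (f x).length) ()).length)
    (Comp.length ((Comp.unary_eval p).comp hf)) fun x => by simp

/-- Algorithms that run in polynomial time, where the security parameter is the length of a
list. -/
theorem PolyTime.comp {a b : Ty} {g : ℕ → a.den → b.den} (hg : PolyTime g) :
    @Comp (List Unit × a.den) b.den (@instDataProd _ _ _ ⟨a, rfl⟩) ⟨b, rfl⟩
      fun x => g x.1.length x.2 := by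
  obtain ⟨c, p, h⟩ := hg
  let _ := Data.mk a rfl
  refine ⟨c, p, fun ⟨l, x⟩ => ?_⟩
  obtain ⟨n, rfl⟩ : ∃ n, l = List.replicate n () := ⟨_, (replicate_length_unit l).symm⟩
  simp only [List.length_replicate]
  refine ⟨(h n x).1, (h n x).2.trans (eval_mono p ?_)⟩
  have h1 := dsize_prod (List.replicate n ()) x
  rw [dsize_replicate_unit] at h1
  have h2 : dsize x = a.size x := rfl
  rw [h1, ← h2]
  omega

end

/-! ### The algorithms of the parties -/

section

variable {α : Type} [Data α] (P : Scheme) {u : α → List Unit} {f g h : α → Str} {l : α → List Str}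

@[fun_prop]
protected theorem Comp.mac_tag (hu : Comp u) (hf : Comp f) (hl : Comp l) :
    Comp fun x => P.mac.tag (u x).length (f x) (l x) :=
  Comp.comp (f := fun x => (u x, f x, l x))
    (g := fun z : List Unit × Str × List Str => P.mac.tag z.1.length z.2.1 z.2.2)
    P.mac.tag_poly.comp (by fun_prop)

@[fun_prop]
protected theorem Comp.mac_vrfy (hu : Comp u) (hf : Comp f) (hl : Comp l) (hg : Comp g) :
    Comp fun x => P.mac.vrfy (u x).length (f x) (l x) (g x) :=
  Comp.comp (f := fun x => (u x, f x, l x, g x)) (g := fun z : List Unit × Str × List Str × Str =>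
    P.mac.vrfy z.1.length z.2.1 z.2.2.1 z.2.2.2) P.mac.vrfy_poly.comp (by fun_prop)

@[fun_prop]
protected theorem Comp.sig_gen (hu : Comp u) (hf : Comp f) :
    Comp fun x => P.sig.gen (u x).length (f x) :=
  Comp.comp (f := fun x => (u x, f x))
    (g := fun z : List Unit × Str => P.sig.gen z.1.length z.2) P.sig.gen_poly.comp
    (by fun_prop)

@[fun_prop]
protected theorem Comp.sig_sign (hu : Comp u) (hf : Comp f) (hg : Comp g) (hl : Comp l) :
    Comp fun x => P.sig.sign (u x).length (f x) (g x) (l x) :=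
  Comp.comp (f := fun x => (u x, f x, g x, l x)) (g := fun z : List Unit × Str × Str × List Str =>
    P.sig.sign z.1.length z.2.1 z.2.2.1 z.2.2.2) P.sig.sign_poly.comp (by fun_prop)

@[fun_prop]
protected theorem Comp.sig_vrfy (hu : Comp u) (hf : Comp f) (hl : Comp l) (hg : Comp g) :
    Comp fun x => P.sig.vrfy (u x).length (f x) (l x) (g x) :=
  Comp.comp (f := fun x => (u x, f x, l x, g x)) (g := fun z : List Unit × Str × List Str × Str =>
    P.sig.vrfy z.1.length z.2.1 z.2.2.1 z.2.2.2) P.sig.vrfy_poly.comp (by fun_prop)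

@[fun_prop]
protected theorem Comp.pke_gen (hu : Comp u) (hf : Comp f) :
    Comp fun x => P.pke.gen (u x).length (f x) :=
  Comp.comp (f := fun x => (u x, f x))
    (g := fun z : List Unit × Str => P.pke.gen z.1.length z.2) P.pke.gen_poly.comp
    (by fun_prop)

@[fun_prop]
protected theorem Comp.pke_enc (hu : Comp u) (hf : Comp f) (hg : Comp g) (hh : Comp h) :
    Comp fun x => P.pke.enc (u x).length (f x) (g x) (h x) :=
  Comp.comp (f := fun x => (u x, f x, g x, h x)) (g := fun z : List Unit × Str × Str × Str =>
    P.pke.enc z.1.length z.2.1 z.2.2.1 z.2.2.2) P.pke.enc_poly.comp (by fun_prop)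

@[fun_prop]
protected theorem Comp.pke_dec (hu : Comp u) (hf : Comp f) (hg : Comp g) :
    Comp fun x => P.pke.dec (u x).length (f x) (g x) :=
  Comp.comp (f := fun x => (u x, f x, g x))
    (g := fun z : List Unit × Str × Str => P.pke.dec z.1.length z.2.1 z.2.2)
    P.pke.dec_poly.comp (by fun_prop)

@[fun_prop]
protected theorem Comp.sym_enc (hu : Comp u) (hf : Comp f) (hg : Comp g) (hl : Comp l) :
    Comp fun x => P.sym.enc (u x).length (f x) (g x) (l x) :=
  Comp.comp (f := fun x => (u x, f x, g x, l x)) (g := fun z : List Unit × Str × Str × List Str =>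
    P.sym.enc z.1.length z.2.1 z.2.2.1 z.2.2.2) P.sym.enc_poly.comp (by fun_prop)

@[fun_prop]
protected theorem Comp.sym_dec (hu : Comp u) (hf : Comp f) (hg : Comp g) :
    Comp fun x => P.sym.dec (u x).length (f x) (g x) :=
  Comp.comp (f := fun x => (u x, f x, g x))
    (g := fun z : List Unit × Str × Str => P.sym.dec z.1.length z.2.1 z.2.2)
    P.sym.dec_poly.comp (by fun_prop)

@[fun_prop]
protected theorem Comp.kdfMac (hu : Comp u) (hf : Comp f) :
    Comp fun x => P.kdfMac (u x).length (f x) :=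
  Comp.comp (f := fun x => (u x, f x))
    (g := fun z : List Unit × Str => P.kdfMac z.1.length z.2) P.kdfMac_poly.comp
    (by fun_prop)

@[fun_prop]
protected theorem Comp.kdfEnc (hu : Comp u) (hf : Comp f) :
    Comp fun x => P.kdfEnc (u x).length (f x) :=
  Comp.comp (f := fun x => (u x, f x))
    (g := fun z : List Unit × Str => P.kdfEnc z.1.length z.2) P.kdfEnc_poly.comp
    (by fun_prop)

@[fun_prop]
protected theorem Comp.nonce (hu : Comp u) (hf : Comp f) :
    Comp fun x => P.nonce (u x).length (f x) :=
  Comp.comp (f := fun x => (u x, f x))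
    (g := fun z : List Unit × Str => P.nonce z.1.length z.2) P.nonce_poly.comp
    (by fun_prop)

@[fun_prop]
protected theorem Comp.dh_base (hu : Comp u) : Comp fun x => P.dh.base (u x).length :=
  Comp.comp (f := fun x => (u x, ()))
    (g := fun z : List Unit × Unit => P.dh.base z.1.length) P.dh.gen_poly.comp
    (by fun_prop)

@[fun_prop]
protected theorem Comp.dh_pow (hu : Comp u) (hf : Comp f) (hg : Comp g) :
    Comp fun x => P.dh.pow (u x).length (f x) (g x) :=
  Comp.comp (f := fun x => (u x, f x, g x))
    (g := fun z : List Unit × Str × Str => P.dh.pow z.1.length z.2.1 z.2.2)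
    P.dh.pow_poly.comp (by fun_prop)

/-- The length of the distress marker can only be computed in unary. -/
protected theorem Comp.replicate_md (hu : Comp u) :
    Comp fun x => List.replicate (P.md (u x).length) () :=
  Comp.comp (f := fun x => (u x, ()))
    (g := fun z : List Unit × Unit => List.replicate (P.md z.1.length) ())
    P.md_poly.comp (by fun_prop)

@[fun_prop]
protected theorem Comp.md (hu : Comp u) : Comp fun x => P.md (u x).length :=
  (Comp.replicate_md P hu).length.congr fun x => by simp

@[fun_prop]
protected theorem Comp.marker (hu : Comp u) :
    Comp fun x => List.replicate (P.md (u x).length) true :=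
  (Comp.replicate true (Comp.replicate_md P hu)).congr fun x => by simp

@[fun_prop]
protected theorem Comp.mi (hu : Comp u) : Comp fun x => P.mi (u x).length := by
  have := Comp.comp (g := fun z : List Unit × Unit => List.replicate (P.mi z.1.length) ())
    (f := fun x => (u x, ())) P.mi_poly.comp (by fun_prop)
  exact this.length.congr fun x => by simp

@[fun_prop]
protected theorem Comp.encodeDistress (hu : Comp u) (hf : Comp f) (hg : Comp g) (hh : Comp h)
    {k : α → Str} (hk : Comp k) :
    Comp fun x => P.encodeDistress (u x).length (f x) (g x) (h x) (k x) := by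
  unfold Scheme.encodeDistress
  fun_prop

@[fun_prop]
protected theorem Comp.decodeDistress (hu : Comp u) (hf : Comp f) (hg : Comp g) :
    Comp fun x => P.decodeDistress (u x).length (f x) (g x) := by
  refine Comp.congr (f := fun x => (P.pke.dec (u x).length (f x) (g x)).elim none fun r =>
    bif decide (r.take (P.md (u x).length) = List.replicate (P.md (u x).length) true) then
      some ((r.drop (P.md (u x).length)).take (P.mi (u x).length),
        (r.drop (P.md (u x).length)).drop (P.mi (u x).length))
    else none) (by fun_prop) fun x => ?_
  unfold Scheme.decodeDistress
  cases P.pke.dec (u x).length (f x) (g x) with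
  | none => rfl
  | some r => simp [Bool.cond_eq_ite, List.drop_drop]

/-- The components of a list of length two. -/
def pairOfList (l : List Str) : Option (Str × Str) :=
  match l with
  | [x, y] => some (x, y)
  | _ => none

@[fun_prop]
protected theorem Comp.pairOfList (hl : Comp l) : Comp fun x => pairOfList (l x) := by
  refine Comp.congr (f := fun x => (bif decide ((l x).length = 2) then
    (l x).head?.bind fun y => ((l x).drop 1).head?.map fun z => (y, z) else none))
    (by fun_prop) fun x => ?_
  rcases l x with _ | ⟨y, _ | ⟨z, _ | ⟨w, t⟩⟩⟩ <;> simp [Distress.pairOfList]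

end

/-! ### Functions computable in polynomial time with an oracle -/

section

variable {α β γ : Type} [iα : Data α] [iβ : Data β] [iγ : Data γ] {J : Interface} {S : Type}
  {h : ℕ → (i : J.Op) → (J.dom i).den → S → (J.cod i).den × S}

theorem Code.run_comp (h : (i : J.Op) → (J.dom i).den → S → (J.cod i).den × S) {a b c : Ty}
    (g : Code J b c) (f : Code J a b) (x : a.den) (s : S) :
    (Code.comp g f).run h x s = ((g.run h (f.run h x s).1 (f.run h x s).2.1).1,
      (g.run h (f.run h x s).1 (f.run h x s).2.1).2.1,
      1 + (f.run h x s).2.2 + (g.run h (f.run h x s).1 (f.run h x s).2.1).2.2) := rfl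

/-- A stateful function that can be computed with calls, which are answered by `h`, in time
polynomial in the security parameter and the size of the argument. -/
def CompIn (h : ℕ → (i : J.Op) → (J.dom i).den → S → (J.cod i).den × S)
    (f : ℕ → α → S → β × S) : Prop :=
  ∃ (c : Code J (Data.ty α) (Data.ty β)) (p : Polynomial ℕ), ∀ n x s,
    (c.run (h n) (Data.enc x) s).1 = Data.enc (f n x s).1 ∧
    (c.run (h n) (Data.enc x) s).2.1 = (f n x s).2 ∧
    (c.run (h n) (Data.enc x) s).2.2 ≤ p.eval (n + dsize x)

theorem CompIn.dsize_le {f : ℕ → α → S → β × S} (hf : CompIn h f) :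
    ∃ p : Polynomial ℕ, ∀ n x s, dsize (f n x s).1 ≤ p.eval (n + dsize x) := by
  obtain ⟨c, p, hc⟩ := hf
  refine ⟨p, fun n x s => le_trans ?_ (hc n x s).2.2⟩
  unfold dsize
  rw [← (hc n x s).1]
  exact c.size_le_cost _ _ _

theorem CompIn.congr {f g : ℕ → α → S → β × S} (hf : CompIn h f)
    (hfg : ∀ n x s, f n x s = g n x s) : CompIn h g := by
  obtain rfl : f = g := funext fun n => funext fun x => funext fun s => hfg n x s
  exact hf

theorem CompIn.pure {f : α → β} (hf : Comp f) : CompIn h fun _ x s => (f x, s) := by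
  obtain ⟨c, p, hc⟩ := hf
  refine ⟨c.lift, p, fun n x s => ?_⟩
  rw [Code.run_lift]
  exact ⟨(hc x).1, rfl, (hc x).2.trans (eval_mono p (Nat.le_add_left _ _))⟩

theorem CompIn.comp {g : ℕ → β → S → γ × S} {f : α → β} (hg : CompIn h g) (hf : Comp f) :
    CompIn h fun n x => g n (f x) := by
  obtain ⟨q, hq⟩ := hf.dsize_le
  obtain ⟨c, p, hc⟩ := hf
  obtain ⟨c', p', hc'⟩ := hg
  refine ⟨.comp c' c.lift, 1 + p + p'.comp (.X + q), fun n x s => ?_⟩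
  have h3 := hc' n (f x) s
  have h4 := eval_mono p' (Nat.add_le_add (le_refl n) ((hq x).trans
    (eval_mono q (Nat.le_add_left (dsize x) n))))
  have h5 := (hc x).2.trans (eval_mono p (Nat.le_add_left (dsize x) n))
  have h6 : n + q.eval (n + dsize x) ≤ n + dsize x + q.eval (n + dsize x) := by omega
  have h7 := eval_mono p' h6
  simp only [Code.run, Code.run_lift, (hc x).1]
  refine ⟨h3.1, h3.2.1, ?_⟩
  simp only [Polynomial.eval_add, Polynomial.eval_one, Polynomial.eval_comp, Polynomial.eval_X]
  have h8 := h3.2.2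
  omega

theorem CompIn.bind {f : ℕ → α → S → β × S} {g : ℕ → α × β → S → γ × S} (hf : CompIn h f)
    (hg : CompIn h g) : CompIn h fun n x s => g n (x, (f n x s).1) (f n x s).2 := by
  obtain ⟨q, hq⟩ := hf.dsize_le
  obtain ⟨c, p, hc⟩ := hf
  obtain ⟨c', p', hc'⟩ := hg
  obtain ⟨a, rfl⟩ := iα
  obtain ⟨b, rfl⟩ := iβ
  obtain ⟨d, rfl⟩ := iγ
  let _ := Data.mk a rfl
  let _ := Data.mk b rfl
  let _ := Data.mk d rfl
  refine ⟨.comp c' (.pair .id c), 3 + 3 * .X + p + p'.comp (1 + .X + q), fun n x s => ?_⟩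
  have h1 := hc n x s
  have h2 := hc' n (x, (f n x s).1) (f n x s).2
  have e1 : (Code.run (h n) (.pair .id c) x s) = ((x, (f n x s).1), (f n x s).2,
      1 + dsize x + (1 + dsize x + dsize x) + (c.run (h n) x s).2.2) :=
    Prod.ext (Prod.ext rfl h1.1) (Prod.ext h1.2.1 rfl)
  have h3 : n + dsize (x, (f n x s).1) ≤ 1 + (n + dsize x) + q.eval (n + dsize x) := by
    have := hq n x s
    rw [dsize_prod]
    omega
  have h4 := eval_mono p' h3
  have h5 : (c.run (h n) x s).2.2 ≤ _ := h1.2.2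
  have e2 : Code.run (h n) (.comp c' (.pair .id c)) x s =
      ((c'.run (h n) (x, (f n x s).1) (f n x s).2).1,
        (c'.run (h n) (x, (f n x s).1) (f n x s).2).2.1,
        1 + (1 + dsize x + (1 + dsize x + dsize x) + (c.run (h n) x s).2.2) +
          (c'.run (h n) (x, (f n x s).1) (f n x s).2).2.2) := by
    rw [Code.run_comp, e1]
  have h6 : (c'.run (h n) (x, (f n x s).1) (f n x s).2).2.2 ≤ _ := h2.2.2
  simp only [Data.enc, cast_eq]
  rw [e2]
  refine ⟨h2.1, h2.2.1, ?_⟩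
  simp only [Polynomial.eval_add, Polynomial.eval_one, Polynomial.eval_comp, Polynomial.eval_X,
    Polynomial.eval_mul, Polynomial.eval_ofNat]
  omega

theorem CompIn.elim {o : α → Option β} {f : ℕ → α → S → γ × S} {g : ℕ → α × β → S → γ × S}
    (ho : Comp o) (hf : CompIn h f) (hg : CompIn h g) :
    CompIn h fun n x s => (o x).elim (f n x s) fun y => g n (x, y) s := by
  refine CompIn.comp (g := fun n (z : α × Option β) s =>
    z.2.elim (f n z.1 s) fun y => g n (z.1, y) s) (f := fun x => (x, o x)) ?_ (by fun_prop)
  obtain ⟨c, p, hc⟩ := hf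
  obtain ⟨c', p', hc'⟩ := hg
  obtain ⟨a, rfl⟩ := iα
  obtain ⟨b, rfl⟩ := iβ
  obtain ⟨d, rfl⟩ := iγ
  let _ := Data.mk a rfl
  let _ := Data.mk b rfl
  let _ := Data.mk d rfl
  refine ⟨.elim c c', 1 + .X + (p + p'), fun n ⟨x, y⟩ s => ?_⟩
  simp only [Polynomial.eval_add, Polynomial.eval_one, Polynomial.eval_X]
  cases y with
  | none =>
    refine ⟨(hc n x s).1, (hc n x s).2.1, ?_⟩
    have h1 := (hc n x s).2.2
    have h2 : n + dsize x ≤ n + dsize (x, (none : Option b.den)) := by rw [dsize_prod]; omega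
    have h3 := eval_mono p h2
    refine Nat.add_le_add (Nat.add_le_add_left (Nat.le_add_left _ _) _) (h1.trans ?_)
    omega
  | some y =>
    refine ⟨(hc' n (x, y) s).1, (hc' n (x, y) s).2.1, ?_⟩
    have h1 := (hc' n (x, y) s).2.2
    have h2 : n + dsize (x, y) ≤ n + dsize (x, some y) := by
      rw [dsize_prod, dsize_prod, dsize_some]; omega
    have h3 := eval_mono p' h2
    refine Nat.add_le_add (Nat.add_le_add_left (Nat.le_add_left _ _) _) (h1.trans ?_)
    omega

theorem CompIn.map {f : ℕ → α → S → β × S} {g : α × β → γ} (hf : CompIn h f) (hg : Comp g) :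
    CompIn h fun n x s => (g (x, (f n x s).1), (f n x s).2) :=
  hf.bind (CompIn.pure hg)

/-- Sequential composition of partial functions. -/
theorem CompIn.bind_elim {f : ℕ → α → S → Option β × S} {g : ℕ → α × β → S → γ × S} {v : α → γ}
    (hf : CompIn h f) (hv : Comp v) (hg : CompIn h g) :
    CompIn h fun n x s => (f n x s).1.elim (v x, (f n x s).2) fun y => g n (x, y) (f n x s).2 :=
  hf.bind <| CompIn.elim (o := fun z : α × Option β => z.2)
    (f := fun _ z s => (v z.1, s)) (g := fun n z => g n (z.1.1, z.2)) (by fun_prop)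
    (CompIn.pure (by fun_prop)) (hg.comp (by fun_prop))

end

namespace Scheme

variable (P : Scheme)

/-- The oracles for tagging and verification with the key in the forgery experiment. -/
def oracle : ℕ → (i : macInterface.Op) → (macInterface.dom i).den → MACState →
    (macInterface.cod i).den × MACState :=
  (P.mac.forgery (fun n => Coins P.ℓ n × Coins P.ℓ n) P.dhMacKey).handle

/-- Tagging with a given key, or else with the oracle. The security parameter is `n` and, in
unary, `u`. -/
def tagWith (n : ℕ) (u : List Unit) (k : Option Str) (m : List Str) (s : MACState) :
    Str × MACState :=
  k.elim (P.mac.tag n s.key m, { s with tagged := m :: s.tagged }) fun k =>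
    (P.mac.tag u.length k m, s)

/-- Verification with a given key, or else with the oracle. The security parameter is `n` and, in
unary, `u`. -/
def vrfyWith (n : ℕ) (u : List Unit) (k : Option Str) (m : List Str) (t : Str) (s : MACState) :
    Bool × MACState :=
  k.elim (P.mac.vrfy n s.key m t,
    { s with forged := s.forged ∨ (P.mac.vrfy n s.key m t = true ∧ m ∉ s.tagged) })
    fun k => (P.mac.vrfy u.length k m t, s)

end Scheme

section

variable {α : Type} [Data α] (P : Scheme)

theorem CompIn.oracle_tag : CompIn P.oracle fun n (m : List Str) (s : MACState) =>
    (P.mac.tag n s.key m, { s with tagged := m :: s.tagged }) := by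
  have ht : Comp fun u : List Unit => P.mac.tag u.length [] [] := by fun_prop
  obtain ⟨q, hq⟩ := ht.dsize_le
  refine ⟨(Code.call (I := macInterface) MACOp.tag :), 1 + .X + q.comp (1 + 2 * .X),
    fun n m s => ⟨rfl, rfl, ?_⟩⟩
  -- The key of the oracle may be long, but all tags have the same length.
  have h1 : dsize (P.mac.tag n s.key m) ≤ q.eval (1 + 2 * (n + dsize m)) := by
    have h2 := hq (List.replicate n ())
    rw [dsize_replicate_unit] at h2
    have h3 : 1 + 2 * n ≤ 1 + 2 * (n + dsize m) := by omega
    refine le_trans ?_ (h2.trans (eval_mono q h3))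
    rw [dsize_str, dsize_str, P.mac.tag_length, P.mac.tag_length, List.length_replicate]
  simp only [Polynomial.eval_add, Polynomial.eval_one, Polynomial.eval_X, Polynomial.eval_mul,
    Polynomial.eval_comp, Polynomial.eval_ofNat]
  exact Nat.add_le_add (Nat.add_le_add_left (Nat.le_add_left _ _) _) h1

theorem CompIn.oracle_vrfy : CompIn P.oracle fun n (x : List Str × Str) (s : MACState) =>
    (P.mac.vrfy n s.key x.1 x.2,
      { s with forged := s.forged ∨ (P.mac.vrfy n s.key x.1 x.2 = true ∧ x.1 ∉ s.tagged) }) := by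
  refine ⟨(Code.call (I := macInterface) MACOp.vrfy :), 1 + .X + 1, fun n x s => ⟨rfl, rfl, ?_⟩⟩
  simp only [Polynomial.eval_add, Polynomial.eval_one, Polynomial.eval_X]
  exact Nat.add_le_add (Nat.add_le_add_left (Nat.le_add_left _ _) _) le_rfl

theorem CompIn.tagWith {u : α → List Unit} {k : α → Option Str} {m : α → List Str} (hu : Comp u)
    (hk : Comp k) (hm : Comp m) :
    CompIn P.oracle fun n x => P.tagWith n (u x) (k x) (m x) :=
  CompIn.elim hk ((CompIn.oracle_tag P).comp hm)
    (CompIn.pure (f := fun z : α × Str => P.mac.tag (u z.1).length z.2 (m z.1)) (by fun_prop))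

theorem CompIn.vrfyWith {u : α → List Unit} {k : α → Option Str} {m : α → List Str}
    {t : α → Str} (hu : Comp u) (hk : Comp k) (hm : Comp m) (ht : Comp t) :
    CompIn P.oracle fun n x => P.vrfyWith n (u x) (k x) (m x) (t x) :=
  CompIn.elim hk ((CompIn.oracle_vrfy P).comp (f := fun x => (m x, t x)) (by fun_prop))
    (CompIn.pure (f := fun z : α × Str => P.mac.vrfy (u z.1).length z.2 (m z.1) (t z.1))
      (by fun_prop))

end

/-! ### Simulation of an experiment within another one -/

section

variable {I J : Interface} {St : Ty}

/-- A program without calls, next to a state that is left alone. -/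
def Code.withState {a b : Ty} (c : Code J a b) : Code J (.prod a St) (.prod b St) :=
  .pair (.comp c .fst) .snd

/-- The program that runs the given one and simulates the answers to its calls; the simulator
keeps a state of type `St`. -/
def Code.simulate (sim : ∀ i, Code J (.prod (I.dom i) St) (.prod (I.cod i) St)) :
    {a b : Ty} → Code I a b → Code J (.prod a St) (.prod b St)
  | _, _, .id => withState .id
  | _, _, .comp g f => .comp (g.simulate sim) (f.simulate sim)
  | _, _, .star => withState .star
  | _, _, .pair f g =>
    .comp (.pair (.pair .fst (.comp .fst .snd)) (.comp .snd .snd)) <|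
    .comp (.pair (.comp .fst .fst) (.comp (g.simulate sim) (.pair .snd (.comp .snd .fst)))) <|
    .pair (f.simulate sim) .fst
  | _, _, .fst => withState .fst
  | _, _, .snd => withState .snd
  | _, _, .true => withState .true
  | _, _, .false => withState .false
  | _, _, .cond t f g =>
    .comp (.cond (.comp .fst .fst)
      (.comp (f.simulate sim) (.pair .snd (.comp .snd .fst)))
      (.comp (g.simulate sim) (.pair .snd (.comp .snd .fst)))) <|
    .pair (t.simulate sim) .fst
  | _, _, .eq => withState .eq
  | _, _, .none => withState .none
  | _, _, .some => withState .some
  | _, _, .elim f g =>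
    .comp (.elim (f.simulate sim)
      (.comp (g.simulate sim) (.pair (.pair (.comp .fst .fst) .snd) (.comp .snd .fst)))) <|
    .pair (.pair (.comp .fst .fst) .snd) (.comp .snd .fst)
  | _, _, .nil => withState .nil
  | _, _, .cons => withState .cons
  | _, _, .uncons => withState .uncons
  | _, _, .append => withState .append
  | _, _, .length => withState .length
  | _, _, .take => withState .take
  | _, _, .drop => withState .drop
  | _, _, .lookup => withState .lookup
  | _, _, .fold f =>
    .comp (.fold (.comp (f.simulate sim)
      (.pair (.pair .fst (.pair (.comp .fst .snd) (.comp .fst (.comp .snd .snd))))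
        (.comp .snd (.comp .snd .snd))))) <|
    .pair (.comp .fst .fst) (.pair (.comp .fst (.comp .snd .fst))
      (.pair (.comp .snd (.comp .snd .fst)) .snd))
  | _, _, .succ => withState .succ
  | _, _, .digits => withState .digits
  | _, _, .ofDigits => withState .ofDigits
  | _, _, .call i => sim i

/-- A factor by which simulation slows down a program, apart from the size of the state. -/
def Code.overhead : {a b : Ty} → Code I a b → ℕ
  | _, _, .comp g f => g.overhead + f.overhead + 1
  | _, _, .pair f g => f.overhead + g.overhead + 100
  | _, _, .cond t f g => t.overhead + f.overhead + g.overhead + 100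
  | _, _, .elim f g => f.overhead + g.overhead + 100
  | _, _, .fold f => f.overhead + 100
  | _, _, _ => 9

variable {S S' : Type} {h : (i : I.Op) → (I.dom i).den → S → (I.cod i).den × S}
  {h' : (i : J.Op) → (J.dom i).den → S' → (J.cod i).den × S'}

/-- The claim that a run of `c'` on `x` and a state simulates a run of `c` on `x`, where `R k`
relates the states after `k` steps, as long as no more than `T` steps are taken. -/
def Simulates (h : (i : I.Op) → (I.dom i).den → S → (I.cod i).den × S)
    (h' : (i : J.Op) → (J.dom i).den → S' → (J.cod i).den × S')
    (R : ℕ → S → St.den → S' → Prop) (T D : ℕ) {a b : Ty} (c : Code I a b)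
    (c' : Code J (.prod a St) (.prod b St)) : Prop :=
  ∀ k x σ st s, R k σ st s → k + (c.run h x σ).2.2 ≤ T →
    (c'.run h' (x, st) s).1.1 = (c.run h x σ).1 ∧
    R (k + (c.run h x σ).2.2) (c.run h x σ).2.1 (c'.run h' (x, st) s).1.2
      (c'.run h' (x, st) s).2.1 ∧
    (c'.run h' (x, st) s).2.2 ≤ D * (c.run h x σ).2.2

variable {R : ℕ → S → St.den → S' → Prop} {T Z : ℕ}

/-- Elementary estimates for the cost of the bookkeeping that moves the state of the simulator. -/
theorem mul_bounds (Z x d e : ℕ) :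
    Z + 1 + x + d + e ≤ (Z + 1) * (1 + x + d + e) ∧
    (Z + 1) * d ≤ (Z + 1) * (1 + x + d + e) ∧ (Z + 1) * e ≤ (Z + 1) * (1 + x + d + e) := by
  refine ⟨?_, Nat.mul_le_mul_left _ (by omega), Nat.mul_le_mul_left _ (by omega)⟩
  nlinarith [Nat.zero_le (Z * x), Nat.zero_le (Z * d), Nat.zero_le (Z * e)]

/-- The case of a basic instruction. -/
theorem simulates_withState (hmono : ∀ k l σ st s, R k σ st s → k ≤ l → R l σ st s)
    (hZ : ∀ k σ st s, R k σ st s → k ≤ T → St.size st ≤ Z) {a b : Ty} {c : Code I a b}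
    {c' : Code J a b} (f : a.den → b.den) (hc : ∀ x s, c.run h x s = basic f x s)
    (hc' : ∀ x s, c'.run h' x s = basic f x s) :
    Simulates h h' R T (9 * (Z + 1)) c c'.withState := by
  intro k x σ st s hR hT
  have hz := hZ k σ st s hR (by omega)
  simp only [Code.withState, Code.run, hc, hc', basic, Ty.size] at *
  refine ⟨trivial, hmono _ _ _ _ _ hR (by omega), ?_⟩
  nlinarith [Nat.zero_le (Z * a.size x), Nat.zero_le (Z * b.size (f x))]

/-- If calls can be simulated with an overhead of `Z + 1`, where `Z` bounds the size of the states
of the simulator, then so can programs, up to a factor that depends on the program only. Since the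
relation `R k` keeps track of the steps, the bounds `Z` on states and `T` on running times need not
be known to the simulator. -/
theorem Code.simulates (hmono : ∀ k l σ st s, R k σ st s → k ≤ l → R l σ st s)
    (hZ : ∀ k σ st s, R k σ st s → k ≤ T → St.size st ≤ Z)
    (sim : ∀ i, Code J (.prod (I.dom i) St) (.prod (I.cod i) St))
    (hsim : ∀ i, Simulates h h' R T (Z + 1) (.call i) (sim i)) {a b : Ty} (c : Code I a b) :
    Simulates h h' R T (c.overhead * (Z + 1)) c (c.simulate sim) := by
  induction c with
  | comp g f ihg ihf =>
    intro k x σ st s hR hT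
    simp only [Code.run] at hT
    obtain ⟨h1, h2, h3⟩ := ihf k x σ st s hR (by omega)
    obtain ⟨h4, h5, h6⟩ := ihg _ (f.run h x σ).1 _ _ _ h2 (by omega)
    simp only [Code.simulate, Code.run, Code.overhead]
    have e : (Code.run h' (f.simulate sim) (x, st) s).1 =
      ((f.run h x σ).1, (Code.run h' (f.simulate sim) (x, st) s).1.2) := Prod.ext h1 rfl
    rw [e]
    refine ⟨h4, hmono _ _ _ _ _ h5 (by omega), ?_⟩
    nlinarith [Nat.zero_le (f.overhead * (Z + 1)), Nat.zero_le (g.overhead * (Z + 1)),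
      Nat.zero_le (f.overhead * (Z + 1) *
        (Code.run h g (Code.run h f x σ).1 (Code.run h f x σ).2.1).2.2),
      Nat.zero_le (g.overhead * (Z + 1) * (Code.run h f x σ).2.2),
      Nat.zero_le ((Z + 1) * (Code.run h f x σ).2.2),
      Nat.zero_le ((Z + 1) * (Code.run h g (Code.run h f x σ).1 (Code.run h f x σ).2.1).2.2)]
  | @pair a b c f g ihf ihg =>
    intro k x σ st s hR hT
    have hz := hZ k σ st s hR (by omega)
    simp only [Code.run] at hT
    have h1 := ihf k x σ st s hR (by omega)
    have hu := f.size_le_cost h x σ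
    rcases hf : f.run h x σ with ⟨u, σ₁, d₁⟩
    rcases hF : (f.simulate sim).run h' (x, st) s with ⟨⟨u', st₁⟩, s₁, t₁⟩
    simp only [hf, hF] at h1 hT hu
    obtain ⟨rfl, h2, h3⟩ := h1
    have hz₁ := hZ _ _ _ _ h2 (by omega)
    have h4 := ihg _ x _ _ _ h2 (by omega)
    have hv := g.size_le_cost h x σ₁
    rcases hg : g.run h x σ₁ with ⟨v, σ₂, d₂⟩
    rcases hG : (g.simulate sim).run h' (x, st₁) s₁ with ⟨⟨v', st₂⟩, s₂, t₂⟩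
    simp only [hg, hG] at h4 hT hv
    obtain ⟨rfl, h5, h6⟩ := h4
    have hz₂ := hZ _ _ _ _ h5 (by omega)
    simp only [Code.simulate, Code.run, Code.overhead, basic, hf, hF, hg, hG, Ty.size]
    refine ⟨trivial, hmono _ _ _ _ _ h5 (by omega), ?_⟩
    set X := (Z + 1) * (1 + a.size x + d₁ + d₂) with hX
    obtain ⟨e₁, e₂, e₃⟩ := mul_bounds Z (a.size x) d₁ d₂
    rw [← hX] at e₁ e₂ e₃
    have h7 := h3.trans (mul_assoc f.overhead _ _ ▸ Nat.mul_le_mul_left f.overhead e₂)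
    have h8 := h6.trans (mul_assoc g.overhead _ _ ▸ Nat.mul_le_mul_left g.overhead e₃)
    rw [mul_assoc, ← hX, add_mul, add_mul]
    omega
  | @cond a b t f g iht ihf ihg =>
    intro k x σ st s hR hT
    have hz := hZ k σ st s hR (by omega)
    simp only [Code.run] at hT
    have h1 := iht k x σ st s hR (by omega)
    rcases hf : t.run h x σ with ⟨u, σ₁, d₁⟩
    rcases hF : (t.simulate sim).run h' (x, st) s with ⟨⟨u', st₁⟩, s₁, t₁⟩
    simp only [hf, hF] at h1 hT
    obtain ⟨rfl, h2, h3⟩ := h1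
    have hz₁ := hZ _ _ _ _ h2 (by omega)
    cases u' with
    | true =>
      simp only at hT
      have h4 := ihf _ x _ _ _ h2 (by omega)
      have hv := f.size_le_cost h x σ₁
      rcases hg : f.run h x σ₁ with ⟨v, σ₂, d₂⟩
      rcases hG : (f.simulate sim).run h' (x, st₁) s₁ with ⟨⟨v', st₂⟩, s₂, t₂⟩
      simp only [hg, hG] at h4 hT hv
      obtain ⟨rfl, h5, h6⟩ := h4
      have hz₂ := hZ _ _ _ _ h5 (by omega)
      simp only [Code.simulate, Code.run, Code.overhead, basic, hf, hF, hg, hG, Ty.size]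
      refine ⟨trivial, hmono _ _ _ _ _ h5 (by omega), ?_⟩
      set X := (Z + 1) * (1 + a.size x + d₁ + d₂) with hX
      obtain ⟨e₁, e₂, e₃⟩ := mul_bounds Z (a.size x) d₁ d₂
      rw [← hX] at e₁ e₂ e₃
      have h7 := h3.trans (mul_assoc t.overhead _ _ ▸ Nat.mul_le_mul_left t.overhead e₂)
      have h8 := h6.trans (mul_assoc f.overhead _ _ ▸ Nat.mul_le_mul_left f.overhead e₃)
      rw [mul_assoc, ← hX, add_mul, add_mul, add_mul]
      have h9 := Nat.zero_le (g.overhead * X)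
      omega
    | false =>
      simp only at hT
      have h4 := ihg _ x _ _ _ h2 (by omega)
      have hv := g.size_le_cost h x σ₁
      rcases hg : g.run h x σ₁ with ⟨v, σ₂, d₂⟩
      rcases hG : (g.simulate sim).run h' (x, st₁) s₁ with ⟨⟨v', st₂⟩, s₂, t₂⟩
      simp only [hg, hG] at h4 hT hv
      obtain ⟨rfl, h5, h6⟩ := h4
      have hz₂ := hZ _ _ _ _ h5 (by omega)
      simp only [Code.simulate, Code.run, Code.overhead, basic, hf, hF, hg, hG, Ty.size]
      refine ⟨trivial, hmono _ _ _ _ _ h5 (by omega), ?_⟩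
      set X := (Z + 1) * (1 + a.size x + d₁ + d₂) with hX
      obtain ⟨e₁, e₂, e₃⟩ := mul_bounds Z (a.size x) d₁ d₂
      rw [← hX] at e₁ e₂ e₃
      have h7 := h3.trans (mul_assoc t.overhead _ _ ▸ Nat.mul_le_mul_left t.overhead e₂)
      have h8 := h6.trans (mul_assoc g.overhead _ _ ▸ Nat.mul_le_mul_left g.overhead e₃)
      rw [mul_assoc, ← hX, add_mul, add_mul, add_mul]
      have h9 := Nat.zero_le (f.overhead * X)
      omega
  | @elim a b c f g ihf ihg =>
    rintro k ⟨x, o⟩ σ st s hR hT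
    have hz := hZ k σ st s hR (by omega)
    cases o with
    | none =>
      simp only [Code.run] at hT
      have h1 := ihf k x σ st s hR (by omega)
      rcases hf : f.run h x σ with ⟨u, σ₁, d₁⟩
      rcases hF : (f.simulate sim).run h' (x, st) s with ⟨⟨u', st₁⟩, s₁, t₁⟩
      simp only [hf, hF] at h1 hT
      obtain ⟨rfl, h2, h3⟩ := h1
      simp only [Code.simulate, Code.run, Code.overhead, basic, hf, hF]
      refine ⟨trivial, hmono _ _ _ _ _ h2 (by omega), ?_⟩
      simp only [Ty.size]
      set o := ((Option.none : Option b.den).map b.size).getD 0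
      have e₀ : 1 + (1 + a.size x + (1 + o)) + d₁ = 1 + (1 + a.size x + (1 + o)) + d₁ + 0 := rfl
      rw [e₀]
      set X := (Z + 1) * (1 + (1 + a.size x + (1 + o)) + d₁ + 0) with hX
      obtain ⟨e₁, e₂, e₃⟩ := mul_bounds Z (1 + a.size x + (1 + o)) d₁ 0
      rw [← hX] at e₁ e₂ e₃
      have h7 := h3.trans (mul_assoc f.overhead _ _ ▸ Nat.mul_le_mul_left f.overhead e₂)
      rw [mul_assoc, ← hX, add_mul, add_mul]
      have h9 := Nat.zero_le (g.overhead * X)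
      omega
    | some y =>
      simp only [Code.run] at hT
      have h1 := ihg k (x, y) σ st s hR (by omega)
      rcases hf : g.run h (x, y) σ with ⟨u, σ₁, d₁⟩
      rcases hF : (g.simulate sim).run h' ((x, y), st) s with ⟨⟨u', st₁⟩, s₁, t₁⟩
      simp only [hf, hF] at h1 hT
      obtain ⟨rfl, h2, h3⟩ := h1
      simp only [Code.simulate, Code.run, Code.overhead, basic, hf, hF]
      refine ⟨trivial, hmono _ _ _ _ _ h2 (by omega), ?_⟩
      simp only [Ty.size, Option.map_some, Option.getD_some]
      have e₀ : 1 + (1 + a.size x + (1 + b.size y)) + d₁ =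
        1 + (1 + a.size x + (1 + b.size y)) + d₁ + 0 := rfl
      rw [e₀]
      set X := (Z + 1) * (1 + (1 + a.size x + (1 + b.size y)) + d₁ + 0) with hX
      obtain ⟨e₁, e₂, e₃⟩ := mul_bounds Z (1 + a.size x + (1 + b.size y)) d₁ 0
      rw [← hX] at e₁ e₂ e₃
      have h7 := h3.trans (mul_assoc g.overhead _ _ ▸ Nat.mul_le_mul_left g.overhead e₂)
      rw [mul_assoc, ← hX, add_mul, add_mul]
      have h9 := Nat.zero_le (f.overhead * X)
      omega
  | @fold a b c f ih =>
    rintro k ⟨u, l, y⟩ σ st s hR hT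
    have hz := hZ k σ st s hR (by omega)
    set D := (f.overhead + 100) * (Z + 1) with hD
    set step : b.den × S × ℕ → a.den → b.den × S × ℕ := fun r e =>
      ((f.run h (u, e, r.1) r.2.1).1, (f.run h (u, e, r.1) r.2.1).2.1,
        r.2.2 + 1 + Ty.size (.prod c (.prod a b)) (u, e, r.1) +
          (f.run h (u, e, r.1) r.2.1).2.2) with hstep
    set body : Code J (.prod c (.prod a (.prod b St))) (.prod b St) :=
      .comp (f.simulate sim)
        (.pair (.pair .fst (.pair (.comp .fst .snd) (.comp .fst (.comp .snd .snd))))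
          (.comp .snd (.comp .snd .snd))) with hbody
    set step' : (b.den × St.den) × S' × ℕ → a.den → (b.den × St.den) × S' × ℕ := fun r e =>
      ((body.run h' (u, e, r.1) r.2.1).1, (body.run h' (u, e, r.1) r.2.1).2.1,
        r.2.2 + 1 + Ty.size (.prod c (.prod a (.prod b St))) (u, e, r.1) +
          (body.run h' (u, e, r.1) r.2.1).2.2) with hstep'
    have hmon : ∀ (l : List a.den) r, r.2.2 ≤ (l.foldl step r).2.2 := by
      intro l
      induction l with
      | nil => exact fun r => le_rfl
      | cons e l ihl =>
        intro r
        refine le_trans ?_ (ihl (step r e))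
        simp only [hstep]
        omega
    -- The running time `t'` of the simulation grows at most by `D` times the growth of `t`.
    have key : ∀ (l : List a.den) y σ t st s t', R (k + t) σ st s →
        k + (l.foldl step (y, σ, t)).2.2 ≤ T →
        (l.foldl step' ((y, st), s, t')).1.1 = (l.foldl step (y, σ, t)).1 ∧
        R (k + (l.foldl step (y, σ, t)).2.2) (l.foldl step (y, σ, t)).2.1
          (l.foldl step' ((y, st), s, t')).1.2 (l.foldl step' ((y, st), s, t')).2.1 ∧
        (l.foldl step' ((y, st), s, t')).2.2 + D * t ≤
          t' + D * (l.foldl step (y, σ, t)).2.2 := by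
      intro l
      induction l with
      | nil => exact fun y σ t st s t' hR hT => ⟨rfl, hR, le_rfl⟩
      | cons e l ihl =>
        intro y σ t st s t' hR hT
        simp only [List.foldl_cons] at hT ⊢
        have hT' := (Nat.add_le_add_left (hmon l (step (y, σ, t) e)) k).trans hT
        simp only [hstep] at hT'
        have hz := hZ _ _ _ _ hR (by omega)
        have h1 := ih (k + t + 1 + Ty.size (.prod c (.prod a b)) (u, e, y)) (u, e, y) σ st s
          (hmono _ _ _ _ _ hR (by omega)) (by omega)
        rcases hf : f.run h (u, e, y) σ with ⟨v, σ₁, d₁⟩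
        rcases hF : (f.simulate sim).run h' ((u, e, y), st) s with ⟨⟨v', st₁⟩, s₁, t₁⟩
        have e1 : step (y, σ, t) e =
            (v, σ₁, t + 1 + Ty.size (.prod c (.prod a b)) (u, e, y) + d₁) := by
          simp only [hstep, hf]
        simp only [hf, hF] at h1
        obtain ⟨rfl, h2, h3⟩ := h1
        set w' := (step' ((y, st), s, t') e).2.2 with hw
        have e2 : step' ((y, st), s, t') e = ((v', st₁), s₁, w') := by
          simp only [hstep', hbody, Code.run, basic, hF, hw]
        rw [e1] at hT ⊢
        rw [e2]
        obtain ⟨h4, h5, h6⟩ := ihl v' σ₁ _ st₁ s₁ w' (by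
          refine hmono _ _ _ _ _ h2 ?_
          omega) hT
        refine ⟨h4, h5, ?_⟩
        have e3 : w' + D * t ≤
            t' + D * (t + 1 + Ty.size (.prod c (.prod a b)) (u, e, y) + d₁) := by
          simp only [hw, hstep', hbody, Code.run, basic, hF]
          simp only [Ty.size]
          obtain ⟨e₁, e₂, e₃⟩ := mul_bounds Z (1 + c.size u + (1 + a.size e + b.size y)) d₁ 0
          set X := (Z + 1) * (1 + (1 + c.size u + (1 + a.size e + b.size y)) + d₁ + 0) with hX
          have h7 := h3.trans (mul_assoc f.overhead _ _ ▸ Nat.mul_le_mul_left f.overhead e₂)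
          have e4 : D * (t + 1 + (1 + c.size u + (1 + a.size e + b.size y)) + d₁) =
              D * t + (f.overhead * X + 100 * X) := by
            rw [hX, hD]; ring
          rw [e4]
          omega
        omega
    have hrun : (Code.fold f).run h (u, l, y) σ =
        l.foldl step (y, σ, 1 + Ty.size (.prod c (.prod (.list a) b)) (u, l, y)) := rfl
    rw [hrun] at hT ⊢
    obtain ⟨h1, h2, h3⟩ := key l y σ _ st s
      (1 + Ty.size (.prod c (.prod (.list a) (.prod b St))) (u, l, y, st))
      (hmono _ _ _ _ _ hR (Nat.le_add_right _ _)) hT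
    set r' := l.foldl step' ((y, st), s,
      1 + Ty.size (.prod c (.prod (.list a) (.prod b St))) (u, l, y, st)) with hr'
    set p : Code J (.prod (.prod c (.prod (.list a) b)) St)
        (.prod c (.prod (.list a) (.prod b St))) :=
      .pair (.comp .fst .fst) (.pair (.comp .fst (.comp .snd .fst))
        (.pair (.comp .snd (.comp .snd .fst)) .snd)) with hp
    have e5 : ((Code.fold f).simulate sim).run h' ((u, l, y), st) s =
        (r'.1, r'.2.1, 1 + (p.run h' ((u, l, y), st) s).2.2 + r'.2.2) := rfl
    rw [e5]
    refine ⟨h1, h2, ?_⟩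
    simp only [Code.overhead]
    rw [← hD]
    refine Nat.le_of_add_le_add_right
      (b := D * (1 + Ty.size (.prod c (.prod (.list a) b)) (u, l, y))) ?_
    have e6 : 1 + (p.run h' ((u, l, y), st) s).2.2 +
        (1 + Ty.size (.prod c (.prod (.list a) (.prod b St))) (u, l, y, st)) ≤
          D * (1 + Ty.size (.prod c (.prod (.list a) b)) (u, l, y)) := by
      simp only [hp, Code.run, basic]
      simp only [Ty.size]
      generalize (l.map fun y => 1 + a.size y).sum = L
      have e₁ := (mul_bounds Z (1 + c.size u + (1 + (1 + L) + b.size y)) 0 0).1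
      set X := (Z + 1) * (1 + (1 + c.size u + (1 + (1 + L) + b.size y)) + 0 + 0) with hX
      have e7 : D * (1 + (1 + c.size u + (1 + (1 + L) + b.size y))) =
          f.overhead * X + 100 * X := by
        rw [hX, hD]; ring
      rw [e7]
      omega
    omega
  | call i =>
    intro k x σ st s hR hT
    obtain ⟨h1, h2, h3⟩ := hsim i k x σ st s hR hT
    refine ⟨h1, h2, h3.trans (Nat.mul_le_mul_right _ ?_)⟩
    simp only [Code.overhead]
    omega
  | _ => exact simulates_withState hmono hZ _ (fun _ _ => rfl) (fun _ _ => rfl)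

end

/-! ### The simulated parties -/

section

variable {α β γ : Type} [iα : Data α] [iβ : Data β] [iγ : Data γ] {J : Interface} {S : Type}
  {h : ℕ → (i : J.Op) → (J.dom i).den → S → (J.cod i).den × S}

theorem CompIn.bif {t : α → Bool} {f g : ℕ → α → S → γ × S} (ht : Comp t) (hf : CompIn h f)
    (hg : CompIn h g) : CompIn h fun n x s => bif t x then f n x s else g n x s :=
  (CompIn.elim (o := fun x => bif t x then some () else none) (f := g) (g := fun n z => f n z.1)
    (by fun_prop) hg (hf.comp (by fun_prop))).congr fun n x s => by cases t x <;> rfl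

end

/-- An honest webserver: its signature key pair, its certificate, and its decryption, encryption
and MAC keys. -/
abbrev SimServer : Type := Str × Str × Str × Option (Str × Str × Str)

/-- A TLS session: whether the peer is the user, the client nonce, and the confirmation. -/
abbrev SimTLS : Type := Bool × Str × Option Str

/-- A user record of the DCP: the MAC key, the sequence number and the instruction. The MAC key is
left out if it is the key of the honest user, which the simulator does not know. -/
abbrev SimRecord : Type := Option Str × ℕ × Str

/-- The honest user: its identifier, its sequence number, and its session, with the website, the
sequence number and the client nonce. -/
abbrev SimUser : Type := Str × ℕ × Option (Str × ℕ × Str)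

/-- The state of the simulator: the security parameter in unary, the unused coins, and the keys of
the certificate authority; tables of the honest and the malicious webservers, of the TLS sessions,
and of the servers and users at the DCP; the public keys that the honest user knows, and the honest
user. -/
abbrev Sim : Type :=
  (List Unit × Str × Str × Str) × List (Str × SimServer) × List (Str × Unit) ×
    List ((Str × Str) × SimTLS) × List (Str × Str × Str × Str) × List (Str × SimRecord) ×
    List (Str × Str) × Option SimUser

/-- The coins of one step. -/
abbrev StepCoins : Type := Str × Str × Str × Str

instance : Data Str := inferInstanceAs (Data (List Bool))
instance : Data StepCoins := inferInstanceAs (Data (Str × Str × Str × Str))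
instance : Data SimServer := inferInstanceAs (Data (Str × Str × Str × Option (Str × Str × Str)))
instance : Data SimTLS := inferInstanceAs (Data (Bool × Str × Option Str))
instance : Data SimRecord := inferInstanceAs (Data (Option Str × ℕ × Str))
instance : Data SimUser := inferInstanceAs (Data (Str × ℕ × Option (Str × ℕ × Str)))
instance : Data Sim := inferInstanceAs (Data ((List Unit × Str × Str × Str) ×
  List (Str × SimServer) × List (Str × Unit) × List ((Str × Str) × SimTLS) ×
    List (Str × Str × Str × Str) × List (Str × SimRecord) × List (Str × Str) × Option SimUser))

namespace Sim

/-- The security parameter in unary. -/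
def un (st : Sim) : List Unit := st.1.1

/-- The unused coins. -/
def tape (st : Sim) : Str := st.1.2.1

/-- The public key of the certificate authority. -/
def caPk (st : Sim) : Str := st.1.2.2.1

/-- The secret key of the certificate authority. -/
def caSk (st : Sim) : Str := st.1.2.2.2

/-- The table of the honest webservers. -/
def honest (st : Sim) : List (Str × SimServer) := st.2.1

/-- The table of the malicious webservers. -/
def corrupt (st : Sim) : List (Str × Unit) := st.2.2.1

/-- The table of the TLS sessions, by webserver and nonce. -/
def tls (st : Sim) : List ((Str × Str) × SimTLS) := st.2.2.2.1

/-- The server database of the DCP. -/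
def serverDB (st : Sim) : List (Str × Str × Str × Str) := st.2.2.2.2.1

/-- The user database of the DCP. -/
def userDB (st : Sim) : List (Str × SimRecord) := st.2.2.2.2.2.1

/-- The public keys that the honest user knows. -/
def pks (st : Sim) : List (Str × Str) := st.2.2.2.2.2.2.1

/-- The honest user, once enrolled. -/
def user (st : Sim) : Option SimUser := st.2.2.2.2.2.2.2

/-- Adds an entry to the table of the honest webservers. -/
def addHonest (st : Sim) (e : Str × SimServer) : Sim := (st.1, e :: st.2.1, st.2.2)

/-- Adds an entry to the table of the malicious webservers. -/
def addCorrupt (st : Sim) (B : Str) : Sim := (st.1, st.2.1, (B, ()) :: st.2.2.1, st.2.2.2)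

/-- Adds an entry to the table of the TLS sessions. -/
def addTLS (st : Sim) (e : (Str × Str) × SimTLS) : Sim :=
  (st.1, st.2.1, st.2.2.1, e :: st.2.2.2.1, st.2.2.2.2)

/-- Adds an entry to the server database. -/
def addServer (st : Sim) (e : Str × Str × Str × Str) : Sim :=
  (st.1, st.2.1, st.2.2.1, st.2.2.2.1, e :: st.2.2.2.2.1, st.2.2.2.2.2)

/-- Adds an entry to the user database. -/
def addRecord (st : Sim) (e : Str × SimRecord) : Sim :=
  (st.1, st.2.1, st.2.2.1, st.2.2.2.1, st.2.2.2.2.1, e :: st.2.2.2.2.2.1, st.2.2.2.2.2.2)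

/-- Changes the public keys that the honest user knows. -/
def setPks (st : Sim) (l : List (Str × Str)) : Sim :=
  (st.1, st.2.1, st.2.2.1, st.2.2.2.1, st.2.2.2.2.1, st.2.2.2.2.2.1, l, st.2.2.2.2.2.2.2)

/-- Changes the honest user. -/
def setUser (st : Sim) (u : SimUser) : Sim :=
  (st.1, st.2.1, st.2.2.1, st.2.2.2.1, st.2.2.2.2.1, st.2.2.2.2.2.1, st.2.2.2.2.2.2.1, some u)

/-- Changes the unused coins. -/
def setTape (st : Sim) (t : Str) : Sim := ((st.1.1, t, st.1.2.2), st.2)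

end Sim

section

@[fun_prop]
protected theorem Comp.sim_un : Comp Sim.un := by unfold Sim.un; fun_prop

@[fun_prop]
protected theorem Comp.sim_tape : Comp Sim.tape := by unfold Sim.tape; fun_prop

@[fun_prop]
protected theorem Comp.sim_caPk : Comp Sim.caPk := by unfold Sim.caPk; fun_prop

@[fun_prop]
protected theorem Comp.sim_caSk : Comp Sim.caSk := by unfold Sim.caSk; fun_prop

@[fun_prop]
protected theorem Comp.sim_honest : Comp Sim.honest := by unfold Sim.honest; fun_prop

@[fun_prop]
protected theorem Comp.sim_corrupt : Comp Sim.corrupt := by unfold Sim.corrupt; fun_prop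

@[fun_prop]
protected theorem Comp.sim_tls : Comp Sim.tls := by unfold Sim.tls; fun_prop

@[fun_prop]
protected theorem Comp.sim_serverDB : Comp Sim.serverDB := by unfold Sim.serverDB; fun_prop

@[fun_prop]
protected theorem Comp.sim_userDB : Comp Sim.userDB := by unfold Sim.userDB; fun_prop

@[fun_prop]
protected theorem Comp.sim_pks : Comp Sim.pks := by unfold Sim.pks; fun_prop

@[fun_prop]
protected theorem Comp.sim_user : Comp Sim.user := by unfold Sim.user; fun_prop

variable {α : Type} [Data α] {f : α → Sim}

@[fun_prop]
protected theorem Comp.sim_addHonest {g : α → Str × SimServer} (hf : Comp f) (hg : Comp g) :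
    Comp fun x => (f x).addHonest (g x) := by
  unfold Sim.addHonest; fun_prop

@[fun_prop]
protected theorem Comp.sim_addCorrupt {g : α → Str} (hf : Comp f) (hg : Comp g) :
    Comp fun x => (f x).addCorrupt (g x) := by
  unfold Sim.addCorrupt; fun_prop

@[fun_prop]
protected theorem Comp.sim_addTLS {g : α → (Str × Str) × SimTLS} (hf : Comp f) (hg : Comp g) :
    Comp fun x => (f x).addTLS (g x) := by
  unfold Sim.addTLS; fun_prop

@[fun_prop]
protected theorem Comp.sim_addServer {g : α → Str × Str × Str × Str} (hf : Comp f)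
    (hg : Comp g) : Comp fun x => (f x).addServer (g x) := by
  unfold Sim.addServer; fun_prop

@[fun_prop]
protected theorem Comp.sim_addRecord {g : α → Str × SimRecord} (hf : Comp f) (hg : Comp g) :
    Comp fun x => (f x).addRecord (g x) := by
  unfold Sim.addRecord; fun_prop

@[fun_prop]
protected theorem Comp.sim_setPks {g : α → List (Str × Str)} (hf : Comp f) (hg : Comp g) :
    Comp fun x => (f x).setPks (g x) := by
  unfold Sim.setPks; fun_prop

@[fun_prop]
protected theorem Comp.sim_setUser {g : α → SimUser} (hf : Comp f) (hg : Comp g) :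
    Comp fun x => (f x).setUser (g x) := by
  unfold Sim.setUser; fun_prop

@[fun_prop]
protected theorem Comp.sim_setTape {g : α → Str} (hf : Comp f) (hg : Comp g) :
    Comp fun x => (f x).setTape (g x) := by
  unfold Sim.setTape; fun_prop

end

namespace Scheme

variable (P : Scheme) (κ : Kind) (r : StepCoins)

/-- Simulation of the registration of an honest webserver. -/
def simRegisterHonest (B : Str) (st : Sim) : Option ((Str × Str) × Sim) :=
  bif (assoc st.honest B).isSome || (assoc st.corrupt B).isSome then none
  else
    let k := P.sig.gen st.un.length r.1
    let cert := P.sig.sign st.un.length st.caSk r.2.1 [B, k.1]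
    some ((k.1, cert), st.addHonest (B, k.1, k.2, cert, none))

/-- Simulation of the registration of a malicious webserver. -/
def simRegisterCorrupt (B pk : Str) (st : Sim) : Option (Str × Sim) :=
  bif decide (κ ≠ .web) || (assoc st.honest B).isSome then none
  else some (P.sig.sign st.un.length st.caSk r.1 [B, pk], st.addCorrupt B)

/-- The keys that the DCP derives in the server enrolment, and its message. -/
def serverSecrets (un : List Unit) (c gb : Str) : Option (Str × Str × Str) :=
  (P.dh.pow un.length gb c).bind fun z =>
    (P.dh.pow un.length (P.dh.base un.length) c).map fun gc =>
      (gc, P.kdfEnc un.length z, P.kdfMac un.length z)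

/-- Simulation of the DCP's part of the server enrolment. -/
def simDcpEnrolServer (c gb B certPk cert pk' s : Str) (st : Sim) : Option (Str × Sim) :=
  bif P.sig.vrfy st.un.length st.caPk [B, certPk] cert &&
      P.sig.vrfy st.un.length certPk [gb, B, pk'] s then
    (P.serverSecrets st.un c gb).map fun z => (z.1, st.addServer (B, pk', z.2))
  else none

/-- The secrets of a webserver in the server enrolment, given the answer of the DCP. -/
def webSecrets (un : List Unit) (gc : Str) : Option (Str × Str × Str) :=
  (P.dh.pow un.length gc r.2.1).map fun z =>
    ((P.pke.gen un.length r.1).2, P.kdfEnc un.length z, P.kdfMac un.length z)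

/-- Simulation of the server enrolment of an honest webserver. -/
def simEnrolServer (B : Str) (st : Sim) : Option (Str × Sim) :=
  (assoc st.honest B).bind fun w =>
    let pk := (P.pke.gen st.un.length r.1).1
    (P.dh.pow st.un.length (P.dh.base st.un.length) r.2.1).bind fun gb =>
      (P.simDcpEnrolServer r.2.2.2 gb B w.1 w.2.2.1 pk
        (P.sig.sign st.un.length w.2.1 r.2.2.1 [gb, B, pk]) st).bind fun y =>
        (P.webSecrets r st.un y.1).map fun z =>
          (pk, y.2.addHonest (B, w.1, w.2.1, w.2.2.1, some z))

/-- The public keys of those of the given websites that are enrolled. -/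
def simPublicKeys (sites : List Str) (st : Sim) : List (Str × Str) :=
  sites.filterMap fun B => (assoc st.serverDB B).map fun e => (B, e.1)

/-- Simulation of the enrolment of the honest user. -/
def simEnrolUser (sites : List Str) (instruction : Str) (st : Sim) : Option (Unit × Sim) :=
  let id := r.2.1.take (P.mi st.un.length)
  bif st.user.isNone && (assoc st.userDB id).isNone then
    some ((), ((st.addRecord (id, none, toNat r.1, instruction)).setPks
      (simPublicKeys sites st)).setUser (id, toNat r.1, none))
  else none

/-- Simulation of the enrolment of the adversary as a further user. -/
def simEnrolUserAs (ga : Str) (sqn : ℕ) (instruction : Str) (sites : List Str) (st : Sim) :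
    Option ((Str × List (Str × Str) × Str) × Sim) :=
  let id := r.1.take (P.mi st.un.length)
  bif (assoc st.userDB id).isNone then
    (P.serverSecrets st.un r.2.1 ga).map fun z =>
      ((id, simPublicKeys sites st, z.1),
        st.addRecord (id, some z.2.2, sqn, instruction))
  else none

/-- Simulation of a distress signal. -/
def simSignal (n : ℕ) (B : Str) (st : Sim) (s : MACState) : Option (Str × Sim) × MACState :=
  (st.user.bind fun u => (assoc st.pks B).map fun pk => (u, pk)).elim (none, s) fun y =>
    let w := P.tagWith n st.un none [y.1.1, y.1.2.1.bits] s
    let nonceA := P.encodeDistress st.un.length y.2 r.1 y.1.1 w.1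
    (some (nonceA, st.setUser (y.1.1, y.1.2.1 + 1, some (B, y.1.2.1, nonceA))), w.2)

/-- Simulation of an honest webserver that gets a client nonce. -/
def simServerHello (withUser : Bool) (B x : Str) (st : Sim) :
    Option ((Str × Str × Str × Str) × Sim) :=
  (assoc st.honest B).bind fun w => w.2.2.2.bind fun k =>
    (P.decodeDistress st.un.length k.1 x).map fun y =>
      let c := P.sym.enc st.un.length k.2.1 r.1 [y.1, y.2]
      let nonceB := P.nonce st.un.length r.2.1
      ((B, c, nonceB, P.mac.tag st.un.length k.2.2 [B, c, nonceB]),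
        st.addTLS ((B, nonceB), withUser, x, none))

/-- Simulation of a webserver that gets the client nonce of the user. -/
def simHello (st : Sim) : Option ((Str × Str × Str × Str) × Sim) :=
  st.user.bind fun u => u.2.2.bind fun v => P.simServerHello r true v.1 v.2.2 st

/-- The records and the distress signal, if a message to the DCP is authentic. -/
def authentic (B c nonceB t : Str) (st : Sim) :
    Option ((Str × Str × Str) × (Str × Str) × SimRecord) :=
  (assoc st.serverDB B).bind fun e =>
    bif P.mac.vrfy st.un.length e.2.2 [B, c, nonceB] t then
      (P.sym.dec st.un.length e.2.1 c).bind fun l => (pairOfList l).bind fun y =>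
        (assoc st.userDB y.1).map fun u => (e, y, u)
    else none

/-- The first sequence number from `m` to `m + j - 1` for which the tag is valid. -/
def findSqn (n : ℕ) (un : List Unit) (k : Option Str) (id : Str) (m : ℕ) (tag : Str) :
    ℕ → MACState → Option ℕ × MACState
  | 0, s => (none, s)
  | j + 1, s =>
    let y := findSqn n un k id m tag j s
    y.1.elim
      (let z := P.vrfyWith n un k [id, (m + j).bits] tag y.2
      (bif z.1 then some (m + j) else none, z.2))
      fun i => (some i, y.2)

/-- Simulation of the DCP that gets a message. -/
def simToDCP (n : ℕ) (B c nonceB t : Str) (st : Sim) (s : MACState) :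
    Option ((Str × Str × Str × Str) × Sim) × MACState :=
  (P.authentic B c nonceB t st).elim (none, s) fun y =>
    let z := P.findSqn n st.un y.2.2.1 y.2.1.1 y.2.2.2.1 y.2.1.2 (P.nMax + 1) s
    z.1.elim (none, z.2) fun m =>
      let w := P.tagWith n st.un y.2.2.1 [m.bits] z.2
      let c' := P.sym.enc st.un.length y.1.2.1 r.1 [y.2.2.2.2]
      let nonceC := P.nonce st.un.length r.2.1
      (some ((c', w.1, nonceC, P.mac.tag st.un.length y.1.2.2 [c', w.1, nonceB, nonceC]),
        st.addRecord (y.2.1.1, y.2.2.1, m + 1, y.2.2.2.2)), w.2)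

/-- Simulation of an honest webserver that gets a reply. -/
def simToServer (B nonceB c s nonceC t : Str) (st : Sim) : Option (Unit × Sim) :=
  (assoc st.honest B).bind fun w => w.2.2.2.bind fun k => (assoc st.tls (B, nonceB)).bind fun v =>
    bif P.mac.vrfy st.un.length k.2.2 [c, s, nonceB, nonceC] t then
      (P.sym.dec st.un.length k.2.1 c).map fun _ =>
        ((), st.addTLS ((B, nonceB), v.1, v.2.1, some s))
    else none

/-- Simulation of the user who verifies a confirmation. -/
def simCheck (n : ℕ) (t : Str) (st : Sim) (s : MACState) : Sim × MACState :=
  (st.user.bind fun u => u.2.2.map fun v => (u, v)).elim (st, s) fun y =>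
    let w := P.vrfyWith n st.un none [y.2.2.1.bits] t s
    (bif w.1 then st.setUser (y.1.1, y.1.2.1, none) else st, w.2)

/-- The confirmation that a webserver sends to its TLS peer, and whether this peer is the user. -/
def pageContent (B nonceB : Str) (st : Sim) : Option (Str × Bool) :=
  (assoc st.tls (B, nonceB)).bind fun v => v.2.2.bind fun s =>
    bif v.1 then st.user.bind fun u => u.2.2.bind fun w =>
      bif decide (w.1 = B) && decide (w.2.2 = v.2.1) then some (s, true) else none
    else some (s, false)

/-- Simulation of a webserver that sends a confirmation to its peer. -/
def simPage (n : ℕ) (B nonceB : Str) (st : Sim) (s : MACState) :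
    Option (Option Str × Sim) × MACState :=
  (pageContent B nonceB st).elim (none, s) fun y =>
    bif y.2 then
      let w := P.simCheck n y.1 st s
      (some (bif decide (κ = .loc) then some y.1 else none, w.1), w.2)
    else (some (some y.1, st), s)

/-- Whether the adversary can choose the page content in the session of the user. -/
def canInject (st : Sim) : Option Unit :=
  st.user.bind fun u => u.2.2.bind fun v =>
    bif decide (κ = .loc) || (decide (κ = .web) && (assoc st.corrupt v.1).isSome) then some ()
    else none

/-- Simulation of page content that is chosen by the adversary. -/
def simInject (n : ℕ) (t : Str) (st : Sim) (s : MACState) : Option (Unit × Sim) × MACState :=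
  (canInject κ st).elim (none, s) fun _ =>
    let w := P.simCheck n t st s
    (some ((), w.1), w.2)

end Scheme

section

variable {α : Type} [Data α] (P : Scheme) (κ : Kind) {r : α → StepCoins} {f g : α → Str}
  {st : α → Sim}

theorem Comp.simRegisterHonest : Comp fun z : StepCoins × Str × Sim =>
    P.simRegisterHonest z.1 z.2.1 z.2.2 := by
  unfold Scheme.simRegisterHonest; fun_prop

theorem Comp.simRegisterCorrupt : Comp fun z : StepCoins × (Str × Str) × Sim =>
    P.simRegisterCorrupt κ z.1 z.2.1.1 z.2.1.2 z.2.2 := by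
  unfold Scheme.simRegisterCorrupt; fun_prop

@[fun_prop]
theorem Comp.serverSecrets {u : α → List Unit} (hu : Comp u) (hf : Comp f) (hg : Comp g) :
    Comp fun x => P.serverSecrets (u x) (f x) (g x) := by
  unfold Scheme.serverSecrets; fun_prop

end

/-! ### Simulated calls take polynomial time -/

section

variable {α : Type} [Data α] (P : Scheme) (κ : Kind) {r : α → StepCoins} {f g : α → Str}
  {st : α → Sim}

@[fun_prop]
theorem Comp.webSecrets {u : α → List Unit} (hr : Comp r) (hu : Comp u) (hf : Comp f) :
    Comp fun x => P.webSecrets (r x) (u x) (f x) := by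
  unfold Scheme.webSecrets; fun_prop

@[fun_prop]
theorem Comp.simPublicKeys {l : α → List Str} (hl : Comp l) (hst : Comp st) :
    Comp fun x => Scheme.simPublicKeys (l x) (st x) := by
  unfold Scheme.simPublicKeys; fun_prop

theorem Comp.simEnrolServer : Comp fun z : StepCoins × Str × Sim =>
    P.simEnrolServer z.1 z.2.1 z.2.2 := by
  unfold Scheme.simEnrolServer Scheme.simDcpEnrolServer; fun_prop

theorem Comp.simEnrolServerAs :
    Comp fun z : StepCoins × (Str × Str × Str × Str × Str × Str) × Sim =>
      P.simDcpEnrolServer z.1.1 z.2.1.1 z.2.1.2.1 z.2.1.2.2.1 z.2.1.2.2.2.1 z.2.1.2.2.2.2.1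
        z.2.1.2.2.2.2.2 z.2.2 := by
  unfold Scheme.simDcpEnrolServer; fun_prop

theorem Comp.simEnrolUser : Comp fun z : StepCoins × (List Str × Str) × Sim =>
    P.simEnrolUser z.1 z.2.1.1 z.2.1.2 z.2.2 := by
  unfold Scheme.simEnrolUser; fun_prop

theorem Comp.simEnrolUserAs : Comp fun z : StepCoins × (Str × ℕ × Str × List Str) × Sim =>
    P.simEnrolUserAs z.1 z.2.1.1 z.2.1.2.1 z.2.1.2.2.1 z.2.1.2.2.2 z.2.2 := by
  unfold Scheme.simEnrolUserAs; fun_prop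

theorem Comp.simHelloAs : Comp fun z : StepCoins × (Str × Str) × Sim =>
    P.simServerHello z.1 false z.2.1.1 z.2.1.2 z.2.2 := by
  unfold Scheme.simServerHello; fun_prop

theorem Comp.simHello : Comp fun z : StepCoins × Unit × Sim => P.simHello z.1 z.2.2 := by
  unfold Scheme.simHello Scheme.simServerHello; fun_prop

theorem Comp.simToServer :
    Comp fun z : StepCoins × (Str × Str × Str × Str × Str × Str) × Sim =>
      P.simToServer z.2.1.1 z.2.1.2.1 z.2.1.2.2.1 z.2.1.2.2.2.1 z.2.1.2.2.2.2.1
        z.2.1.2.2.2.2.2 z.2.2 := by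
  unfold Scheme.simToServer; fun_prop

theorem CompIn.simSignal : CompIn P.oracle fun n (z : StepCoins × Str × Sim) =>
    P.simSignal z.1 n z.2.1 z.2.2 := by
  refine CompIn.elim (α := StepCoins × Str × Sim) (β := SimUser × Str)
    (o := fun z => z.2.2.user.bind fun u => (assoc z.2.2.pks z.2.1).map fun pk => (u, pk))
    (f := fun _ _ s => (none, s))
    (g := fun n z s =>
      let w := P.tagWith n z.1.2.2.un none [z.2.1.1, z.2.1.2.1.bits] s
      let nonceA := P.encodeDistress z.1.2.2.un.length z.2.2 z.1.1.1 z.2.1.1 w.1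
      (some (nonceA, z.1.2.2.setUser (z.2.1.1, z.2.1.2.1 + 1, some (z.1.2.1, z.2.1.2.1, nonceA))),
        w.2))
    (by fun_prop) (CompIn.pure (f := fun _ => none) (by fun_prop)) ?_
  exact CompIn.map (f := fun n (z : (StepCoins × Str × Sim) × SimUser × Str) =>
      P.tagWith n z.1.2.2.un none [z.2.1.1, z.2.1.2.1.bits])
    (g := fun z : ((StepCoins × Str × Sim) × SimUser × Str) × Str =>
      let nonceA := P.encodeDistress z.1.1.2.2.un.length z.1.2.2 z.1.1.1.1 z.1.2.1.1 z.2
      some (nonceA, z.1.1.2.2.setUser (z.1.2.1.1, z.1.2.1.2.1 + 1,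
        some (z.1.1.2.1, z.1.2.1.2.1, nonceA))))
    (CompIn.tagWith P (by fun_prop) (by fun_prop) (by fun_prop)) (by fun_prop)

theorem CompIn.findSqn {u : α → List Unit} {k : α → Option Str} {m : α → ℕ} (hu : Comp u)
    (hk : Comp k) (hf : Comp f) (hm : Comp m) (hg : Comp g) (j : ℕ) :
    CompIn P.oracle fun n x => P.findSqn n (u x) (k x) (f x) (m x) (g x) j := by
  induction j with
  | zero => exact CompIn.pure (f := fun _ => none) (by fun_prop)
  | succ j ih =>
    refine CompIn.bind ih (g := fun n z s => z.2.elim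
      (let y := P.vrfyWith n (u z.1) (k z.1) [f z.1, (m z.1 + j).bits] (g z.1) s
      (bif y.1 then some (m z.1 + j) else none, y.2)) fun i => (some i, s)) ?_
    refine CompIn.elim (o := fun z : α × Option ℕ => z.2) (g := fun n z s => (some z.2, s))
      (by fun_prop) ?_ (CompIn.pure (f := fun z : (α × Option ℕ) × ℕ => some z.2) (by fun_prop))
    exact CompIn.map (f := fun n (z : α × Option ℕ) =>
        P.vrfyWith n (u z.1) (k z.1) [f z.1, (m z.1 + j).bits] (g z.1))
      (g := fun z : (α × Option ℕ) × Bool => bif z.2 then some (m z.1.1 + j) else none)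
      (CompIn.vrfyWith P (by fun_prop) (by fun_prop) (by fun_prop) (by fun_prop)) (by fun_prop)

theorem CompIn.simToDCP : CompIn P.oracle fun n (z : StepCoins × (Str × Str × Str × Str) × Sim) =>
    P.simToDCP z.1 n z.2.1.1 z.2.1.2.1 z.2.1.2.2.1 z.2.1.2.2.2 z.2.2 := by
  refine CompIn.elim (α := StepCoins × (Str × Str × Str × Str) × Sim)
    (β := (Str × Str × Str) × (Str × Str) × SimRecord)
    (o := fun z => P.authentic z.2.1.1 z.2.1.2.1 z.2.1.2.2.1 z.2.1.2.2.2 z.2.2)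
    (f := fun _ _ s => (none, s))
    (g := fun n z s =>
      let v := P.findSqn n z.1.2.2.un z.2.2.2.1 z.2.2.1.1 z.2.2.2.2.1 z.2.2.1.2 (P.nMax + 1) s
      v.1.elim (none, v.2) fun m =>
        let w := P.tagWith n z.1.2.2.un z.2.2.2.1 [m.bits] v.2
        let c' := P.sym.enc z.1.2.2.un.length z.2.1.2.1 z.1.1.1 [z.2.2.2.2.2]
        let nonceC := P.nonce z.1.2.2.un.length z.1.1.2.1
        (some ((c', w.1, nonceC,
          P.mac.tag z.1.2.2.un.length z.2.1.2.2 [c', w.1, z.1.2.1.2.2.1, nonceC]),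
          z.1.2.2.addRecord (z.2.2.1.1, z.2.2.2.1, m + 1, z.2.2.2.2.2)), w.2))
    (by unfold Scheme.authentic; fun_prop) (CompIn.pure (f := fun _ => none) (by fun_prop)) ?_
  refine CompIn.bind_elim
    (α := (StepCoins × (Str × Str × Str × Str) × Sim) × (Str × Str × Str) × (Str × Str) × SimRecord)
    (f := fun n z => P.findSqn n z.1.2.2.un z.2.2.2.1 z.2.2.1.1 z.2.2.2.2.1 z.2.2.1.2 (P.nMax + 1))
    (v := fun _ => none)
    (g := fun n z s =>
      let w := P.tagWith n z.1.1.2.2.un z.1.2.2.2.1 [z.2.bits] s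
      let c' := P.sym.enc z.1.1.2.2.un.length z.1.2.1.2.1 z.1.1.1.1 [z.1.2.2.2.2.2]
      let nonceC := P.nonce z.1.1.2.2.un.length z.1.1.1.2.1
      (some ((c', w.1, nonceC,
        P.mac.tag z.1.1.2.2.un.length z.1.2.1.2.2 [c', w.1, z.1.1.2.1.2.2.1, nonceC]),
        z.1.1.2.2.addRecord (z.1.2.2.1.1, z.1.2.2.2.1, z.2 + 1, z.1.2.2.2.2.2)), w.2))
    (CompIn.findSqn P (by fun_prop) (by fun_prop) (by fun_prop) (by fun_prop) (by fun_prop) _)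
    (by fun_prop) ?_
  exact CompIn.map (f := fun n (z : ((StepCoins × (Str × Str × Str × Str) × Sim) ×
        (Str × Str × Str) × (Str × Str) × SimRecord) × ℕ) =>
      P.tagWith n z.1.1.2.2.un z.1.2.2.2.1 [z.2.bits])
    (g := fun y : (((StepCoins × (Str × Str × Str × Str) × Sim) × (Str × Str × Str) ×
        (Str × Str) × SimRecord) × ℕ) × Str =>
      let z := y.1
      let c' := P.sym.enc z.1.1.2.2.un.length z.1.2.1.2.1 z.1.1.1.1 [z.1.2.2.2.2.2]
      let nonceC := P.nonce z.1.1.2.2.un.length z.1.1.1.2.1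
      some ((c', y.2, nonceC,
        P.mac.tag z.1.1.2.2.un.length z.1.2.1.2.2 [c', y.2, z.1.1.2.1.2.2.1, nonceC]),
        z.1.1.2.2.addRecord (z.1.2.2.1.1, z.1.2.2.2.1, z.2 + 1, z.1.2.2.2.2.2)))
    (CompIn.tagWith P (by fun_prop) (by fun_prop) (by fun_prop)) (by fun_prop)

theorem CompIn.simCheck (hf : Comp f) (hst : Comp st) :
    CompIn P.oracle fun n x => P.simCheck n (f x) (st x) := by
  refine CompIn.elim (β := SimUser × Str × ℕ × Str)
    (o := fun x => (st x).user.bind fun u => u.2.2.map fun v => (u, v))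
    (f := fun _ x s => (st x, s))
    (g := fun n z s =>
      let w := P.vrfyWith n (st z.1).un none [z.2.2.2.1.bits] (f z.1) s
      (bif w.1 then (st z.1).setUser (z.2.1.1, z.2.1.2.1, none) else st z.1, w.2))
    (by fun_prop) (CompIn.pure (by fun_prop)) ?_
  exact CompIn.map (f := fun n (z : α × SimUser × Str × ℕ × Str) =>
      P.vrfyWith n (st z.1).un none [z.2.2.2.1.bits] (f z.1))
    (g := fun y : (α × SimUser × Str × ℕ × Str) × Bool =>
      bif y.2 then (st y.1.1).setUser (y.1.2.1.1, y.1.2.1.2.1, none) else st y.1.1)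
    (CompIn.vrfyWith P (by fun_prop) (by fun_prop) (by fun_prop) (by fun_prop)) (by fun_prop)

theorem CompIn.simPage : CompIn P.oracle fun n (z : StepCoins × (Str × Str) × Sim) =>
    P.simPage κ n z.2.1.1 z.2.1.2 z.2.2 := by
  refine CompIn.elim (α := StepCoins × (Str × Str) × Sim) (β := Str × Bool)
    (o := fun z => Scheme.pageContent z.2.1.1 z.2.1.2 z.2.2)
    (f := fun _ _ s => (none, s))
    (g := fun n z s => bif z.2.2 then
      let w := P.simCheck n z.2.1 z.1.2.2 s
      (some (bif decide (κ = .loc) then some z.2.1 else none, w.1), w.2)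
    else (some (some z.2.1, z.1.2.2), s))
    (by unfold Scheme.pageContent; fun_prop) (CompIn.pure (f := fun _ => none) (by fun_prop)) ?_
  refine CompIn.bif (by fun_prop) ?_ (CompIn.pure
    (f := fun z : (StepCoins × (Str × Str) × Sim) × Str × Bool => some (some z.2.1, z.1.2.2))
    (by fun_prop))
  exact CompIn.map (g := fun y : ((StepCoins × (Str × Str) × Sim) × Str × Bool) × Sim =>
      some (bif decide (κ = .loc) then some y.1.2.1 else none, y.2))
    (CompIn.simCheck P (by fun_prop) (by fun_prop)) (by fun_prop)

theorem CompIn.simInject : CompIn P.oracle fun n (z : StepCoins × Str × Sim) =>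
    P.simInject κ n z.2.1 z.2.2 := by
  refine CompIn.elim (α := StepCoins × Str × Sim) (β := Unit)
    (o := fun z => Scheme.canInject κ z.2.2)
    (f := fun _ _ s => (none, s))
    (g := fun n z s =>
      let w := P.simCheck n z.1.2.1 z.1.2.2 s
      (some ((), w.1), w.2))
    (by unfold Scheme.canInject; fun_prop) (CompIn.pure (f := fun _ => none) (by fun_prop)) ?_
  exact CompIn.map (g := fun y : ((StepCoins × Str × Sim) × Unit) × Sim => some ((), y.2))
    (CompIn.simCheck P (by fun_prop) (by fun_prop)) (by fun_prop)

end

namespace Sim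

variable (P : Scheme)

/-- The coins of the next step. -/
def coins (st : Sim) : StepCoins :=
  (st.tape.take (P.ℓ.eval st.un.length),
    (st.tape.drop (P.ℓ.eval st.un.length)).take (P.ℓ.eval st.un.length),
    ((st.tape.drop (P.ℓ.eval st.un.length)).drop (P.ℓ.eval st.un.length)).take
      (P.ℓ.eval st.un.length),
    (((st.tape.drop (P.ℓ.eval st.un.length)).drop (P.ℓ.eval st.un.length)).drop
      (P.ℓ.eval st.un.length)).take (P.ℓ.eval st.un.length))

/-- The state after the coins of one step have been used up. -/
def next (st : Sim) : Sim :=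
  st.setTape ((((st.tape.drop (P.ℓ.eval st.un.length)).drop (P.ℓ.eval st.un.length)).drop
    (P.ℓ.eval st.un.length)).drop (P.ℓ.eval st.un.length))

end Sim

@[fun_prop]
theorem Comp.sim_coins (P : Scheme) : Comp (Sim.coins P) := by unfold Sim.coins; fun_prop

@[fun_prop]
theorem Comp.sim_next (P : Scheme) : Comp (Sim.next P) := by unfold Sim.next; fun_prop

/-- A simulated step: it uses up its coins, and nothing else changes if it is aborted. -/
def simPerform (P : Scheme) {α β : Type}
    (f : ℕ → StepCoins × α × Sim → MACState → Option (β × Sim) × MACState) (n : ℕ)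
    (z : α × Sim) (s : MACState) : (Option β × Sim) × MACState :=
  let y := f n (z.2.coins P, z.1, z.2.next P) s
  (y.1.elim (none, z.2.next P) fun w => (some w.1, w.2), y.2)

theorem CompIn.simPerform (P : Scheme) {α β : Type} [Data α] [Data β]
    {f : ℕ → StepCoins × α × Sim → MACState → Option (β × Sim) × MACState}
    (hf : CompIn P.oracle f) : CompIn P.oracle (simPerform P f) := by
  refine CompIn.map (g := fun y : (α × Sim) × Option (β × Sim) =>
    y.2.elim (none, y.1.2.next P) fun w => (some w.1, w.2))
    (hf.comp (f := fun z : α × Sim => (z.2.coins P, z.1, z.2.next P)) (by fun_prop)) (by fun_prop)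

namespace Scheme

variable (P : Scheme) (κ : Kind)

/-- The simulated answer to a call. -/
def simHandle (n : ℕ) (i : Call) : (protocolInterface.dom i).den × Sim → MACState →
    ((protocolInterface.cod i).den × Sim) × MACState :=
  match i with
  | .caPublicKey => simPerform P (α := Unit) (β := Str) (fun _ z s =>
      (some (z.2.2.caPk, z.2.2), s)) n
  | .registerHonest => simPerform P (α := Str) (β := Str × Str) (fun _ z s =>
      (P.simRegisterHonest z.1 z.2.1 z.2.2, s)) n
  | .registerCorrupt => simPerform P (α := Str × Str) (β := Str) (fun _ z s =>
      (P.simRegisterCorrupt κ z.1 z.2.1.1 z.2.1.2 z.2.2, s)) n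
  | .enrolServer => simPerform P (α := Str) (β := Str) (fun _ z s =>
      (P.simEnrolServer z.1 z.2.1 z.2.2, s)) n
  | .enrolServerAs => simPerform P (α := Str × Str × Str × Str × Str × Str) (β := Str)
      (fun _ z s => (P.simDcpEnrolServer z.1.1 z.2.1.1 z.2.1.2.1 z.2.1.2.2.1 z.2.1.2.2.2.1
        z.2.1.2.2.2.2.1 z.2.1.2.2.2.2.2 z.2.2, s)) n
  | .enrolUser => simPerform P (α := List Str × Str) (β := Unit) (fun _ z s =>
      (P.simEnrolUser z.1 z.2.1.1 z.2.1.2 z.2.2, s)) n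
  | .enrolUserAs => simPerform P (α := Str × ℕ × Str × List Str)
      (β := Str × List (Str × Str) × Str) (fun _ z s =>
      (P.simEnrolUserAs z.1 z.2.1.1 z.2.1.2.1 z.2.1.2.2.1 z.2.1.2.2.2 z.2.2, s)) n
  | .signal => simPerform P (α := Str) (β := Str) (fun n z =>
      P.simSignal z.1 n z.2.1 z.2.2) n
  | .hello => simPerform P (α := Unit) (β := Str × Str × Str × Str) (fun _ z s =>
      (P.simHello z.1 z.2.2, s)) n
  | .helloAs => simPerform P (α := Str × Str) (β := Str × Str × Str × Str) (fun _ z s =>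
      (P.simServerHello z.1 false z.2.1.1 z.2.1.2 z.2.2, s)) n
  | .toDCP => simPerform P (α := Str × Str × Str × Str) (β := Str × Str × Str × Str)
      (fun n z => P.simToDCP z.1 n z.2.1.1 z.2.1.2.1 z.2.1.2.2.1 z.2.1.2.2.2 z.2.2) n
  | .toServer => simPerform P (α := Str × Str × Str × Str × Str × Str) (β := Unit) (fun _ z s =>
      (P.simToServer z.2.1.1 z.2.1.2.1 z.2.1.2.2.1 z.2.1.2.2.2.1 z.2.1.2.2.2.2.1
        z.2.1.2.2.2.2.2 z.2.2, s)) n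
  | .page => simPerform P (α := Str × Str) (β := Option Str) (fun n z =>
      P.simPage κ n z.2.1.1 z.2.1.2 z.2.2) n
  | .inject => simPerform P (α := Str) (β := Unit) (fun n z =>
      P.simInject κ n z.2.1 z.2.2) n

/-- The answers to calls can be simulated in polynomial time. -/
theorem exists_simHandle_code (i : Call) :
    ∃ (c : Code macInterface (.prod (protocolInterface.dom i) (Data.ty Sim))
        (.prod (protocolInterface.cod i) (Data.ty Sim))) (p : Polynomial ℕ), ∀ n x st s,
      (c.run (P.oracle n) (x, Data.enc st) s).1 = ((P.simHandle κ n i (x, st) s).1.1,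
        Data.enc (P.simHandle κ n i (x, st) s).1.2) ∧
      (c.run (P.oracle n) (x, Data.enc st) s).2.1 = (P.simHandle κ n i (x, st) s).2 ∧
      (c.run (P.oracle n) (x, Data.enc st) s).2.2 ≤
        p.eval (n + (1 + (protocolInterface.dom i).size x + dsize st)) := by
  have key : ∀ {α β : Type} [Data α] [Data β] {f : ℕ → StepCoins × α × Sim → MACState →
      Option (β × Sim) × MACState}, CompIn P.oracle f →
      ∃ (c : Code macInterface (.prod (Data.ty α) (Data.ty Sim))
        (.prod (.opt (Data.ty β)) (Data.ty Sim))) (p : Polynomial ℕ), ∀ n (x : α) (st : Sim) s,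
      (c.run (P.oracle n) (Data.enc (x, st)) s).1 = Data.enc (simPerform P f n (x, st) s).1 ∧
      (c.run (P.oracle n) (Data.enc (x, st)) s).2.1 = (simPerform P f n (x, st) s).2 ∧
      (c.run (P.oracle n) (Data.enc (x, st)) s).2.2 ≤ p.eval (n + (1 + dsize x + dsize st)) := by
    intro α β _ _ f hf
    obtain ⟨c, p, h⟩ := CompIn.simPerform P hf
    exact ⟨c, p, fun n x st s => by rw [← dsize_prod]; exact h n (x, st) s⟩
  cases i with
  | caPublicKey => exact key (CompIn.pure
      (f := fun z : StepCoins × Unit × Sim => some (z.2.2.caPk, z.2.2)) (by fun_prop))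
  | registerHonest => exact key (CompIn.pure (Comp.simRegisterHonest P))
  | registerCorrupt => exact key (CompIn.pure (Comp.simRegisterCorrupt P κ))
  | enrolServer => exact key (CompIn.pure (Comp.simEnrolServer P))
  | enrolServerAs => exact key (CompIn.pure (Comp.simEnrolServerAs P))
  | enrolUser => exact key (CompIn.pure (Comp.simEnrolUser P))
  | enrolUserAs => exact key (CompIn.pure (Comp.simEnrolUserAs P))
  | signal => exact key (CompIn.simSignal P)
  | hello => exact key (CompIn.pure (Comp.simHello P))
  | helloAs => exact key (CompIn.pure (Comp.simHelloAs P))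
  | toDCP => exact key (CompIn.simToDCP P)
  | toServer => exact key (CompIn.pure (Comp.simToServer P))
  | page => exact key (CompIn.simPage P κ)
  | inject => exact key (CompIn.simInject P κ)

end Scheme

/-! ### The simulation is perfect -/

section

variable {α β γ : Type} [DecidableEq α]

theorem assoc_cons (e : α × β) (l : List (α × β)) (x : α) :
    assoc (e :: l) x = if e.1 = x then some e.2 else assoc l x := by
  unfold assoc
  by_cases h : e.1 = x <;> simp [h]

theorem map_assoc_cons (f : β → γ) (e : α × β) (l : List (α × β)) :
    (fun x => (assoc (e :: l) x).map f) =
      Function.update (fun x => (assoc l x).map f) e.1 (some (f e.2)) := by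
  funext x
  rw [assoc_cons]
  by_cases h : e.1 = x
  · subst h; simp
  · simp [h, Function.update_of_ne (Ne.symm h)]

theorem lookup_eq_assoc [BEq α] [LawfulBEq α] (l : List (α × β)) (x : α) :
    l.lookup x = assoc l x := by
  induction l with
  | nil => rfl
  | cons e l ih =>
    rw [assoc_cons, List.lookup_cons, ih]
    by_cases h : e.1 = x
    · simp [h]
    · have : (x == e.1) = false := by simpa using Ne.symm h
      simp [h, this]

theorem assoc_mem {l : List (α × β)} {x : α} {y : β} (h : assoc l x = some y) : (x, y) ∈ l := by
  unfold assoc at h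
  obtain ⟨e, he, rfl⟩ := Option.map_eq_some_iff.1 h
  have h1 := List.mem_of_find?_eq_some he
  have h2 := List.find?_some he
  simp only [decide_eq_true_eq] at h2
  rwa [← h2]

end

namespace Sim

variable (P : Scheme)

/-- The coins of a step, by index. -/
def coin (r : StepCoins) : Fin 4 → Str := ![r.1, r.2.1, r.2.2.1, r.2.2.2]

/-- An honest webserver of the simulator, as a party of the protocol. -/
def webServer (w : SimServer) : WebServer :=
  ⟨w.1, w.2.1, w.2.2.1, w.2.2.2.map fun k => ⟨k.1, k.2.1, k.2.2⟩⟩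

/-- The state of the protocol that is simulated, where `key` is the MAC key of the honest user, `a`
and `c` are the coins for the exponents, and `tr` is the sequence of events. -/
def toState (key a c : Str) (tr : List Event) (st : Sim) : State where
  tape j l := (st.tape.drop (P.ℓ.eval st.un.length * (4 * j + l))).take (P.ℓ.eval st.un.length)
  aUser := a
  cUser := c
  caPk := st.caPk
  caSk := st.caSk
  honest B := (assoc st.honest B).map webServer
  corrupt B := (assoc st.corrupt B).isSome
  tls x := (assoc st.tls x).map fun v => ⟨v.1, v.2.1, v.2.2⟩
  serverDB B := (assoc st.serverDB B).map fun e => ⟨e.1, e.2.1, e.2.2⟩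
  userDB id := (assoc st.userDB id).map fun u => ⟨u.1.getD key, u.2.1, u.2.2⟩
  user := st.user.map fun u =>
    ⟨u.1, key, u.2.1, st.pks, u.2.2.map fun v => ⟨v.1, v.2.1, v.2.2⟩⟩
  trace := tr

variable {P} {key a c : Str} {tr : List Event} (st : Sim)

theorem toState_addHonest (e : Str × SimServer) : toState P key a c tr (st.addHonest e) =
    { toState P key a c tr st with
      honest := Function.update (toState P key a c tr st).honest e.1 (some (webServer e.2)) } := by
  unfold toState
  simp only [addHonest, honest, map_assoc_cons]
  rfl

theorem toState_addCorrupt (B : Str) : toState P key a c tr (st.addCorrupt B) =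
    { toState P key a c tr st with
      corrupt := Function.update (toState P key a c tr st).corrupt B true } := by
  have : (fun x => (assoc ((B, ()) :: st.corrupt) x).isSome) =
      Function.update (fun x => (assoc st.corrupt x).isSome) B true := by
    funext x
    rw [assoc_cons]
    by_cases h : B = x
    · subst h; simp
    · simp [h, Function.update_of_ne (Ne.symm h)]
  unfold toState
  rw [← this]
  rfl

theorem toState_addTLS (e : (Str × Str) × SimTLS) : toState P key a c tr (st.addTLS e) =
    { toState P key a c tr st with
      tls := Function.update (toState P key a c tr st).tls e.1
        (some ⟨e.2.1, e.2.2.1, e.2.2.2⟩) } := by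
  unfold toState
  simp only [addTLS, tls, map_assoc_cons]
  rfl

theorem toState_addServer (e : Str × Str × Str × Str) :
    toState P key a c tr (st.addServer e) =
      { toState P key a c tr st with
        serverDB := Function.update (toState P key a c tr st).serverDB e.1
          (some ⟨e.2.1, e.2.2.1, e.2.2.2⟩) } := by
  unfold toState
  simp only [addServer, serverDB, map_assoc_cons]
  rfl

theorem toState_addRecord (e : Str × SimRecord) : toState P key a c tr (st.addRecord e) =
    { toState P key a c tr st with
      userDB := Function.update (toState P key a c tr st).userDB e.1
        (some ⟨e.2.1.getD key, e.2.2.1, e.2.2.2⟩) } := by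
  unfold toState
  simp only [addRecord, userDB, map_assoc_cons]
  rfl

theorem toState_setUser (u : SimUser) : toState P key a c tr (st.setUser u) =
    { toState P key a c tr st with
      user := some ⟨u.1, key, u.2.1, st.pks, u.2.2.map fun v => ⟨v.1, v.2.1, v.2.2⟩⟩ } := rfl

theorem toState_next : toState P key a c tr (st.next P) =
    { toState P key a c tr st with tape := fun j => (toState P key a c tr st).tape (j + 1) } := by
  have : ∀ j l : ℕ, ((st.next P).tape.drop (P.ℓ.eval st.un.length * (4 * j + l))) =
      st.tape.drop (P.ℓ.eval st.un.length * (4 * (j + 1) + l)) := by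
    intro j l
    simp only [next, setTape, tape, List.drop_drop]
    congr 1
    ring
  unfold toState
  simp only [← this]
  rfl

theorem toState_tape_zero : (toState P key a c tr st).tape 0 = coin (st.coins P) := by
  funext l
  fin_cases l <;> simp [toState, coin, coins, List.drop_drop] <;> congr 2 <;> ring

end Sim

namespace Scheme
open Sim

variable (P : Scheme) (κ : Kind) {key a c : Str} {tr : List Event} (st : Sim) (r : StepCoins)

theorem registerHonest_toState (B : Str) :
    P.registerHonest st.un.length (coin r) B (toState P key a c tr st) =
      (P.simRegisterHonest r B st).map fun y => (y.1, toState P key a c tr y.2) := by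
  unfold registerHonest simRegisterHonest
  have h1 : ((toState P key a c tr st).honest B).isSome = (assoc st.honest B).isSome := by
    simp [toState]
  have h2 : (toState P key a c tr st).corrupt B = (assoc st.corrupt B).isSome := rfl
  rw [h1, h2]
  cases (assoc st.honest B).isSome || (assoc st.corrupt B).isSome with
  | true => rfl
  | false =>
    simp only [cond_false, Option.map_some, toState_addHonest]
    rfl

theorem registerCorrupt_toState (B pk : Str) :
    P.registerCorrupt κ st.un.length (coin r) B pk (toState P key a c tr st) =
      (P.simRegisterCorrupt κ r B pk st).map fun y => (y.1, toState P key a c tr y.2) := by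
  unfold registerCorrupt simRegisterCorrupt
  have h1 : ((toState P key a c tr st).honest B).isSome = (assoc st.honest B).isSome := by
    simp [toState]
  rw [h1]
  cases decide (κ ≠ .web) || (assoc st.honest B).isSome with
  | true => rfl
  | false =>
    simp only [cond_false, Option.map_some, toState_addCorrupt]
    rfl

theorem dcpEnrolServer_toState (e gb B certPk cert pk' s : Str) :
    P.dcpEnrolServer st.un.length e gb B certPk cert pk' s (toState P key a c tr st) =
      (P.simDcpEnrolServer e gb B certPk cert pk' s st).map
        fun y => (y.1, toState P key a c tr y.2) := by
  unfold dcpEnrolServer simDcpEnrolServer serverSecrets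
  have h : (toState P key a c tr st).caPk = st.caPk := rfl
  rw [h]
  cases P.sig.vrfy st.un.length st.caPk [B, certPk] cert <;>
    cases P.sig.vrfy st.un.length certPk [gb, B, pk'] s <;>
    cases P.dh.pow st.un.length gb e <;>
    cases P.dh.pow st.un.length (P.dh.base st.un.length) e <;>
    (simp [guard, toState_addServer]; try rfl)

theorem enrolServer_toState (B : Str) :
    P.enrolServer st.un.length (coin r) B (toState P key a c tr st) =
      (P.simEnrolServer r B st).map fun y => (y.1, toState P key a c tr y.2) := by
  unfold enrolServer simEnrolServer
  have h : (toState P key a c tr st).honest B = (assoc st.honest B).map webServer := rfl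
  rw [h]
  cases assoc st.honest B with
  | none => rfl
  | some w =>
    have e1 : coin r 1 = r.2.1 := rfl
    cases h1 : P.dh.pow st.un.length (P.dh.base st.un.length) r.2.1 with
    | none => simp [h1, e1]
    | some gb =>
      simp only [e1, h1, Option.map_some, Option.bind_some, Option.bind_eq_bind,
        dcpEnrolServer_toState]
      have e2 : coin r 0 = r.1 := rfl
      have e3 : coin r 2 = r.2.2.1 := rfl
      have e4 : coin r 3 = r.2.2.2 := rfl
      simp only [webServer, e2, e3, e4]
      cases h2 : P.simDcpEnrolServer r.2.2.2 gb B w.1 w.2.2.1 (P.pke.gen st.un.length r.1).1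
        (P.sig.sign st.un.length w.2.1 r.2.2.1 [gb, B, (P.pke.gen st.un.length r.1).1]) st with
      | none => rfl
      | some y =>
        simp only [Option.map_some, Option.bind_some, webSecrets]
        cases P.dh.pow st.un.length y.1 r.2.1 with
        | none => rfl
        | some z =>
          simp only [Option.map_some, Option.bind_some, toState_addHonest]
          rfl

theorem publicKeys_toState (sites : List Str) :
    publicKeys (toState P key a c tr st).serverDB sites = simPublicKeys sites st := by
  unfold publicKeys simPublicKeys
  congr 1
  funext B
  simp [toState, Function.comp_def]

theorem enrolUserAs_toState (ga : Str) (sqn : ℕ) (instruction : Str) (sites : List Str) :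
    P.enrolUserAs st.un.length (coin r) ga sqn instruction sites (toState P key a c tr st) =
      (P.simEnrolUserAs r ga sqn instruction sites st).map
        fun y => (y.1, toState P key a c tr y.2) := by
  unfold enrolUserAs dcpEnrolUser simEnrolUserAs serverSecrets
  have e1 : coin r 0 = r.1 := rfl
  have e2 : coin r 1 = r.2.1 := rfl
  have h : ∀ id, ((toState P key a c tr st).userDB id).isNone = (assoc st.userDB id).isNone := by
    simp [toState]
  simp only [e1, e2, publicKeys_toState, h]
  cases (assoc st.userDB (r.1.take (P.mi st.un.length))).isNone <;>
    cases P.dh.pow st.un.length ga r.2.1 <;>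
    cases P.dh.pow st.un.length (P.dh.base st.un.length) r.2.1 <;>
    simp [guard, toState_addRecord]

theorem enrolUser_toState {n : ℕ} (hn : st.un.length = n) {ω : Coins P.ℓ n × Coins P.ℓ n}
    (sites : List Str) (instruction : Str) :
    P.enrolUser n (coin r) sites instruction
        (toState P (P.dhMacKey n ω) (List.ofFn ω.1) (List.ofFn ω.2) tr st) =
      (P.simEnrolUser r sites instruction st).map fun y =>
        (y.1, toState P (P.dhMacKey n ω) (List.ofFn ω.1) (List.ofFn ω.2) tr y.2) := by
  subst hn
  unfold enrolUser dcpEnrolUser simEnrolUser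
  have e1 : coin r 0 = r.1 := rfl
  have e2 : coin r 1 = r.2.1 := rfl
  have h : ∀ id, ((toState P (P.dhMacKey st.un.length ω) (List.ofFn ω.1) (List.ofFn ω.2) tr
      st).userDB id).isNone = (assoc st.userDB id).isNone := by
    simp [toState]
  have h' : (toState P (P.dhMacKey st.un.length ω) (List.ofFn ω.1) (List.ofFn ω.2) tr
      st).user.isNone = st.user.isNone := by simp [toState]
  have ha : (toState P (P.dhMacKey st.un.length ω) (List.ofFn ω.1) (List.ofFn ω.2) tr
      st).aUser = List.ofFn ω.1 := rfl
  have hc : (toState P (P.dhMacKey st.un.length ω) (List.ofFn ω.1) (List.ofFn ω.2) tr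
      st).cUser = List.ofFn ω.2 := rfl
  have hb : ∀ e, P.dh.pow st.un.length (P.dh.base st.un.length) e =
      some (P.dh.encode st.un.length (P.dh.gen st.un.length ^ toNat e)) := by
    intro e
    simp [DHGroup.pow, DHGroup.base, P.dh.decode_encode]
  have hp : ∀ x e, P.dh.pow st.un.length (P.dh.encode st.un.length x) e =
      some (P.dh.encode st.un.length (x ^ toNat e)) := by
    intro x e
    simp [DHGroup.pow, P.dh.decode_encode]
  have hk : P.kdfMac st.un.length (P.dh.encode st.un.length
      ((P.dh.gen st.un.length ^ toNat (List.ofFn ω.2)) ^ toNat (List.ofFn ω.1))) =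
      P.dhMacKey st.un.length ω := by
    rw [dhMacKey, ← pow_mul, ← pow_mul, mul_comm]
  have hk' : P.kdfMac st.un.length (P.dh.encode st.un.length
      ((P.dh.gen st.un.length ^ toNat (List.ofFn ω.1)) ^ toNat (List.ofFn ω.2))) =
      P.dhMacKey st.un.length ω := rfl
  simp only [e1, e2, h, h', ha, hc, hb, publicKeys_toState]
  cases st.user.isNone <;> cases (assoc st.userDB (r.2.1.take (P.mi st.un.length))).isNone <;>
    simp [guard, hp, hk, hk', toState_setUser]
  exact ⟨rfl, rfl, rfl, rfl, rfl, rfl, rfl, rfl, rfl,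
    (congrArg State.userDB (toState_addRecord st (_, none, _, _))).symm, rfl, rfl⟩

theorem serverHello_toState (b : Bool) (B x : Str) :
    P.serverHello st.un.length (coin r) b B x (toState P key a c tr st) =
      (P.simServerHello r b B x st).map fun y => (y.1, toState P key a c tr y.2) := by
  unfold serverHello simServerHello
  have e1 : coin r 0 = r.1 := rfl
  have e2 : coin r 1 = r.2.1 := rfl
  have h : (toState P key a c tr st).honest B = (assoc st.honest B).map webServer := rfl
  rw [h, e1, e2]
  cases assoc st.honest B with
  | none => rfl
  | some w =>
    obtain ⟨pk, sk, cert, k⟩ := w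
    cases k with
    | none => rfl
    | some k =>
      simp only [Option.map_some, Option.bind_some, Option.bind_eq_bind, webServer]
      cases P.decodeDistress st.un.length k.1 x with
      | none => rfl
      | some y => simp [toState_addTLS]

theorem hello_toState :
    P.hello st.un.length (coin r) (toState P key a c tr st) =
      (P.simHello r st).map fun y => (y.1, toState P key a c tr y.2) := by
  unfold hello simHello
  have h : (toState P key a c tr st).user = st.user.map fun u =>
    ⟨u.1, key, u.2.1, st.pks, u.2.2.map fun v => ⟨v.1, v.2.1, v.2.2⟩⟩ := rfl
  rw [h]
  rcases st.user with _ | ⟨id, sqn, _ | v⟩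
  · rfl
  · rfl
  · simp only [Option.map_some, Option.bind_some, Option.bind_eq_bind]
    exact P.serverHello_toState st r true v.1 v.2.2

theorem toServer_toState (B nonceB e s nonceC t : Str) :
    P.toServer st.un.length B nonceB e s nonceC t (toState P key a c tr st) =
      (P.simToServer B nonceB e s nonceC t st).map fun y => (y.1, toState P key a c tr y.2) := by
  unfold toServer simToServer
  have h : (toState P key a c tr st).honest B = (assoc st.honest B).map webServer := rfl
  have h' : (toState P key a c tr st).tls (B, nonceB) = (assoc st.tls (B, nonceB)).map fun v =>
    ⟨v.1, v.2.1, v.2.2⟩ := rfl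
  rw [h, h']
  cases assoc st.honest B with
  | none => rfl
  | some w =>
    obtain ⟨pk, sk, cert, k⟩ := w
    cases k with
    | none => rfl
    | some k =>
      simp only [Option.map_some, Option.bind_some, Option.bind_eq_bind, webServer]
      cases assoc st.tls (B, nonceB) with
      | none => rfl
      | some v =>
        simp only [Option.map_some, Option.bind_some]
        cases P.mac.vrfy st.un.length k.2.2 [e, s, nonceB, nonceC] t <;>
          cases P.sym.dec st.un.length k.2.1 e <;> simp [guard, toState_addTLS]

end Scheme

/-! ### Runs without a forgery -/

theorem toNat_bits (m : ℕ) : toNat m.bits = m := by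
  induction m using Nat.binaryRec' with
  | zero => simp [toNat]
  | bit b m h ih =>
    rw [Nat.bits_append_bit m b h]
    exact congrArg (Nat.bit b) ih

theorem bits_injective : Function.Injective Nat.bits :=
  Function.LeftInverse.injective toNat_bits

/-- What holds as long as no forgery has occurred, for the honest user, the user database of the
DCP, the messages that were tagged with the key of the honest user, and the sequence of events.

The messages tagged for a signal have two components and those of a confirmation have one, so that
one kind cannot be taken for the other. Sequence numbers only increase; so the current distress
cannot have been received before it was signalled. -/
structure Safe (user : Option SimUser) (db : List (Str × SimRecord)) (tagged : List (List Str))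
    (tr : List Event) : Prop where
  assured : Assured tr
  /-- an identifier is in use once a distress of it has been received -/
  registered : ∀ id B m, Event.received id B m ∈ tr → (assoc db id).isSome
  tagged_nil : user = none → tagged = []
  not_signalled : user = none → ∀ id B m, Event.signalled id B m ∉ tr
  key_isSome : user = none → ∀ id u, assoc db id = some u → u.1.isSome
  /-- the DCP uses the key of the honest user for the identifier of the user only -/
  key_eq_none : ∀ u, user = some u → ∀ id v, assoc db id = some v → (v.1 = none ↔ id = u.1)
  enrolled : ∀ u, user = some u → (assoc db u.1).isSome
  signalled_lt : ∀ u, user = some u → ∀ id B m, Event.signalled id B m ∈ tr → m < u.2.1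
  /-- a tag belongs to a signal of the user or to a distress that was received -/
  mem_tagged : ∀ u, user = some u → ∀ l ∈ tagged, ∃ m B,
    (l = [u.1, m.bits] ∧ Event.signalled u.1 B m ∈ tr) ∨
      (l = [m.bits] ∧ Event.received u.1 B m ∈ tr)
  received : ∀ u, user = some u → ∀ B m, Event.received u.1 B m ∈ tr →
    ∃ B', Event.signalled u.1 B' m ∈ tr
  /-- a session starts with the last signal, and its distress was not received before -/
  session : ∀ u, user = some u → ∀ v, u.2.2 = some v → ∃ past recent,
    tr = past ++ .signalled u.1 v.1 v.2.1 :: recent ∧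
      (∀ id B m, Event.signalled id B m ∉ recent) ∧ ∀ B, Event.received u.1 B v.2.1 ∉ past

/-- The guarantee has to be verified only when the user completes the protocol. -/
theorem Assured.concat {tr : List Event} (h : Assured tr) (e : Event)
    (he : ∀ id B m, e = .completed id B m → ∃ past recent : List Event,
      tr = past ++ .signalled id B m :: recent ∧ (∃ B', .received id B' m ∈ recent) ∧
        ∀ id' B' m', .signalled id' B' m' ∉ recent) : Assured (tr ++ [e]) := by
  intro pre post id B m heq
  rcases post.eq_nil_or_concat with rfl | ⟨l, b, rfl⟩
  · obtain ⟨rfl, h1⟩ := List.append_inj' heq rfl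
    exact he id B m (by simpa using h1)
  · have h1 : tr ++ [e] = (pre ++ .completed id B m :: l) ++ [b] := by simpa using heq
    exact h _ l id B m (List.append_inj' h1 rfl).1

theorem safe_nil : Safe none [] [] [] where
  assured pre post id B m h := by simp at h
  registered := by simp
  tagged_nil := by simp
  not_signalled := by simp
  key_isSome := by simp [assoc]
  key_eq_none := by simp
  enrolled := by simp
  signalled_lt := by simp
  mem_tagged := by simp
  received := by simp
  session := by simp

section

variable {db : List (Str × SimRecord)} {tagged : List (List Str)} {tr : List Event}

/-- Enrolment of the honest user with a new identifier. -/
theorem Safe.enrolUser (h : Safe none db tagged tr) {id : Str} (hid : assoc db id = none)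
    (sqn : ℕ) (instruction : Str) :
    Safe (some (id, sqn, none)) ((id, none, sqn, instruction) :: db) tagged tr := by
  have hr : ∀ B m, Event.received id B m ∉ tr := by
    intro B m hm
    have := h.registered id B m hm
    simp [hid] at this
  refine ⟨h.assured, ?_, by simp, by simp, by simp, ?_, ?_, ?_, ?_, ?_, by simp⟩
  · intro id' B m hm
    rw [assoc_cons]
    split
    · rfl
    · exact h.registered id' B m hm
  · rintro _ ⟨⟩ id' v hv
    rw [assoc_cons] at hv
    split at hv
    · next hi =>
      cases hv
      simpa using hi.symm
    · next hi =>
      have := h.key_isSome rfl id' v hv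
      refine ⟨fun hn => ?_, fun hn => absurd hn.symm hi⟩
      simp [hn] at this
  · rintro _ ⟨⟩
    simp [assoc_cons]
  · rintro _ ⟨⟩ id' B m hm
    exact absurd hm (h.not_signalled rfl id' B m)
  · rintro _ ⟨⟩ l hl
    rw [h.tagged_nil rfl] at hl
    cases hl
  · rintro _ ⟨⟩ B m hm
    exact absurd hm (hr B m)

/-- Enrolment of a user whose key is known. -/
theorem Safe.enrolUserAs {user : Option SimUser} (h : Safe user db tagged tr) {id : Str}
    (hid : assoc db id = none) (k : Str) (sqn : ℕ) (instruction : Str) :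
    Safe user ((id, some k, sqn, instruction) :: db) tagged tr := by
  refine { h with registered := ?_, key_isSome := ?_, key_eq_none := ?_, enrolled := ?_ }
  · intro id' B m hm
    rw [assoc_cons]
    split
    · rfl
    · exact h.registered id' B m hm
  · intro hu id' u hv
    rw [assoc_cons] at hv
    split at hv
    · cases hv; rfl
    · exact h.key_isSome hu id' u hv
  · intro u hu id' v hv
    rw [assoc_cons] at hv
    split at hv
    · next hi =>
      cases hv
      have := h.enrolled u hu
      refine ⟨by simp, fun hn => ?_⟩
      have hi' : id = id' := hi
      rw [← hn, ← hi', hid] at this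
      simp at this
    · exact h.key_eq_none u hu id' v hv
  · intro u hu
    rw [assoc_cons]
    split
    · rfl
    · exact h.enrolled u hu

/-- A distress signal of the user. -/
theorem Safe.signal {u : SimUser} (h : Safe (some u) db tagged tr) (B x : Str) :
    Safe (some (u.1, u.2.1 + 1, some (B, u.2.1, x))) db ([u.1, u.2.1.bits] :: tagged)
      (tr ++ [.signalled u.1 B u.2.1]) := by
  refine ⟨h.assured.concat _ (by simp), ?_, by simp, by simp, by simp, ?_, ?_, ?_, ?_, ?_, ?_⟩
  · intro id B' m hm
    exact h.registered id B' m (by simpa using hm)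
  · rintro _ ⟨⟩
    exact h.key_eq_none u rfl
  · rintro _ ⟨⟩
    exact h.enrolled u rfl
  · rintro _ ⟨⟩ id B' m hm
    rcases List.mem_append.1 hm with hm | hm
    · exact Nat.lt_succ_of_lt (h.signalled_lt u rfl id B' m hm)
    · simp only [List.mem_singleton, Event.signalled.injEq] at hm
      simp [hm.2.2]
  · rintro _ ⟨⟩ l hl
    rcases List.mem_cons.1 hl with rfl | hl
    · exact ⟨u.2.1, B, .inl ⟨rfl, by simp⟩⟩
    · obtain ⟨m, B', hm⟩ := h.mem_tagged u rfl l hl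
      exact ⟨m, B', hm.imp (And.imp_right (List.mem_append_left _))
        (And.imp_right (List.mem_append_left _))⟩
  · rintro _ ⟨⟩ B' m hm
    obtain ⟨B'', hB⟩ := h.received u rfl B' m (by simpa using hm)
    exact ⟨B'', List.mem_append_left _ hB⟩
  · rintro _ ⟨⟩ _ ⟨⟩
    refine ⟨tr, [], rfl, by simp, fun B' hB => ?_⟩
    obtain ⟨B'', hB'⟩ := h.received u rfl B' u.2.1 hB
    exact lt_irrefl _ (h.signalled_lt u rfl _ _ _ hB')

/-- The DCP receives a distress and tags the confirmation, if the record holds the key of the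
honest user. -/
theorem Safe.toDCP {user : Option SimUser} (h : Safe user db tagged tr) {id : Str}
    {v : SimRecord} (hid : assoc db id = some v) (B : Str) (m sqn : ℕ) (instruction : Str)
    (hm : v.1 = none → [id, m.bits] ∈ tagged) :
    Safe user ((id, v.1, sqn, instruction) :: db)
      (v.1.elim ([m.bits] :: tagged) fun _ => tagged) (tr ++ [.received id B m]) := by
  have hs : ∀ u, user = some u → id = u.1 → ∃ B', Event.signalled u.1 B' m ∈ tr := by
    rintro u hu rfl
    obtain ⟨m', B', hB | hB⟩ := h.mem_tagged u hu _ (hm ((h.key_eq_none u hu _ v hid).2 rfl))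
    · have h1 : m = m' := bits_injective (by simpa using hB.1)
      exact ⟨B', h1 ▸ hB.2⟩
    · simp at hB
  refine ⟨h.assured.concat _ (by simp), ?_, ?_, ?_, ?_, ?_, ?_, ?_, ?_, ?_, ?_⟩
  · intro id' B' m' hm'
    rw [assoc_cons]
    split
    · rfl
    · next hi =>
      refine h.registered id' B' m' ?_
      simp only [List.mem_append, List.mem_singleton, Event.received.injEq] at hm'
      exact hm'.resolve_right fun hc => hi hc.1.symm
  · intro hu
    have := h.key_isSome hu id v hid
    cases hv : v.1 with
    | none => simp [hv] at this
    | some k => exact h.tagged_nil hu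
  · intro hu id' B' m' hm'
    exact h.not_signalled hu id' B' m' (by simpa using hm')
  · intro hu id' u hv
    rw [assoc_cons] at hv
    split at hv
    · cases hv
      exact h.key_isSome hu id v hid
    · exact h.key_isSome hu id' u hv
  · intro u hu id' v' hv
    rw [assoc_cons] at hv
    split at hv
    · next hi =>
      cases hv
      have hi' : id = id' := hi
      subst hi'
      exact h.key_eq_none u hu id v hid
    · exact h.key_eq_none u hu id' v' hv
  · intro u hu
    rw [assoc_cons]
    split
    · rfl
    · exact h.enrolled u hu
  · intro u hu id' B' m' hm'
    exact h.signalled_lt u hu id' B' m' (by simpa using hm')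
  · intro u hu l hl
    have old : l ∈ tagged → ∃ m' B', (l = [u.1, m'.bits] ∧
        Event.signalled u.1 B' m' ∈ tr ++ [.received id B m]) ∨
        (l = [m'.bits] ∧ Event.received u.1 B' m' ∈ tr ++ [.received id B m]) := by
      intro hl
      obtain ⟨m', B', hm'⟩ := h.mem_tagged u hu l hl
      exact ⟨m', B', hm'.imp (And.imp_right (List.mem_append_left _))
        (And.imp_right (List.mem_append_left _))⟩
    cases hv : v.1 with
    | some k =>
      rw [hv] at hl
      exact old hl
    | none =>
      rw [hv] at hl
      rcases List.mem_cons.1 hl with rfl | hl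
      · refine ⟨m, B, .inr ⟨rfl, ?_⟩⟩
        rw [(h.key_eq_none u hu id v hid).1 hv]
        simp
      · exact old hl
  · intro u hu B' m' hm'
    rcases List.mem_append.1 hm' with hm' | hm'
    · obtain ⟨B'', hB⟩ := h.received u hu B' m' hm'
      exact ⟨B'', List.mem_append_left _ hB⟩
    · simp only [List.mem_singleton, Event.received.injEq] at hm'
      obtain ⟨B'', hB⟩ := hs u hu hm'.1.symm
      exact ⟨B'', List.mem_append_left _ (hm'.2.2 ▸ hB)⟩
  · intro u hu w hw
    obtain ⟨past, recent, h1, h2, h3⟩ := h.session u hu w hw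
    refine ⟨past, recent ++ [.received id B m], by simp [h1], ?_, h3⟩
    intro id' B' m' hm'
    exact h2 id' B' m' (by simpa using hm')

/-- The user accepts a confirmation that was tagged with its key. -/
theorem Safe.complete {u : SimUser} (h : Safe (some u) db tagged tr) {v : Str × ℕ × Str}
    (hv : u.2.2 = some v) (hm : [v.2.1.bits] ∈ tagged) :
    Safe (some (u.1, u.2.1, none)) db tagged (tr ++ [.completed u.1 v.1 v.2.1]) := by
  refine ⟨h.assured.concat _ ?_, ?_, by simp, by simp, by simp, ?_, ?_, ?_, ?_, ?_, ?_⟩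
  · intro id B m heq
    simp only [Event.completed.injEq] at heq
    obtain ⟨rfl, rfl, rfl⟩ := heq
    obtain ⟨past, recent, h1, h2, h3⟩ := h.session u rfl v hv
    refine ⟨past, recent, h1, ?_, h2⟩
    obtain ⟨m', B', hB | hB⟩ := h.mem_tagged u rfl _ hm
    · simp at hB
    · have h4 : v.2.1 = m' := bits_injective (by simpa using hB.1)
      have h5 := hB.2
      rw [← h4, h1] at h5
      simp only [List.mem_append, List.mem_cons, reduceCtorEq, false_or] at h5
      exact ⟨B', h5.resolve_left (h3 B')⟩
  · intro id B' m hm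
    exact h.registered id B' m (by simpa using hm)
  · rintro _ ⟨⟩
    exact h.key_eq_none u rfl
  · rintro _ ⟨⟩
    exact h.enrolled u rfl
  · rintro _ ⟨⟩ id B' m hm
    exact h.signalled_lt u rfl id B' m (by simpa using hm)
  · rintro _ ⟨⟩ l hl
    obtain ⟨m, B', hm⟩ := h.mem_tagged u rfl l hl
    exact ⟨m, B', hm.imp (And.imp_right (List.mem_append_left _))
      (And.imp_right (List.mem_append_left _))⟩
  · rintro _ ⟨⟩ B' m hm
    obtain ⟨B'', hB⟩ := h.received u rfl B' m (by simpa using hm)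
    exact ⟨B'', List.mem_append_left _ hB⟩
  · rintro _ ⟨⟩ _ ⟨⟩

end

/-! ### Simulated steps that use the oracles -/

namespace Scheme
open Sim

variable (P : Scheme) (κ : Kind)

/-- There has been a forgery, or the run has been safe so far. -/
def Good (st : Sim) (s : MACState) (tr : List Event) : Prop :=
  s.forged ∨ Safe st.user st.userDB s.tagged tr

section

variable {P} {n : ℕ} {un : List Unit}

theorem tagWith_fst (hn : un.length = n) (k : Option Str) (m : List Str) (s : MACState) :
    (P.tagWith n un k m s).1 = P.mac.tag n (k.getD s.key) m := by
  subst hn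
  cases k <;> rfl

theorem vrfyWith_fst (hn : un.length = n) (k : Option Str) (m : List Str) (t : Str)
    (s : MACState) :
    (P.vrfyWith n un k m t s).1 = P.mac.vrfy n (k.getD s.key) m t := by
  subst hn
  cases k <;> rfl

end

section

variable {P} (n : ℕ) (un : List Unit) (k : Option Str) (m : List Str) (t : Str) (s : MACState)

theorem tagWith_key : (P.tagWith n un k m s).2.key = s.key := by
  cases k <;> rfl

theorem tagWith_forged : (P.tagWith n un k m s).2.forged = s.forged := by
  cases k <;> rfl

theorem tagWith_tagged :
    (P.tagWith n un k m s).2.tagged = k.elim (m :: s.tagged) fun _ => s.tagged := by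
  cases k <;> rfl

theorem vrfyWith_key : (P.vrfyWith n un k m t s).2.key = s.key := by
  cases k <;> rfl

theorem vrfyWith_tagged : (P.vrfyWith n un k m t s).2.tagged = s.tagged := by
  cases k <;> rfl

theorem vrfyWith_forged (h : s.forged) : (P.vrfyWith n un k m t s).2.forged := by
  cases k with
  | none => exact Or.inl h
  | some k => exact h

/-- A valid tag that does not come from the oracle is a forgery. -/
theorem vrfyWith_none (h : (P.vrfyWith n un none m t s).1 = true) :
    (P.vrfyWith n un none m t s).2.forged ∨ m ∈ s.tagged := by
  by_cases hm : m ∈ s.tagged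
  · exact .inr hm
  · exact .inl (.inr ⟨h, hm⟩)

end

/-- The search finds the same number as the DCP does with the key. If the key is that of the oracle,
then a tag that is accepted is a forgery unless it was made by the oracle. -/
theorem findSqn_spec {n : ℕ} {un : List Unit} (hn : un.length = n) (k : Option Str) (id : Str)
    (m : ℕ) (tag : Str) (j : ℕ) (s : MACState) :
    (P.findSqn n un k id m tag j s).1 = ((List.range j).find? fun i =>
      P.mac.vrfy n (k.getD s.key) [id, (m + i).bits] tag).map (m + ·) ∧
    (P.findSqn n un k id m tag j s).2.key = s.key ∧
    (P.findSqn n un k id m tag j s).2.tagged = s.tagged ∧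
    (s.forged → (P.findSqn n un k id m tag j s).2.forged) ∧
    ∀ i, (P.findSqn n un k id m tag j s).1 = some i → k = none →
      (P.findSqn n un k id m tag j s).2.forged ∨ [id, i.bits] ∈ s.tagged := by
  induction j with
  | zero => simp [findSqn]
  | succ j ih =>
    obtain ⟨h1, h2, h3, h4, h5⟩ := ih
    rw [List.range_succ, List.find?_append, findSqn]
    cases hy : (P.findSqn n un k id m tag j s).1 with
    | some i =>
      rw [hy] at h1 h5
      obtain ⟨i', hi, rfl⟩ := Option.map_eq_some_iff.1 h1.symm
      simp only [Option.elim_some, hi, Option.some_or, Option.map_some]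
      exact ⟨trivial, h2, h3, h4, h5⟩
    | none =>
      rw [hy] at h1
      simp only [Option.elim_none, Option.map_eq_none_iff.1 h1.symm, Option.none_or,
        vrfyWith_key, vrfyWith_tagged, h2, h3]
      have h6 := vrfyWith_fst (P := P) hn k [id, (m + j).bits] tag
        (P.findSqn n un k id m tag j s).2
      rw [h2] at h6
      refine ⟨?_, trivial, trivial, fun h => vrfyWith_forged _ _ _ _ _ _ (h4 h), ?_⟩
      · rw [h6, List.find?_singleton]
        cases P.mac.vrfy n (k.getD s.key) [id, (m + j).bits] tag <;> rfl
      · rintro i hi rfl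
        have h7 := vrfyWith_none (P := P) n un [id, (m + j).bits] tag
          (P.findSqn n un none id m tag j s).2
        rw [h3] at h7
        cases hv : (P.vrfyWith n un none [id, (m + j).bits] tag
            (P.findSqn n un none id m tag j s).2).1 with
        | false =>
          rw [hv] at hi
          cases hi
        | true =>
          rw [hv] at hi
          cases hi
          exact h7 hv

/-- The simulated step `q` matches the step `f` of the protocol: it has the same outcome, and it
preserves that the run is safe unless there has been a forgery. -/
def Matches (a c : Str) {β : Type} (tr : List Event) (st : Sim) (s : MACState)
    (f : State → Option (β × State)) (q : Option (β × Sim) × MACState) : Prop :=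
  q.2.key = s.key ∧ ∃ tr',
    f (toState P s.key a c tr st) = q.1.map (fun y => (y.1, toState P s.key a c tr' y.2)) ∧
    (Good st s tr → q.1.elim (Good st q.2 tr) fun y => Good y.2 q.2 tr')

variable {P} {a c : Str} {tr : List Event} {st : Sim} {s : MACState}

/-- Steps that do not use the oracles leave the sequence of events alone. -/
theorem Matches.of_eq {β : Type} {f : State → Option (β × State)} {o : Option (β × Sim)}
    (h : f (toState P s.key a c tr st) = o.map fun y => (y.1, toState P s.key a c tr y.2))
    (hg : ∀ y, o = some y → Good st s tr → Good y.2 s tr) : P.Matches a c tr st s f (o, s) := by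
  refine ⟨rfl, tr, h, fun hst => ?_⟩
  cases o with
  | none => exact hst
  | some y => exact hg y rfl hst

variable (P)

theorem matches_signal {n : ℕ} (hn : st.un.length = n) (r : StepCoins) (B : Str) :
    P.Matches a c tr st s (P.signal n (coin r) B) (P.simSignal r n B st s) := by
  unfold simSignal
  cases hu : st.user with
  | none =>
    refine ⟨rfl, tr, ?_, fun h => h⟩
    simp [signal, toState, hu]
  | some u =>
    have h1 : (toState P s.key a c tr st).user =
      some ⟨u.1, s.key, u.2.1, st.pks, u.2.2.map fun v => ⟨v.1, v.2.1, v.2.2⟩⟩ := by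
      simp [toState, hu]
    cases hp : assoc st.pks B with
    | none =>
      refine ⟨rfl, tr, ?_, fun h => h⟩
      simp [signal, h1, lookup_eq_assoc, hp]
    | some pk =>
      refine ⟨tagWith_key _ _ _ _ _, tr ++ [.signalled u.1 B u.2.1], ?_, ?_⟩
      · subst hn
        simp only [signal, h1, Option.bind_eq_bind, Option.bind_some, lookup_eq_assoc, hp,
          Option.map_some, Option.elim_some, tagWith_fst rfl, Option.getD_none]
        rfl
      · rintro (h | h)
        · exact .inl h
        · rw [hu] at h
          exact .inr (h.signal B _)

theorem matches_toDCP {n : ℕ} (hn : st.un.length = n) (r : StepCoins) (B e nonceB t : Str) :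
    P.Matches a c tr st s (P.toDCP n (coin r) B e nonceB t)
      (P.simToDCP r n B e nonceB t st s) := by
  subst hn
  have h1 : P.toDCP st.un.length (coin r) B e nonceB t (toState P s.key a c tr st) =
      (P.authentic B e nonceB t st).bind fun y =>
        ((List.range (P.nMax + 1)).find? fun i => P.mac.vrfy st.un.length
          (y.2.2.1.getD s.key) [y.2.1.1, (y.2.2.2.1 + i).bits] y.2.1.2).map fun i =>
            let m := y.2.2.2.1 + i
            let c' := P.sym.enc st.un.length y.1.2.1 r.1 [y.2.2.2.2]
            let tag := P.mac.tag st.un.length (y.2.2.1.getD s.key) [m.bits]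
            let nonceC := P.nonce st.un.length r.2.1
            ((c', tag, nonceC, P.mac.tag st.un.length y.1.2.2 [c', tag, nonceB, nonceC]),
              toState P s.key a c (tr ++ [.received y.2.1.1 B m])
                (st.addRecord (y.2.1.1, y.2.2.1, m + 1, y.2.2.2.2))) := by
    have e1 : (toState P s.key a c tr st).serverDB B =
      (assoc st.serverDB B).map fun e => ⟨e.1, e.2.1, e.2.2⟩ := rfl
    have e2 : ∀ id, (toState P s.key a c tr st).userDB id =
      (assoc st.userDB id).map fun u => ⟨u.1.getD s.key, u.2.1, u.2.2⟩ := fun _ => rfl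
    unfold toDCP authentic
    rw [e1]
    cases assoc st.serverDB B with
    | none => rfl
    | some w =>
      simp only [Option.map_some, Option.bind_eq_bind, Option.bind_some]
      cases P.mac.vrfy st.un.length w.2.2 [B, e, nonceB] t with
      | false => rfl
      | true =>
        simp only [guard, if_true, cond_true, Option.pure_def, Option.bind_some]
        cases P.sym.dec st.un.length w.2.1 e with
        | none => rfl
        | some l =>
          match l with
          | [] => rfl
          | [_] => rfl
          | _ :: _ :: _ :: _ => rfl
          | [id, tag] =>
            simp only [Option.bind_some, pairOfList, e2]
            cases assoc st.userDB id with
            | none => rfl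
            | some u =>
              simp only [Option.map_some, Option.bind_some]
              cases List.find? (fun i => P.mac.vrfy st.un.length (u.1.getD s.key)
                [id, (u.2.1 + i).bits] tag) (List.range (P.nMax + 1)) with
              | none => rfl
              | some i =>
                simp only [Option.map_some, Option.bind_some, toState_addRecord]
                rfl
  unfold simToDCP
  cases hy : P.authentic B e nonceB t st with
  | none =>
    refine ⟨rfl, tr, ?_, fun h => h⟩
    rw [h1, hy]
    rfl
  | some y =>
    obtain ⟨w, ⟨id, tag⟩, v⟩ := y
    rw [hy] at h1
    have hid : assoc st.userDB id = some v := by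
      unfold authentic at hy
      obtain ⟨w', _, hy⟩ := Option.bind_eq_some_iff.1 hy
      rw [Bool.cond_eq_ite] at hy
      split at hy
      · obtain ⟨l, _, hy⟩ := Option.bind_eq_some_iff.1 hy
        obtain ⟨x, _, hy⟩ := Option.bind_eq_some_iff.1 hy
        obtain ⟨v', hv, hy⟩ := Option.map_eq_some_iff.1 hy
        cases hy
        exact hv
      · cases hy
    obtain ⟨f1, f2, f3, f4, f5⟩ := P.findSqn_spec (n := st.un.length) rfl v.1 id v.2.1 tag
      (P.nMax + 1) s
    simp only [Option.elim_some]
    simp only [Option.bind_some] at h1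
    cases hf : List.find? (fun i => P.mac.vrfy st.un.length (v.1.getD s.key)
        [id, (v.2.1 + i).bits] tag) (List.range (P.nMax + 1)) with
    | none =>
      rw [hf] at f1 h1
      simp only [Option.map_none] at f1
      rw [f1]
      refine ⟨f2, tr, h1, fun h => h.imp f4 fun h => ?_⟩
      rw [Option.elim_none, f3]
      exact h
    | some i =>
      rw [hf] at f1 h1
      simp only [Option.map_some] at f1 h1
      rw [f1] at f5 ⊢
      simp only [Option.elim_some]
      refine ⟨(tagWith_key _ _ _ _ _).trans f2, tr ++ [.received id B (v.2.1 + i)], ?_, ?_⟩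
      · rw [h1]
        simp only [tagWith_fst rfl, f2, Option.map_some]
      · intro h
        simp only [Option.elim_some, Good, tagWith_forged, tagWith_tagged, f3]
        rcases h with h | h
        · exact .inl (f4 h)
        · by_cases hfo : (P.findSqn st.un.length st.un v.1 id v.2.1 tag (P.nMax + 1) s).2.forged
          · exact .inl hfo
          · exact .inr (h.toDCP hid B (v.2.1 + i) (v.2.1 + i + 1) v.2.2
              fun hv => (f5 _ rfl hv).resolve_left hfo)

/-- The verification of a confirmation by the user. -/
theorem userCheck_toState {n : ℕ} (hn : st.un.length = n) (t : Str) :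
    (P.simCheck n t st s).2.key = s.key ∧ ∃ tr',
      P.userCheck n t (toState P s.key a c tr st) =
        toState P s.key a c tr' (P.simCheck n t st s).1 ∧
      (Good st s tr → Good (P.simCheck n t st s).1 (P.simCheck n t st s).2 tr') := by
  have h1 : (toState P s.key a c tr st).user = st.user.map fun u =>
    ⟨u.1, s.key, u.2.1, st.pks, u.2.2.map fun v => ⟨v.1, v.2.1, v.2.2⟩⟩ := rfl
  unfold simCheck userCheck
  rw [h1]
  cases hu : st.user with
  | none => exact ⟨rfl, tr, rfl, fun h => h⟩
  | some u =>
    cases hv : u.2.2 with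
    | none =>
      simp only [hv, Option.map_some, Option.map_none, Option.bind_some, Option.elim_none]
      exact ⟨trivial, tr, rfl, fun h => h⟩
    | some v =>
      simp only [hv, Option.map_some, Option.bind_some, Option.elim_some, vrfyWith_fst hn,
        Option.getD_none]
      refine ⟨vrfyWith_key _ _ _ _ _ _, ?_⟩
      cases hm : P.mac.vrfy n s.key [v.2.1.bits] t with
      | false =>
        refine ⟨tr, rfl, fun h => h.imp (vrfyWith_forged _ _ _ _ _ _) fun h => ?_⟩
        rw [vrfyWith_tagged]
        exact h
      | true =>
        refine ⟨tr ++ [.completed u.1 v.1 v.2.1], rfl, ?_⟩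
        rintro (h | h)
        · exact .inl (vrfyWith_forged _ _ _ _ _ _ h)
        · refine (vrfyWith_none (P := P) n st.un _ t s hm).imp_right fun h' => ?_
          rw [vrfyWith_tagged]
          rw [hu] at h
          exact h.complete hv h'

theorem matches_page {n : ℕ} (hn : st.un.length = n) (B nonceB : Str) :
    P.Matches a c tr st s (P.page κ n B nonceB) (P.simPage κ n B nonceB st s) := by
  have h1 : P.page κ n B nonceB (toState P s.key a c tr st) =
      (pageContent B nonceB st).map fun y => if y.2 then
        (if κ = .loc then some y.1 else none, P.userCheck n y.1 (toState P s.key a c tr st))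
        else (some y.1, toState P s.key a c tr st) := by
    have e1 : (toState P s.key a c tr st).tls (B, nonceB) = (assoc st.tls (B, nonceB)).map
      fun v => ⟨v.1, v.2.1, v.2.2⟩ := rfl
    have e2 : (toState P s.key a c tr st).user = st.user.map fun u =>
      ⟨u.1, s.key, u.2.1, st.pks, u.2.2.map fun v => ⟨v.1, v.2.1, v.2.2⟩⟩ := rfl
    unfold page pageContent
    rw [e1, e2]
    rcases assoc st.tls (B, nonceB) with _ | ⟨b, x, _ | y⟩
    · rfl
    · rfl
    · cases b with
      | false => rfl
      | true =>
        rcases st.user with _ | ⟨id, sqn, _ | w⟩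
        · rfl
        · rfl
        · simp only [Option.map_some, Option.bind_some, Option.bind_eq_bind, guard, cond_true,
            if_true]
          by_cases h1 : w.1 = B <;> by_cases h2 : w.2.2 = x <;> simp [h1, h2]
  unfold simPage
  rcases hp : pageContent B nonceB st with _ | ⟨y, _ | _⟩
  · rw [hp] at h1
    exact ⟨rfl, tr, h1, fun h => h⟩
  · rw [hp] at h1
    exact ⟨rfl, tr, h1, fun h => h⟩
  · rw [hp] at h1
    obtain ⟨h2, tr', h3, h4⟩ := P.userCheck_toState (a := a) (c := c) (tr := tr) (s := s) hn y
    refine ⟨h2, tr', h1.trans ?_, h4⟩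
    simp only [Option.map_some, if_true, h3, Option.elim_some, cond_true, Bool.cond_decide]

theorem matches_inject {n : ℕ} (hn : st.un.length = n) (t : Str) :
    P.Matches a c tr st s (P.inject κ n t) (P.simInject κ n t st s) := by
  have h1 : P.inject κ n t (toState P s.key a c tr st) =
      (canInject κ st).map fun _ => ((), P.userCheck n t (toState P s.key a c tr st)) := by
    have e1 : ∀ B, (toState P s.key a c tr st).corrupt B = (assoc st.corrupt B).isSome :=
      fun _ => rfl
    have e2 : (toState P s.key a c tr st).user = st.user.map fun u =>
      ⟨u.1, s.key, u.2.1, st.pks, u.2.2.map fun v => ⟨v.1, v.2.1, v.2.2⟩⟩ := rfl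
    unfold inject canInject
    rw [e2]
    rcases st.user with _ | ⟨id, sqn, _ | w⟩
    · rfl
    · rfl
    · simp only [Option.map_some, Option.bind_some, Option.bind_eq_bind, guard, e1]
      by_cases h1 : κ = .loc <;> by_cases h2 : κ = .web <;>
        cases (assoc st.corrupt w.1).isSome <;> simp [h1, h2]
  unfold simInject
  cases hp : canInject κ st with
  | none =>
    rw [hp] at h1
    exact ⟨rfl, tr, h1, fun h => h⟩
  | some y =>
    rw [hp] at h1
    obtain ⟨h2, tr', h3, h4⟩ := P.userCheck_toState (a := a) (c := c) (tr := tr) (s := s) hn t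
    refine ⟨h2, tr', h1.trans ?_, h4⟩
    simp only [Option.map_some, h3, Option.elim_some]

end Scheme

/-! ### Simulated calls -/

namespace Scheme
open Sim

variable {P : Scheme} {κ : Kind} {r : StepCoins} {st : Sim}

theorem simRegisterHonest_eq_some {B : Str} {y : (Str × Str) × Sim}
    (h : P.simRegisterHonest r B st = some y) :
    y.2 = st.addHonest (B, (P.sig.gen st.un.length r.1).1, (P.sig.gen st.un.length r.1).2,
      P.sig.sign st.un.length st.caSk r.2.1 [B, (P.sig.gen st.un.length r.1).1], none) := by
  unfold simRegisterHonest at h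
  rw [Bool.cond_eq_ite] at h
  split at h
  · cases h
  · cases h
    rfl

theorem simRegisterCorrupt_eq_some {B pk : Str} {y : Str × Sim}
    (h : P.simRegisterCorrupt κ r B pk st = some y) : y.2 = st.addCorrupt B := by
  unfold simRegisterCorrupt at h
  rw [Bool.cond_eq_ite] at h
  split at h
  · cases h
  · cases h
    rfl

theorem simDcpEnrolServer_eq_some {c gb B certPk cert pk' s : Str} {y : Str × Sim}
    (h : P.simDcpEnrolServer c gb B certPk cert pk' s st = some y) :
    ∃ z, P.serverSecrets st.un c gb = some z ∧ y = (z.1, st.addServer (B, pk', z.2)) := by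
  unfold simDcpEnrolServer at h
  rw [Bool.cond_eq_ite] at h
  split at h
  · obtain ⟨z, hz, rfl⟩ := Option.map_eq_some_iff.1 h
    exact ⟨z, hz, rfl⟩
  · cases h

theorem simEnrolServer_eq_some {B : Str} {y : Str × Sim}
    (h : P.simEnrolServer r B st = some y) :
    ∃ w gb z v, assoc st.honest B = some w ∧
      P.dh.pow st.un.length (P.dh.base st.un.length) r.2.1 = some gb ∧
      P.serverSecrets st.un r.2.2.2 gb = some z ∧ P.webSecrets r st.un z.1 = some v ∧
      y.2 = (st.addServer (B, (P.pke.gen st.un.length r.1).1, z.2)).addHonest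
        (B, w.1, w.2.1, w.2.2.1, some v) := by
  obtain ⟨w, hw, h⟩ := Option.bind_eq_some_iff.1 h
  obtain ⟨gb, hgb, h⟩ := Option.bind_eq_some_iff.1 h
  obtain ⟨y', hy, h⟩ := Option.bind_eq_some_iff.1 h
  obtain ⟨z, hz, rfl⟩ := simDcpEnrolServer_eq_some hy
  obtain ⟨v, hv, rfl⟩ := Option.map_eq_some_iff.1 h
  exact ⟨w, gb, z, v, hw, hgb, hz, hv, rfl⟩

theorem simEnrolUser_eq_some {sites : List Str} {instr : Str} {y : Unit × Sim}
    (h : P.simEnrolUser r sites instr st = some y) :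
    st.user = none ∧ assoc st.userDB (r.2.1.take (P.mi st.un.length)) = none ∧
      y.2 = ((st.addRecord (r.2.1.take (P.mi st.un.length), none, toNat r.1, instr)).setPks
        (simPublicKeys sites st)).setUser (r.2.1.take (P.mi st.un.length), toNat r.1, none) := by
  unfold simEnrolUser at h
  rw [Bool.cond_eq_ite] at h
  split at h
  · next hc =>
    cases h
    simpa using hc
  · cases h

theorem simEnrolUserAs_eq_some {ga : Str} {sqn : ℕ} {instr : Str} {sites : List Str}
    {y : (Str × List (Str × Str) × Str) × Sim}
    (h : P.simEnrolUserAs r ga sqn instr sites st = some y) :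
    ∃ z, P.serverSecrets st.un r.2.1 ga = some z ∧
      assoc st.userDB (r.1.take (P.mi st.un.length)) = none ∧
      y.2 = st.addRecord (r.1.take (P.mi st.un.length), some z.2.2, sqn, instr) := by
  unfold simEnrolUserAs at h
  rw [Bool.cond_eq_ite] at h
  split at h
  · next hc =>
    obtain ⟨z, hz, rfl⟩ := Option.map_eq_some_iff.1 h
    exact ⟨z, hz, by simpa using hc, rfl⟩
  · cases h

theorem simSignal_eq_some {n : ℕ} {B : Str} {s : MACState} {y : Str × Sim}
    (h : (P.simSignal r n B st s).1 = some y) :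
    ∃ u, st.user = some u ∧ y.2 = st.setUser (u.1, u.2.1 + 1, some (B, u.2.1, y.1)) := by
  unfold simSignal at h
  cases hu : st.user with
  | none => simp [hu] at h
  | some u =>
    cases hp : assoc st.pks B with
    | none => simp [hu, hp] at h
    | some pk =>
      simp only [hu, hp, Option.bind_some, Option.map_some, Option.elim_some,
        Option.some.injEq] at h
      subst h
      exact ⟨u, rfl, rfl⟩

theorem simServerHello_eq_some {b : Bool} {B x : Str} {y : (Str × Str × Str × Str) × Sim}
    (h : P.simServerHello r b B x st = some y) :
    y.1.1 = B ∧ y.2 = st.addTLS ((B, y.1.2.2.1), b, x, none) := by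
  obtain ⟨w, _, h⟩ := Option.bind_eq_some_iff.1 h
  obtain ⟨k, _, h⟩ := Option.bind_eq_some_iff.1 h
  obtain ⟨z, _, rfl⟩ := Option.map_eq_some_iff.1 h
  exact ⟨rfl, rfl⟩

theorem simHello_eq_some {y : (Str × Str × Str × Str) × Sim} (h : P.simHello r st = some y) :
    ∃ u v, st.user = some u ∧ u.2.2 = some v ∧
      y.2 = st.addTLS ((y.1.1, y.1.2.2.1), true, v.2.2, none) := by
  obtain ⟨u, hu, h⟩ := Option.bind_eq_some_iff.1 h
  obtain ⟨v, hv, h⟩ := Option.bind_eq_some_iff.1 h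
  obtain ⟨h1, h2⟩ := simServerHello_eq_some h
  exact ⟨u, v, hu, hv, h1 ▸ h2⟩

theorem findSqn_le {n : ℕ} {un : List Unit} {k : Option Str} {id tag : Str} {m i : ℕ} (j : ℕ)
    {s : MACState} (h : (P.findSqn n un k id m tag (j + 1) s).1 = some i) : i ≤ m + j := by
  induction j with
  | zero =>
    simp only [findSqn, Option.elim_none, Bool.cond_eq_ite] at h
    split at h
    · cases h
      exact le_rfl
    · cases h
  | succ j ih =>
    rw [findSqn] at h
    cases hy : (P.findSqn n un k id m tag (j + 1) s).1 with
    | some i' =>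
      simp only [hy, Option.elim_some, Option.some.injEq] at h
      subst h
      exact (ih hy).trans (by omega)
    | none =>
      simp only [hy, Option.elim_none, Bool.cond_eq_ite] at h
      split at h
      · cases h
        exact le_rfl
      · cases h

theorem authentic_eq_some {B c nonceB t : Str} {y : (Str × Str × Str) × (Str × Str) × SimRecord}
    (h : P.authentic B c nonceB t st = some y) : assoc st.userDB y.2.1.1 = some y.2.2 := by
  obtain ⟨w, _, h⟩ := Option.bind_eq_some_iff.1 h
  rw [Bool.cond_eq_ite] at h
  split at h
  · obtain ⟨l, _, h⟩ := Option.bind_eq_some_iff.1 h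
    obtain ⟨x, _, h⟩ := Option.bind_eq_some_iff.1 h
    obtain ⟨v, hv, rfl⟩ := Option.map_eq_some_iff.1 h
    exact hv
  · cases h

theorem simToDCP_eq_some {n : ℕ} {B c nonceB t : Str} {s : MACState}
    {y : (Str × Str × Str × Str) × Sim} (h : (P.simToDCP r n B c nonceB t st s).1 = some y) :
    ∃ id v m, assoc st.userDB id = some v ∧ m ≤ v.2.1 + P.nMax ∧
      y.2 = st.addRecord (id, v.1, m + 1, v.2.2) := by
  unfold simToDCP at h
  cases hy : P.authentic B c nonceB t st with
  | none => simp [hy] at h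
  | some z =>
    simp only [hy, Option.elim_some] at h
    cases hf : (P.findSqn n st.un z.2.2.1 z.2.1.1 z.2.2.2.1 z.2.1.2 (P.nMax + 1) s).1 with
    | none => simp [hf] at h
    | some m =>
      simp only [hf, Option.elim_some, Option.some.injEq] at h
      subst h
      exact ⟨_, _, m, authentic_eq_some hy, findSqn_le _ hf, rfl⟩

theorem simToServer_eq_some {B nonceB c s nonceC t : Str} {y : Unit × Sim}
    (h : P.simToServer B nonceB c s nonceC t st = some y) :
    ∃ v, assoc st.tls (B, nonceB) = some v ∧
      y.2 = st.addTLS ((B, nonceB), v.1, v.2.1, some s) := by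
  obtain ⟨w, _, h⟩ := Option.bind_eq_some_iff.1 h
  obtain ⟨k, _, h⟩ := Option.bind_eq_some_iff.1 h
  obtain ⟨v, hv, h⟩ := Option.bind_eq_some_iff.1 h
  rw [Bool.cond_eq_ite] at h
  split at h
  · obtain ⟨_, _, rfl⟩ := Option.map_eq_some_iff.1 h
    exact ⟨v, hv, rfl⟩
  · cases h

theorem simCheck_fst (n : ℕ) (t : Str) (s : MACState) :
    (P.simCheck n t st s).1 = st ∨
      ∃ u, st.user = some u ∧ (P.simCheck n t st s).1 = st.setUser (u.1, u.2.1, none) := by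
  unfold simCheck
  cases hu : st.user with
  | none => exact .inl rfl
  | some u =>
    cases hv : u.2.2 with
    | none => simp [hv]
    | some v =>
      simp only [hv, Option.bind_some, Option.map_some, Option.elim_some, Bool.cond_eq_ite]
      split
      · exact .inr ⟨u, rfl, rfl⟩
      · exact .inl rfl

theorem simPage_eq_some {n : ℕ} {B nonceB : Str} {s : MACState} {y : Option Str × Sim}
    (h : (P.simPage κ n B nonceB st s).1 = some y) :
    y.2 = st ∨ ∃ t, y.2 = (P.simCheck n t st s).1 := by
  unfold simPage at h
  rcases hp : pageContent B nonceB st with _ | ⟨t, _ | _⟩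
  · simp [hp] at h
  · simp only [hp, Option.elim_some, cond_false, Option.some.injEq] at h
    subst h
    exact .inl rfl
  · simp only [hp, Option.elim_some, cond_true, Option.some.injEq] at h
    subst h
    exact .inr ⟨t, rfl⟩

theorem simInject_eq_some {n : ℕ} {t : Str} {s : MACState} {y : Unit × Sim}
    (h : (P.simInject κ n t st s).1 = some y) : y.2 = (P.simCheck n t st s).1 := by
  unfold simInject at h
  cases hp : canInject κ st with
  | none => simp [hp] at h
  | some u =>
    simp only [hp, Option.elim_some, Option.some.injEq] at h
    subst h
    rfl

section

variable (P) (κ) {a c : Str} {tr : List Event} {s : MACState}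

theorem Good.of_eq {st st' : Sim} (h : Good st s tr) (h1 : st'.user = st.user)
    (h2 : st'.userDB = st.userDB) : Good st' s tr := by
  unfold Good
  rw [h1, h2]
  exact h

/-- A simulated call, which uses up its coins. -/
theorem Matches.perform {α β : Type} {f : (Fin 4 → Str) → State → Option (β × State)}
    {g : ℕ → StepCoins × α × Sim → MACState → Option (β × Sim) × MACState} {n : ℕ} {x : α}
    {st : Sim} (h : P.Matches a c tr (st.next P) s (f (coin (st.coins P)))
      (g n (st.coins P, x, st.next P) s)) :
    (simPerform P g n (x, st) s).2.key = s.key ∧ ∃ tr',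
      perform f (toState P s.key a c tr st) =
        ((simPerform P g n (x, st) s).1.1,
          toState P s.key a c tr' (simPerform P g n (x, st) s).1.2) ∧
      (Good st s tr →
        Good (simPerform P g n (x, st) s).1.2 (simPerform P g n (x, st) s).2 tr') := by
  obtain ⟨h1, tr', h2, h3⟩ := h
  unfold Distress.perform simPerform
  simp only [← toState_next, toState_tape_zero, h2]
  cases hq : (g n (st.coins P, x, st.next P) s).1 with
  | none =>
    rw [hq] at h3
    exact ⟨h1, tr, rfl, h3⟩
  | some y =>
    rw [hq] at h3
    exact ⟨h1, tr', rfl, h3⟩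

/-- The simulation of the answers to calls is perfect, and a run stays safe without a forgery. -/
theorem simHandle_spec {n : ℕ} {ω : Coins P.ℓ n × Coins P.ℓ n} (hs : s.key = P.dhMacKey n ω)
    {st : Sim} (hn : st.un.length = n) (i : Call) (x : (protocolInterface.dom i).den) :
    (P.simHandle κ n i (x, st) s).2.key = s.key ∧ ∃ tr',
      (P.attack κ).handle n i x (toState P s.key (List.ofFn ω.1) (List.ofFn ω.2) tr st) =
        ((P.simHandle κ n i (x, st) s).1.1, toState P s.key (List.ofFn ω.1) (List.ofFn ω.2) tr'
          (P.simHandle κ n i (x, st) s).1.2) ∧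
      (Good st s tr → Good (P.simHandle κ n i (x, st) s).1.2 (P.simHandle κ n i (x, st) s).2
        tr') := by
  have hn' : (st.next P).un.length = n := hn
  subst hn
  cases i with
  | caPublicKey =>
    refine Matches.perform P (f := fun _ σ => some (σ.caPk, σ)) (.of_eq rfl ?_)
    rintro _ ⟨⟩ h
    exact h
  | registerHonest =>
    refine Matches.perform P (f := fun r => P.registerHonest st.un.length r x)
      (.of_eq (P.registerHonest_toState (st.next P) _ _) fun y hy h => ?_)
    rw [simRegisterHonest_eq_some hy]
    exact h.of_eq rfl rfl
  | registerCorrupt =>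
    refine Matches.perform P (f := fun r => P.registerCorrupt κ st.un.length r _ _)
      (.of_eq (P.registerCorrupt_toState κ (st.next P) _ _ _) fun y hy h => ?_)
    rw [simRegisterCorrupt_eq_some hy]
    exact h.of_eq rfl rfl
  | enrolServer =>
    refine Matches.perform P (f := fun r => P.enrolServer st.un.length r x)
      (.of_eq (P.enrolServer_toState (st.next P) _ _) fun y hy h => ?_)
    obtain ⟨w, gb, z, v, -, -, -, -, e⟩ := simEnrolServer_eq_some hy
    rw [e]
    exact h.of_eq rfl rfl
  | enrolServerAs =>
    refine Matches.perform P (f := fun r => P.enrolServerAs st.un.length r _ _ _ _ _ _)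
      (.of_eq (P.dcpEnrolServer_toState (st.next P) _ _ _ _ _ _ _) fun y hy h => ?_)
    obtain ⟨z, -, e⟩ := simDcpEnrolServer_eq_some hy
    rw [e]
    exact h.of_eq rfl rfl
  | enrolUser =>
    refine Matches.perform P (f := fun r => P.enrolUser st.un.length r _ _) (.of_eq ?_ ?_)
    · rw [hs]
      exact P.enrolUser_toState (st.next P) _ rfl _ _
    · intro y hy h
      obtain ⟨h1, h2, e⟩ := simEnrolUser_eq_some hy
      rw [e]
      refine h.imp_right fun h => ?_
      rw [h1] at h
      exact h.enrolUser h2 _ _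
  | enrolUserAs =>
    refine Matches.perform P (f := fun r => P.enrolUserAs st.un.length r _ _ _ _)
      (.of_eq (P.enrolUserAs_toState (st.next P) _ _ _ _ _) fun y hy h => ?_)
    obtain ⟨z, -, h2, e⟩ := simEnrolUserAs_eq_some hy
    rw [e]
    exact h.imp_right fun h => h.enrolUserAs h2 _ _ _
  | signal =>
    exact Matches.perform P (f := fun r => P.signal st.un.length r x) (P.matches_signal hn' _ _)
  | hello =>
    refine Matches.perform P (f := fun r => P.hello st.un.length r)
      (.of_eq (P.hello_toState (st.next P) _) fun y hy h => ?_)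
    obtain ⟨u, v, -, -, e⟩ := simHello_eq_some hy
    rw [e]
    exact h.of_eq rfl rfl
  | helloAs =>
    refine Matches.perform P (f := fun r => P.helloAs st.un.length r _ _)
      (.of_eq (P.serverHello_toState (st.next P) _ _ _ _) fun y hy h => ?_)
    rw [(simServerHello_eq_some hy).2]
    exact h.of_eq rfl rfl
  | toDCP =>
    exact Matches.perform P (f := fun r => P.toDCP st.un.length r _ _ _ _)
      (P.matches_toDCP hn' _ _ _ _ _)
  | toServer =>
    refine Matches.perform P (f := fun _ => P.toServer st.un.length _ _ _ _ _ _)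
      (.of_eq (P.toServer_toState (st.next P) _ _ _ _ _ _) fun y hy h => ?_)
    obtain ⟨v, -, e⟩ := simToServer_eq_some hy
    rw [e]
    exact h.of_eq rfl rfl
  | page =>
    exact Matches.perform P (f := fun _ => P.page κ st.un.length _ _)
      (P.matches_page κ hn' _ _)
  | inject =>
    exact Matches.perform P (f := fun _ => P.inject κ st.un.length _) (P.matches_inject κ hn' _)

end

end Scheme

/-! ### The size of the state of the simulator -/

section

variable {α : Type} [Data α]

/-- Lists with at most `k` entries of size at most `M`. -/
def Bounded (k M : ℕ) (l : List α) : Prop := l.length ≤ k ∧ ∀ x ∈ l, dsize x ≤ M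

theorem Bounded.mono {k k' M M' : ℕ} {l : List α} (h : Bounded k M l) (hk : k ≤ k')
    (hM : M ≤ M') : Bounded k' M' l :=
  ⟨h.1.trans hk, fun x hx => (h.2 x hx).trans hM⟩

theorem Bounded.cons {k M M' : ℕ} {l : List α} (h : Bounded k M l) {e : α} (hM : M ≤ M')
    (he : dsize e ≤ M') : Bounded (k + 1) M' (e :: l) := by
  refine ⟨Nat.succ_le_succ h.1, fun x hx => ?_⟩
  rcases List.mem_cons.1 hx with rfl | hx
  · exact he
  · exact (h.2 x hx).trans hM

theorem dsize_take_le (l : List α) (j : ℕ) : dsize (l.take j) ≤ dsize l :=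
  dsize_sublist (List.take_sublist j l)

theorem dsize_drop_le (l : List α) (j : ℕ) : dsize (l.drop j) ≤ dsize l :=
  dsize_sublist (List.drop_sublist j l)

/-- Sequence numbers grow slowly. -/
theorem size_add_le (m j : ℕ) : Nat.size (m + j) ≤ Nat.size m + j := by
  induction j with
  | zero => rfl
  | succ j ih =>
    have h1 : Nat.size (m + j + 1) ≤ Nat.size (m + j) + 1 := by
      rw [Nat.size_le]
      have := Nat.lt_size_self (m + j)
      rw [pow_succ]
      omega
    rw [← Nat.add_assoc]
    omega

theorem size_toNat_le (x : Str) : Nat.size (toNat x) ≤ x.length :=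
  Nat.size_le.2 (toNat_lt x)

end

namespace Scheme

variable (P : Scheme) (κ : Kind)

/-- The bound `F` on the size of the keys and certificates that are computed in the registration
and enrolment of webservers and users, at security parameter `n` and for inputs of size up to `w`;
the four strings of coins of a step together have size up to `3 + 4 * w`. -/
structure Fresh (n w F : ℕ) : Prop where
  register : ∀ (r : StepCoins) (sk B : Str), dsize r ≤ 3 + 4 * w → dsize sk ≤ w → dsize B ≤ w →
    dsize (P.sig.gen n r.1, P.sig.sign n sk r.2.1 [B, (P.sig.gen n r.1).1]) ≤ F
  secrets : ∀ (c gb : Str) z, dsize c ≤ 3 + 4 * w → dsize gb ≤ w →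
    P.serverSecrets (List.replicate n ()) c gb = some z → dsize z ≤ F
  enrol : ∀ (r : StepCoins) gb z v, dsize r ≤ 3 + 4 * w →
    P.dh.pow n (P.dh.base n) r.2.1 = some gb →
    P.serverSecrets (List.replicate n ()) r.2.2.2 gb = some z →
    P.webSecrets r (List.replicate n ()) z.1 = some v →
    dsize ((P.pke.gen n r.1).1, z, v) ≤ F

/-- These computations do not depend on the tables, so that they have a polynomial bound which does
not grow in the course of a run. -/
theorem exists_fresh : ∃ q : Polynomial ℕ, ∀ n w, P.Fresh n w (q.eval (n + w)) := by
  have h1 : Comp fun x : List Unit × StepCoins × Str × Str =>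
      (P.sig.gen x.1.length x.2.1.1, P.sig.sign x.1.length x.2.2.1 x.2.1.2.1
        [x.2.2.2, (P.sig.gen x.1.length x.2.1.1).1]) := by fun_prop
  have h2 : Comp fun x : List Unit × Str × Str => P.serverSecrets x.1 x.2.1 x.2.2 := by fun_prop
  have h3 : Comp fun x : List Unit × StepCoins => ((P.pke.gen x.1.length x.2.1).1,
      (P.dh.pow x.1.length (P.dh.base x.1.length) x.2.2.1).bind fun gb =>
        (P.serverSecrets x.1 x.2.2.2.2 gb).bind fun z =>
          (P.webSecrets x.2 x.1 z.1).map fun v => (z, v)) := by fun_prop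
  obtain ⟨q1, hq1⟩ := h1.dsize_le
  obtain ⟨q2, hq2⟩ := h2.dsize_le
  obtain ⟨q3, hq3⟩ := h3.dsize_le
  refine ⟨(q1 + q2 + q3).comp (10 + 10 * .X), fun n w => ⟨?_, ?_, ?_⟩⟩
  · intro r sk B hr hsk hB
    have h4 := hq1 (List.replicate n (), r, sk, B)
    simp only [List.length_replicate, dsize_prod (_ : List Unit), dsize_prod (_ : StepCoins),
      dsize_prod (_ : Str) (_ : Str), dsize_replicate_unit] at h4
    have h5 := h4.trans (eval_mono q1 (show _ ≤ 10 + 10 * (n + w) by omega))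
    simp only [Polynomial.eval_comp, Polynomial.eval_add, Polynomial.eval_mul,
      Polynomial.eval_ofNat, Polynomial.eval_X]
    omega
  · intro c gb z hc hgb hz
    have h4 := hq2 (List.replicate n (), c, gb)
    simp only [hz, dsize_some, dsize_prod (_ : List Unit),
      dsize_prod (_ : Str) (_ : Str), dsize_replicate_unit] at h4
    have h5 := h4.trans (eval_mono q2 (show _ ≤ 10 + 10 * (n + w) by omega))
    simp only [Polynomial.eval_comp, Polynomial.eval_add, Polynomial.eval_mul,
      Polynomial.eval_ofNat, Polynomial.eval_X]
    omega
  · intro r gb z v hr hgb hz hv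
    have h4 := hq3 (List.replicate n (), r)
    simp only [List.length_replicate, hgb, hz, hv, Option.bind_some, Option.map_some,
      dsize_some, dsize_prod (_ : List Unit), dsize_prod (_ : Str) (_ : Option _),
      dsize_replicate_unit] at h4
    have h5 := h4.trans (eval_mono q3 (show _ ≤ 10 + 10 * (n + w) by omega))
    simp only [Polynomial.eval_comp, Polynomial.eval_add, Polynomial.eval_mul,
      Polynomial.eval_ofNat, Polynomial.eval_X]
    have h6 := dsize_prod (P.pke.gen n r.1).1 (z, v)
    omega

/-- A bound on the state of the simulator after `k` steps. Every step adds at most one entry to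
each table, of a size that exceeds the size `M` of the previous ones by a bounded amount. -/
structure Small (n w k M : ℕ) (st : Sim) : Prop where
  un : st.un = List.replicate n ()
  tape : dsize st.tape ≤ w
  caPk : dsize st.caPk ≤ w
  caSk : dsize st.caSk ≤ w
  honest : Bounded k M st.honest
  corrupt : Bounded k M st.corrupt
  tls : Bounded k M st.tls
  serverDB : Bounded k M st.serverDB
  userDB : Bounded k M st.userDB
  pks : Bounded w M st.pks
  user : ∀ u, st.user = some u →
    dsize (u.1, u.2.1) ≤ M ∧ ∀ v, u.2.2 = some v → dsize v ≤ M

section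

variable {P} {κ} {n w k M : ℕ} {st : Sim}

theorem Small.mono (h : Small n w k M st) {k' M' : ℕ} (hk : k ≤ k') (hM : M ≤ M') :
    Small n w k' M' st :=
  ⟨h.un, h.tape, h.caPk, h.caSk, h.honest.mono hk hM, h.corrupt.mono hk hM, h.tls.mono hk hM,
    h.serverDB.mono hk hM, h.userDB.mono hk hM, h.pks.mono le_rfl hM,
    fun u hu => ⟨(h.user u hu).1.trans hM, fun v hv => ((h.user u hu).2 v hv).trans hM⟩⟩

/-- The coins of a step are taken from the tape. -/
theorem Small.next (h : Small n w k M st) : Small n w k M (st.next P) :=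
  { h with
    tape := (((dsize_drop_le _ _).trans (dsize_drop_le _ _)).trans (dsize_drop_le _ _)).trans
      ((dsize_drop_le _ _).trans h.tape) }

theorem Small.coins (h : Small n w k M st) : dsize (st.coins P) ≤ 3 + 4 * w := by
  have h1 : ∀ j : ℕ, dsize (st.tape.drop j) ≤ w := fun j => (dsize_drop_le _ j).trans h.tape
  have h2 : ∀ l : Str, dsize l ≤ w → ∀ i j, dsize ((l.drop j).take i) ≤ w ∧
      dsize (l.drop j) ≤ w := fun l hl i j => ⟨(dsize_take_le _ _).trans
        ((dsize_drop_le _ _).trans hl), (dsize_drop_le _ _).trans hl⟩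
  unfold Sim.coins
  rw [dsize_prod (α := Str), dsize_prod (α := Str), dsize_prod (α := Str)]
  set j := P.ℓ.eval st.un.length
  have e1 := (dsize_take_le st.tape j).trans h.tape
  have e2 := (h2 _ h.tape j j).1
  have e3 := (h2 _ (h2 _ h.tape j j).2 j j).1
  have e4 := (h2 _ (h2 _ (h2 _ h.tape j j).2 j j).2 j j).1
  omega

/-- The size of the state of the simulator. -/
theorem Small.dsize_le (h : Small n w k M st) :
    dsize st ≤ 50 + 2 * n + 4 * w + (5 * k + w + 2) * (1 + M) := by
  have e1 := dsize_list_le h.honest.1 h.honest.2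
  have e2 := dsize_list_le h.corrupt.1 h.corrupt.2
  have e3 := dsize_list_le h.tls.1 h.tls.2
  have e4 := dsize_list_le h.serverDB.1 h.serverDB.2
  have e5 := dsize_list_le h.userDB.1 h.userDB.2
  have e6 := dsize_list_le h.pks.1 h.pks.2
  have e7 : dsize st.user ≤ 10 + 2 * M := by
    cases hu : st.user with
    | none => rw [dsize_none]; omega
    | some u =>
      obtain ⟨h1, h2⟩ := h.user u hu
      obtain ⟨id, sqn, o⟩ := u
      rw [dsize_some]
      have e : dsize ((id, sqn, o) : SimUser) = 1 + dsize id + (1 + dsize sqn + dsize o) := rfl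
      have e' : dsize (id, sqn) = 1 + dsize id + dsize sqn := rfl
      cases o with
      | none =>
        rw [dsize_none] at e
        simp only at h1
        omega
      | some v =>
        have h3 := h2 v rfl
        rw [dsize_some] at e
        simp only at h1
        omega
  have e8 : dsize st.un = 1 + 2 * n := by rw [h.un, dsize_replicate_unit]
  have e9 : dsize st = 1 + (1 + dsize st.un + (1 + dsize st.tape + (1 + dsize st.caPk +
      dsize st.caSk))) + (1 + dsize st.honest + (1 + dsize st.corrupt + (1 + dsize st.tls +
      (1 + dsize st.serverDB + (1 + dsize st.userDB + (1 + dsize st.pks + dsize st.user)))))) :=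
    rfl
  have h1 := h.tape
  have h2 := h.caPk
  have h3 := h.caSk
  have e10 : (5 * k + w + 2) * (1 + M) = 5 * (k * (1 + M)) + w * (1 + M) + 2 * (1 + M) := by ring
  rw [e10]
  omega

variable {F D : ℕ}

theorem Small.simCheck (h : Small n w k M st) (n' : ℕ) (t : Str) (s : MACState) :
    Small n w k M (P.simCheck n' t st s).1 := by
  rcases P.simCheck_fst (st := st) n' t s with e | ⟨u, hu, e⟩
  · rw [e]
    exact h
  · rw [e]
    refine { h with user := ?_ }
    rintro _ ⟨⟩
    exact ⟨(h.user u hu).1, by simp⟩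

theorem Small.simRegisterHonest (h : Small n w k M st) (hF : P.Fresh n w F)
    (hD : 20 + 10 * w + 10 * F + P.nMax ≤ D) {r : StepCoins} (hr : dsize r ≤ 3 + 4 * w) {B : Str}
    (hB : dsize B ≤ w) {y : (Str × Str) × Sim} (hy : P.simRegisterHonest r B st = some y) :
    Small n w (k + 1) (M + D) y.2 := by
  rw [simRegisterHonest_eq_some hy]
  refine { h.mono (Nat.le_succ k) (Nat.le_add_right M D) with
    honest := h.honest.cons (Nat.le_add_right M D) ?_ }
  have h1 := hF.register r st.caSk B hr h.caSk hB
  rw [h.un, List.length_replicate]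
  have e : ∀ x y z : Str, dsize ((B, x, y, z, none) : Str × SimServer) =
    1 + dsize B + (1 + dsize x + (1 + dsize y + (1 + dsize z + 1))) := fun _ _ _ => rfl
  rw [e]
  have h2 : 1 + (1 + dsize (P.sig.gen n r.1).1 + dsize (P.sig.gen n r.1).2) +
    dsize (P.sig.sign n st.caSk r.2.1 [B, (P.sig.gen n r.1).1]) ≤ F := h1
  omega

theorem Small.simRegisterCorrupt (h : Small n w k M st)
    (hD : 20 + 10 * w + 10 * F + P.nMax ≤ D) {r : StepCoins} {B pk : Str}
    (hB : dsize B ≤ w) {y : Str × Sim} (hy : P.simRegisterCorrupt κ r B pk st = some y) :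
    Small n w (k + 1) (M + D) y.2 := by
  rw [simRegisterCorrupt_eq_some hy]
  refine { h.mono (Nat.le_succ k) (Nat.le_add_right M D) with
    corrupt := h.corrupt.cons (Nat.le_add_right M D) ?_ }
  rw [dsize_prod, dsize_unit]
  omega

theorem Small.simDcpEnrolServer (h : Small n w k M st) (hF : P.Fresh n w F)
    (hD : 20 + 10 * w + 10 * F + P.nMax ≤ D) {c gb B certPk cert pk' s : Str}
    (hc : dsize c ≤ 3 + 4 * w) (hgb : dsize gb ≤ w) (hB : dsize B ≤ w) (hpk : dsize pk' ≤ w)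
    {y : Str × Sim} (hy : P.simDcpEnrolServer c gb B certPk cert pk' s st = some y) :
    Small n w (k + 1) (M + D) y.2 := by
  obtain ⟨z, hz, rfl⟩ := simDcpEnrolServer_eq_some hy
  refine { h.mono (Nat.le_succ k) (Nat.le_add_right M D) with
    serverDB := h.serverDB.cons (Nat.le_add_right M D) ?_ }
  rw [h.un] at hz
  have h1 := hF.secrets c gb z hc hgb hz
  have e : dsize z = 1 + dsize z.1 + dsize z.2 := rfl
  have e' : dsize ((B, pk', z.2) : Str × Str × Str × Str) =
    1 + dsize B + (1 + dsize pk' + dsize z.2) := rfl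
  omega

theorem Small.simEnrolServer (h : Small n w k M st) (hF : P.Fresh n w F)
    (hD : 20 + 10 * w + 10 * F + P.nMax ≤ D) {r : StepCoins} (hr : dsize r ≤ 3 + 4 * w) {B : Str}
    (hB : dsize B ≤ w) {y : Str × Sim} (hy : P.simEnrolServer r B st = some y) :
    Small n w (k + 1) (M + D) y.2 := by
  obtain ⟨x, gb, z, v, hx, hgb, hz, hv, e⟩ := simEnrolServer_eq_some hy
  rw [e]
  rw [h.un] at hgb hz hv ⊢
  rw [List.length_replicate] at hgb ⊢
  have h1 := hF.enrol r gb z v hr hgb hz hv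
  have h2 := h.honest.2 _ (assoc_mem hx)
  have e1 : dsize ((P.pke.gen n r.1).1, z, v) = 1 + dsize (P.pke.gen n r.1).1 +
    (1 + (1 + dsize z.1 + dsize z.2) + dsize v) := rfl
  have e2 : dsize ((B, x) : Str × SimServer) = 1 + dsize B + (1 + dsize x.1 +
    (1 + dsize x.2.1 + (1 + dsize x.2.2.1 + dsize x.2.2.2))) := rfl
  have e3 : dsize ((B, x.1, x.2.1, x.2.2.1, some v) : Str × SimServer) = 1 + dsize B +
    (1 + dsize x.1 + (1 + dsize x.2.1 + (1 + dsize x.2.2.1 + (1 + dsize v)))) := rfl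
  have e4 : dsize ((B, (P.pke.gen n r.1).1, z.2) : Str × Str × Str × Str) =
    1 + dsize B + (1 + dsize (P.pke.gen n r.1).1 + dsize z.2) := rfl
  exact { h.mono (Nat.le_succ k) (Nat.le_add_right M D) with
    honest := h.honest.cons (Nat.le_add_right M D) (by omega)
    serverDB := h.serverDB.cons (Nat.le_add_right M D) (by omega) }

theorem Small.simEnrolUser (h : Small n w k M st)
    (hD : 20 + 10 * w + 10 * F + P.nMax ≤ D) {r : StepCoins} (hr : dsize r ≤ 3 + 4 * w)
    {sites : List Str} {instr : Str} (hs : dsize sites ≤ w) (hi : dsize instr ≤ w)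
    {y : Unit × Sim} (hy : P.simEnrolUser r sites instr st = some y) :
    Small n w (k + 1) (M + D) y.2 := by
  obtain ⟨-, -, e⟩ := simEnrolUser_eq_some hy
  rw [e]
  have e1 : dsize r = 1 + dsize r.1 + (1 + dsize r.2.1 + dsize r.2.2) := rfl
  have e2 := dsize_take_le r.2.1 (P.mi st.un.length)
  have e3 := size_toNat_le r.1
  have e4 := dsize_str r.1
  have e5 : dsize (toNat r.1) = 1 + Nat.size (toNat r.1) := rfl
  set id := r.2.1.take (P.mi st.un.length)
  have e6 : dsize ((id, none, toNat r.1, instr) : Str × SimRecord) =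
    1 + dsize id + (1 + 1 + (1 + dsize (toNat r.1) + dsize instr)) := rfl
  have e7 : dsize (id, toNat r.1) = 1 + dsize id + dsize (toNat r.1) := rfl
  refine { h.mono (Nat.le_succ k) (Nat.le_add_right M D) with
    userDB := h.userDB.cons (Nat.le_add_right M D) (by omega)
    pks := ⟨?_, ?_⟩
    user := ?_ }
  · exact (List.length_filterMap_le _ _).trans ((length_lt_dsize sites).le.trans hs)
  · intro x hx
    obtain ⟨B, hB, hx⟩ := List.mem_filterMap.1 hx
    obtain ⟨v, hv, rfl⟩ := Option.map_eq_some_iff.1 hx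
    have h1 := dsize_mem hB
    have h2 := h.serverDB.2 _ (assoc_mem hv)
    have e8 : dsize ((B, v) : Str × Str × Str × Str) = 1 + dsize B + (1 + dsize v.1 +
      dsize v.2) := rfl
    have e9 : dsize (B, v.1) = 1 + dsize B + dsize v.1 := rfl
    omega
  · rintro _ ⟨⟩
    refine ⟨?_, by simp⟩
    simp only
    omega

theorem Small.simEnrolUserAs (h : Small n w k M st) (hF : P.Fresh n w F)
    (hD : 20 + 10 * w + 10 * F + P.nMax ≤ D) {r : StepCoins} (hr : dsize r ≤ 3 + 4 * w)
    {ga : Str} {sqn : ℕ} {instr : Str} {sites : List Str} (hga : dsize ga ≤ w)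
    (hs : dsize sqn ≤ w) (hi : dsize instr ≤ w) {y : (Str × List (Str × Str) × Str) × Sim}
    (hy : P.simEnrolUserAs r ga sqn instr sites st = some y) :
    Small n w (k + 1) (M + D) y.2 := by
  obtain ⟨z, hz, -, e⟩ := simEnrolUserAs_eq_some hy
  rw [e]
  rw [h.un] at hz
  have e1 : dsize r = 1 + dsize r.1 + (1 + dsize r.2.1 + dsize r.2.2) := rfl
  have e2 := dsize_take_le r.1 (P.mi st.un.length)
  have h1 := hF.secrets r.2.1 ga z (by omega) hga hz
  have e3 : dsize z = 1 + dsize z.1 + (1 + dsize z.2.1 + dsize z.2.2) := rfl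
  set id := r.1.take (P.mi st.un.length)
  have e6 : dsize ((id, some z.2.2, sqn, instr) : Str × SimRecord) =
    1 + dsize id + (1 + (1 + dsize z.2.2) + (1 + dsize sqn + dsize instr)) := rfl
  exact { h.mono (Nat.le_succ k) (Nat.le_add_right M D) with
    userDB := h.userDB.cons (Nat.le_add_right M D) (by omega) }

theorem Small.simSignal (h : Small n w k M st) (hD : 20 + 10 * w + 10 * F + P.nMax ≤ D)
    {r : StepCoins} {n' : ℕ} {B : Str} {s : MACState} (hB : dsize B ≤ w) {y : Str × Sim}
    (hy : (P.simSignal r n' B st s).1 = some y) (hyw : dsize y.1 ≤ w) :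
    Small n w (k + 1) (M + D) y.2 := by
  obtain ⟨u, hu, e⟩ := simSignal_eq_some hy
  rw [e]
  have h1 := (h.user u hu).1
  have e1 : dsize (u.1, u.2.1) = 1 + dsize u.1 + (1 + Nat.size u.2.1) := rfl
  have e2 : dsize (u.1, u.2.1 + 1) = 1 + dsize u.1 + (1 + Nat.size (u.2.1 + 1)) := rfl
  have e3 := size_add_le u.2.1 1
  refine { h.mono (Nat.le_succ k) (Nat.le_add_right M D) with user := ?_ }
  rintro _ ⟨⟩
  refine ⟨?_, ?_⟩
  · simp only
    omega
  · rintro _ ⟨⟩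
    have e4 : dsize (B, u.2.1, y.1) = 1 + dsize B + (1 + (1 + Nat.size u.2.1) + dsize y.1) := rfl
    omega

theorem Small.addTLS (h : Small n w k M st) {e : (Str × Str) × SimTLS} (he : dsize e ≤ M + D) :
    Small n w (k + 1) (M + D) (st.addTLS e) :=
  { h.mono (Nat.le_succ k) (Nat.le_add_right M D) with
    tls := h.tls.cons (Nat.le_add_right M D) he }

theorem Small.simServerHello (h : Small n w k M st)
    (hD : 20 + 10 * w + 10 * F + P.nMax ≤ D) {r : StepCoins} {b : Bool} {B x : Str}
    (hx : dsize x ≤ w) {y : (Str × Str × Str × Str) × Sim}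
    (hy : P.simServerHello r b B x st = some y) (hyw : dsize y.1 ≤ w) :
    Small n w (k + 1) (M + D) y.2 := by
  obtain ⟨e1, e2⟩ := simServerHello_eq_some hy
  rw [e2]
  have e3 : dsize y.1 = 1 + dsize y.1.1 + (1 + dsize y.1.2.1 + (1 + dsize y.1.2.2.1 +
    dsize y.1.2.2.2)) := rfl
  rw [e1] at e3
  have e4 : dsize (((B, y.1.2.2.1), b, x, none) : (Str × Str) × SimTLS) =
    1 + (1 + dsize B + dsize y.1.2.2.1) + (1 + 1 + (1 + dsize x + 1)) := rfl
  exact h.addTLS (by omega)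

theorem Small.simHello (h : Small n w k M st) (hD : 20 + 10 * w + 10 * F + P.nMax ≤ D)
    {r : StepCoins} {y : (Str × Str × Str × Str) × Sim} (hy : P.simHello r st = some y)
    (hyw : dsize y.1 ≤ w) : Small n w (k + 1) (M + D) y.2 := by
  obtain ⟨u, v, hu, hv, e⟩ := simHello_eq_some hy
  rw [e]
  have e3 : dsize y.1 = 1 + dsize y.1.1 + (1 + dsize y.1.2.1 + (1 + dsize y.1.2.2.1 +
    dsize y.1.2.2.2)) := rfl
  have e4 : dsize (((y.1.1, y.1.2.2.1), true, v.2.2, none) : (Str × Str) × SimTLS) =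
    1 + (1 + dsize y.1.1 + dsize y.1.2.2.1) + (1 + 1 + (1 + dsize v.2.2 + 1)) := rfl
  have e5 : dsize v = 1 + dsize v.1 + (1 + dsize v.2.1 + dsize v.2.2) := rfl
  have h1 := (h.user u hu).2 v hv
  exact h.addTLS (by omega)

theorem Small.simToServer (h : Small n w k M st) (hD : 20 + 10 * w + 10 * F + P.nMax ≤ D)
    {B nonceB c s nonceC t : Str} (hs : dsize s ≤ w) {y : Unit × Sim}
    (hy : P.simToServer B nonceB c s nonceC t st = some y) :
    Small n w (k + 1) (M + D) y.2 := by
  obtain ⟨v, hv, e⟩ := simToServer_eq_some hy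
  rw [e]
  have h1 := h.tls.2 _ (assoc_mem hv)
  have e3 : dsize (((B, nonceB), v) : (Str × Str) × SimTLS) = 1 + dsize (B, nonceB) +
    (1 + dsize v.1 + (1 + dsize v.2.1 + dsize v.2.2)) := rfl
  have e4 : dsize (((B, nonceB), v.1, v.2.1, some s) : (Str × Str) × SimTLS) =
    1 + dsize (B, nonceB) + (1 + dsize v.1 + (1 + dsize v.2.1 + (1 + dsize s))) := rfl
  exact h.addTLS (by omega)

theorem Small.simToDCP (h : Small n w k M st) (hD : 20 + 10 * w + 10 * F + P.nMax ≤ D)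
    {r : StepCoins} {n' : ℕ} {B c nonceB t : Str} {s : MACState}
    {y : (Str × Str × Str × Str) × Sim} (hy : (P.simToDCP r n' B c nonceB t st s).1 = some y) :
    Small n w (k + 1) (M + D) y.2 := by
  obtain ⟨id, v, m, hv, hm, e⟩ := simToDCP_eq_some hy
  rw [e]
  have h1 := h.userDB.2 _ (assoc_mem hv)
  have e1 : dsize ((id, v) : Str × SimRecord) = 1 + dsize id + (1 + dsize v.1 +
    (1 + (1 + Nat.size v.2.1) + dsize v.2.2)) := rfl
  have e2 : dsize ((id, v.1, m + 1, v.2.2) : Str × SimRecord) = 1 + dsize id + (1 + dsize v.1 +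
    (1 + (1 + Nat.size (m + 1)) + dsize v.2.2)) := rfl
  have e3 : Nat.size (m + 1) ≤ Nat.size (v.2.1 + (P.nMax + 1)) := Nat.size_le_size (by omega)
  have e4 := size_add_le v.2.1 (P.nMax + 1)
  exact { h.mono (Nat.le_succ k) (Nat.le_add_right M D) with
    userDB := h.userDB.cons (Nat.le_add_right M D) (by omega) }

theorem Small.simPerform {α β : Type} [Data β] (h : Small n w k M st)
    {g : ℕ → StepCoins × α × Sim → MACState → Option (β × Sim) × MACState} {n' : ℕ} {x : α}
    {s : MACState} {w' : ℕ} (hw : w' + dsize (simPerform P g n' (x, st) s).1.1 ≤ w)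
    (hg : ∀ y, (g n' (st.coins P, x, st.next P) s).1 = some y → w' + dsize y.1 ≤ w →
      Small n w (k + 1) (M + D) y.2) :
    Small n w (k + 1) (M + D) (Distress.simPerform P g n' (x, st) s).1.2 := by
  unfold Distress.simPerform at hw ⊢
  simp only at hw ⊢
  cases hq : (g n' (st.coins P, x, st.next P) s).1 with
  | none => exact h.next.mono (Nat.le_succ k) (Nat.le_add_right M D)
  | some y =>
    rw [hq] at hw
    simp only [Option.elim_some, dsize_some] at hw
    exact hg y hq (by omega)

/-- The growth of the state of the simulator in one step. The query and the answer are bounded since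
the adversary has to write and to read them. -/
theorem Small.simHandle (h : Small n w k M st) (hF : P.Fresh n w F)
    (hD : 20 + 10 * w + 10 * F + P.nMax ≤ D) (i : Call) (x : (protocolInterface.dom i).den)
    (s : MACState) (hw : (protocolInterface.dom i).size x +
      (protocolInterface.cod i).size (P.simHandle κ n i (x, st) s).1.1 ≤ w) :
    Small n w (k + 1) (M + D) (P.simHandle κ n i (x, st) s).1.2 := by
  have hc := h.coins (P := P)
  have hc' : dsize (st.coins P) = 1 + dsize (st.coins P).1 + (1 + dsize (st.coins P).2.1 +
    (1 + dsize (st.coins P).2.2.1 + dsize (st.coins P).2.2.2)) := rfl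
  have hn := h.next (P := P)
  cases i with
  | caPublicKey =>
    refine h.simPerform hw ?_
    rintro _ ⟨⟩ -
    exact hn.mono (Nat.le_succ k) (Nat.le_add_right M D)
  | registerHonest =>
    exact h.simPerform hw fun y hy hyw => hn.simRegisterHonest hF hD hc
      ((Nat.le_add_right _ _).trans hyw) hy
  | registerCorrupt =>
    have e : (protocolInterface.dom .registerCorrupt).size x = 1 + dsize x.1 + dsize x.2 := rfl
    exact h.simPerform hw fun y hy hyw => hn.simRegisterCorrupt hD (B := x.1) (by omega) hy
  | enrolServer =>
    exact h.simPerform hw fun y hy hyw => hn.simEnrolServer hF hD hc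
      ((Nat.le_add_right _ _).trans hyw) hy
  | enrolServerAs =>
    have e : (protocolInterface.dom .enrolServerAs).size x = 1 + dsize x.1 + (1 + dsize x.2.1 +
      (1 + dsize x.2.2.1 + (1 + dsize x.2.2.2.1 + (1 + dsize x.2.2.2.2.1 +
        dsize x.2.2.2.2.2)))) := rfl
    exact h.simPerform hw fun y hy hyw => hn.simDcpEnrolServer hF hD (c := (st.coins P).1)
      (gb := x.1) (B := x.2.1) (pk' := x.2.2.2.2.1) (by omega) (by omega) (by omega) (by omega) hy
  | enrolUser =>
    have e : (protocolInterface.dom .enrolUser).size x = 1 + dsize x.1 + dsize x.2 := rfl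
    exact h.simPerform hw fun y hy hyw => hn.simEnrolUser hD hc (sites := x.1) (instr := x.2)
      (by omega) (by omega) hy
  | enrolUserAs =>
    have e : (protocolInterface.dom .enrolUserAs).size x = 1 + dsize x.1 + (1 + dsize x.2.1 +
      (1 + dsize x.2.2.1 + dsize x.2.2.2)) := rfl
    exact h.simPerform hw fun y hy hyw => hn.simEnrolUserAs hF hD hc (ga := x.1) (sqn := x.2.1)
      (instr := x.2.2.1) (by omega) (by omega) (by omega) hy
  | signal =>
    exact h.simPerform hw fun y hy hyw => hn.simSignal hD
      ((Nat.le_add_right _ _).trans hyw) hy ((Nat.le_add_left _ _).trans hyw)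
  | hello =>
    exact h.simPerform hw fun y hy hyw => hn.simHello hD hy ((Nat.le_add_left _ _).trans hyw)
  | helloAs =>
    have e : (protocolInterface.dom .helloAs).size x = 1 + dsize x.1 + dsize x.2 := rfl
    exact h.simPerform hw fun y hy hyw => hn.simServerHello hD (x := x.2) (by omega) hy
      ((Nat.le_add_left _ _).trans hyw)
  | toDCP =>
    exact h.simPerform hw fun y hy _ => hn.simToDCP hD hy
  | toServer =>
    have e : (protocolInterface.dom .toServer).size x = 1 + dsize x.1 + (1 + dsize x.2.1 +
      (1 + dsize x.2.2.1 + (1 + dsize x.2.2.2.1 + (1 + dsize x.2.2.2.2.1 +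
        dsize x.2.2.2.2.2)))) := rfl
    exact h.simPerform hw fun y hy _ => hn.simToServer hD (s := x.2.2.2.1) (by omega) hy
  | page =>
    refine h.simPerform hw fun y hy _ => ?_
    rcases simPage_eq_some hy with e | ⟨t, e⟩
    · rw [e]
      exact hn.mono (Nat.le_succ k) (Nat.le_add_right M D)
    · rw [e]
      exact (hn.simCheck _ _ _).mono (Nat.le_succ k) (Nat.le_add_right M D)
  | inject =>
    refine h.simPerform hw fun y hy _ => ?_
    rw [simInject_eq_some hy]
    exact (hn.simCheck _ _ _).mono (Nat.le_succ k) (Nat.le_add_right M D)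

end

end Scheme

/-! ### The reduction -/

section

/-- Coins as coins for the certificate authority, for the steps of a run, and for the adversary. -/
def splitCoins {N ℓ m T : ℕ} (hN : N = ℓ + m + 4 * T * ℓ) (f : Fin N → Bool) :
    (Fin ℓ → Bool) × (Fin T → Fin 4 → Fin ℓ → Bool) × (Fin m → Bool) :=
  (fun i => f ⟨i, by omega⟩,
    fun j l i => f ⟨ℓ + m + ℓ * (4 * j + l) + i, by
      have h1 : 4 * (j : ℕ) + l + 1 ≤ 4 * T := by omega
      have h2 := Nat.mul_le_mul_left ℓ h1
      have h3 : ℓ * (4 * T) = 4 * T * ℓ := mul_comm _ _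
      rw [mul_add, mul_one, h3] at h2
      omega⟩,
    fun i => f ⟨ℓ + i, by omega⟩)

theorem splitCoins_bijective {N ℓ m T : ℕ} (hN : N = ℓ + m + 4 * T * ℓ) :
    Function.Bijective (splitCoins hN) := by
  rw [Fintype.bijective_iff_injective_and_card]
  constructor
  · intro f g h
    funext ⟨i, hi⟩
    rcases lt_or_ge i ℓ with h1 | h1
    · exact congrFun (congrArg (fun x => x.1) h) ⟨i, h1⟩
    rcases lt_or_ge i (ℓ + m) with h2 | h2
    · have h3 := congrFun (congrArg (fun x => x.2.2) h) ⟨i - ℓ, by omega⟩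
      simp only [splitCoins] at h3
      have e : ℓ + (i - ℓ) = i := by omega
      simpa only [e] using h3
    -- The coins of the steps come in `4 * T` blocks of length `ℓ`; this is block `q`.
    · obtain ⟨q, hq⟩ : ∃ q, q = (i - (ℓ + m)) / ℓ := ⟨_, rfl⟩
      have hℓ : 0 < ℓ := by
        rcases Nat.eq_zero_or_pos ℓ with rfl | h0
        · omega
        · exact h0
      have h3 : q < 4 * T := by
        rw [hq, Nat.div_lt_iff_lt_mul hℓ]
        omega
      have h4 := congrFun (congrFun (congrFun (congrArg (fun x => x.2.1) h) ⟨q / 4, by omega⟩)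
        ⟨q % 4, by omega⟩) ⟨(i - (ℓ + m)) % ℓ, Nat.mod_lt _ hℓ⟩
      simp only [splitCoins] at h4
      have e : ℓ + m + ℓ * (4 * (q / 4) + q % 4) + (i - (ℓ + m)) % ℓ = i := by
        rw [Nat.div_add_mod, hq, Nat.add_assoc, Nat.div_add_mod]
        omega
      simpa only [e] using h4
  · subst hN
    simp only [Fintype.card_prod, Fintype.card_pi, Fintype.card_bool, Finset.prod_const,
      Finset.card_univ, Fintype.card_fin, ← pow_mul, ← pow_add]
    congr 1
    ring

/-- A slice of a string of coins. -/
theorem take_drop_ofFn {N : ℕ} (f : Fin N → Bool) {i j : ℕ} (h : i + j ≤ N) :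
    ((List.ofFn f).drop i).take j = List.ofFn fun l : Fin j => f ⟨i + l, by omega⟩ := by
  refine List.ext_getElem ?_ fun l h1 h2 => ?_
  · simp
    omega
  · simp

theorem prob_nonneg (Ω : Type) [Fintype Ω] (E : Ω → Prop) : 0 ≤ prob Ω E :=
  div_nonneg (Nat.cast_nonneg _) (Nat.cast_nonneg _)

theorem prob_le_of_bijective {Ω Ω' : Type} [Fintype Ω] [Fintype Ω'] {f : Ω' → Ω}
    (hf : Function.Bijective f) {E : Ω → Prop} {E' : Ω' → Prop} (h : ∀ ω, E (f ω) → E' ω) :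
    prob Ω E ≤ prob Ω' E' := by
  unfold prob
  rw [Nat.card_congr (Equiv.ofBijective f hf)]
  refine div_le_div_of_nonneg_right ?_ (Nat.cast_nonneg _)
  refine Nat.cast_le.2 (Nat.card_le_card_of_injective
    (fun ω : {ω // E ω} => (⟨(Equiv.ofBijective f hf).symm ω, h _ ?_⟩ : {ω // E' ω})) ?_)
  · have e : f ((Equiv.ofBijective f hf).symm ω) = ω := (Equiv.ofBijective f hf).apply_symm_apply ω
    rw [e]
    exact ω.2
  · intro x y hxy
    exact Subtype.ext ((Equiv.ofBijective f hf).symm.injective (congrArg Subtype.val hxy))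

theorem Negligible.mono {f g : ℕ → ℝ} (hg : Negligible g) (hf : ∀ n, 0 ≤ f n)
    (hfg : ∀ n, f n ≤ g n) : Negligible f :=
  Asymptotics.SuperpolynomialDecay.trans_abs_le hg fun n => by
    rw [abs_of_nonneg (hf n), abs_of_nonneg ((hf n).trans (hfg n))]
    exact hfg n

end

namespace Scheme
open Sim

variable (P : Scheme) (κ : Kind)

/-- The state `σ` of the protocol after `k` steps is simulated by `st`, when the state of the
forgery experiment is `ms`. -/
def Related (n w D : ℕ) (ω : Coins P.ℓ n × Coins P.ℓ n) (k : ℕ) (σ : State)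
    (st : (Data.ty Sim).den) (ms : MACState) : Prop :=
  ∃ (st' : Sim) (tr : List Event), st = Data.enc st' ∧
    σ = toState P ms.key (List.ofFn ω.1) (List.ofFn ω.2) tr st' ∧
    ms.key = P.dhMacKey n ω ∧ Good st' ms tr ∧ Small n w k (k * D) st'

variable {P} in
theorem Related.mono {n w D : ℕ} {ω : Coins P.ℓ n × Coins P.ℓ n} (k l : ℕ) (σ : State)
    (st : (Data.ty Sim).den) (ms : MACState) (h : P.Related n w D ω k σ st ms) (hkl : k ≤ l) :
    P.Related n w D ω l σ st ms := by
  obtain ⟨st', tr, h1, h2, h3, h4, h5⟩ := h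
  exact ⟨st', tr, h1, h2, h3, h4, h5.mono hkl (Nat.mul_le_mul_right D hkl)⟩

/-- A bound on the size of the state of the simulator. -/
def stateBound (n w D : ℕ) : ℕ := 50 + 2 * n + 4 * w + (6 * w + 2) * (1 + w * D)

variable {P} in
theorem Related.size_le {n w D T : ℕ} (hT : T ≤ w) {ω : Coins P.ℓ n × Coins P.ℓ n} (k : ℕ)
    (σ : State) (st : (Data.ty Sim).den) (ms : MACState) (h : P.Related n w D ω k σ st ms)
    (hk : k ≤ T) : (Data.ty Sim).size st ≤ stateBound n w D := by
  obtain ⟨st', tr, rfl, -, -, -, h5⟩ := h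
  have h6 := (h5.mono (hk.trans hT) (Nat.mul_le_mul_right D (hk.trans hT))).dsize_le
  refine h6.trans (le_of_eq ?_)
  unfold stateBound
  ring

/-- A simulator for the calls of an adversary; it is the same for all security parameters and
running times. -/
theorem exists_simulator : ∃ (c : ∀ i, Code macInterface
      (.prod (protocolInterface.dom i) (Data.ty Sim))
      (.prod (protocolInterface.cod i) (Data.ty Sim))) (p : Polynomial ℕ),
    ∀ n w T F D Z, P.Fresh n w F → T ≤ w → 20 + 10 * w + 10 * F + P.nMax ≤ D →
      p.eval (n + 1 + w + stateBound n w D) ≤ Z → ∀ ω i,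
        Simulates ((P.attack κ).handle n) (P.oracle n) (P.Related n w D ω) T (Z + 1)
          (.call i) (c i) := by
  choose c p hc using P.exists_simHandle_code κ
  refine ⟨c, p .caPublicKey + p .registerHonest + p .registerCorrupt + p .enrolServer +
    p .enrolServerAs + p .enrolUser + p .enrolUserAs + p .signal + p .hello + p .helloAs +
    p .toDCP + p .toServer + p .page + p .inject, ?_⟩
  intro n w T F D Z hF hT hD hZ ω i k x σ st s hR hk
  have hZ' : (p i).eval (n + 1 + w + stateBound n w D) ≤ Z := by
    simp only [Polynomial.eval_add] at hZ
    cases i <;> omega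
  have hsize := hR.size_le hT k σ st s (by omega)
  obtain ⟨st', tr, hst, rfl, h3, h4, h5⟩ := hR
  rw [hst] at hsize ⊢
  have hn : st'.un.length = n := by rw [h5.un, List.length_replicate]
  obtain ⟨g1, tr', g2, g3⟩ := P.simHandle_spec κ (tr := tr) h3 hn i x
  obtain ⟨e1, e2, e3⟩ := hc i n x st' s
  simp only [Code.run, g2] at hk ⊢
  rw [e1, e2]
  have h6 := h5.simHandle (κ := κ) hF hD i x s (by omega)
  refine ⟨rfl, ⟨_, tr', rfl, ?_, g1.trans h3, g3 h4, h6.mono (by omega) ?_⟩, ?_⟩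
  · rw [g1]
    rfl
  · rw [← Nat.succ_mul]
    exact Nat.mul_le_mul_right D (by omega)
  · refine (e3.trans (eval_mono (p i) ?_)).trans (hZ'.trans (Nat.le_succ Z |>.trans ?_))
    · have : dsize st' ≤ _ := hsize
      omega
    · exact Nat.le_mul_of_pos_right _ (by omega)

variable (A : Adversary protocolInterface)

/-- The input of the adversary and the initial state of the simulator, for the security parameter
in unary and coins for the certificate authority, the adversary and the steps of the run. -/
def simInit (z : List Unit × Str) : (List Unit × Str) × Sim :=
  let k := P.sig.gen z.1.length (z.2.take (P.ℓ.eval z.1.length))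
  ((z.1, (z.2.drop (P.ℓ.eval z.1.length)).take (A.coins.eval z.1.length)),
    (z.1, (z.2.drop (P.ℓ.eval z.1.length)).drop (A.coins.eval z.1.length), k.1, k.2),
    [], [], [], [], [], [], none)

theorem comp_simInit : Comp (P.simInit A) := by
  unfold simInit
  fun_prop

/-- The simulator starts in a state that simulates the start of the experiment, where its own coins
serve as the coins of the honest parties and of the adversary. -/
theorem simInit_spec {n N : ℕ}
    (hN : N = P.ℓ.eval n + A.coins.eval n + 4 * A.time.eval n * P.ℓ.eval n)
    (s : Coins P.ℓ n × Coins P.ℓ n) (f : Fin N → Bool) :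
    (P.simInit A (List.replicate n (), List.ofFn f)).1 =
      (List.replicate n (), List.ofFn (splitCoins hN f).2.2) ∧
    P.start n (A.time.eval n) (s, (splitCoins hN f).1, (splitCoins hN f).2.1) =
      toState P (P.dhMacKey n s) (List.ofFn s.1) (List.ofFn s.2) []
        (P.simInit A (List.replicate n (), List.ofFn f)).2 := by
  have h1 : (List.ofFn f).take (P.ℓ.eval n) = List.ofFn (splitCoins hN f).1 := by
    have := take_drop_ofFn f (i := 0) (j := P.ℓ.eval n) (by omega)
    simpa [splitCoins] using this
  constructor
  · simp only [simInit, List.length_replicate]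
    rw [take_drop_ofFn f (by omega)]
    rfl
  · unfold start toState
    congr 1
    · funext j l
      simp only [simInit, un, tape, List.length_replicate, List.drop_drop]
      split
      · next hj =>
        have h2 : 4 * j + (l : ℕ) + 1 ≤ 4 * A.time.eval n := by omega
        have h3 := Nat.mul_le_mul_left (P.ℓ.eval n) h2
        rw [mul_add, mul_one, mul_comm (P.ℓ.eval n) (4 * A.time.eval n)] at h3
        rw [take_drop_ofFn f (by omega)]
        rfl
      · next hj =>
        have h2 : 4 * A.time.eval n ≤ 4 * j + (l : ℕ) := by omega
        have h3 := Nat.mul_le_mul_left (P.ℓ.eval n) h2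
        rw [mul_comm (P.ℓ.eval n) (4 * A.time.eval n)] at h3
        rw [List.drop_eq_nil_of_le, List.take_nil]
        rw [List.length_ofFn]
        omega
    · simp only [simInit, caPk, List.length_replicate, h1]
    · simp only [simInit, caSk, List.length_replicate, h1]

/-- An adversary against the protocols yields one against the MAC, which produces a forgery
whenever the former is successful. -/
theorem exists_reduction (hA : A.IsPPT (P.attack κ)) : ∃ B : Adversary macInterface,
    B.IsPPT (P.mac.forgery (fun n => Coins P.ℓ n × Coins P.ℓ n) P.dhMacKey) ∧
    ∃ hN : ∀ n, B.coins.eval n =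
        P.ℓ.eval n + A.coins.eval n + 4 * A.time.eval n * P.ℓ.eval n,
      ∀ n s f, (P.attack κ).Won (A.exec (P.attack κ) n
          ((s, (splitCoins (hN n) f).1, (splitCoins (hN n) f).2.1),
            (splitCoins (hN n) f).2.2)).1 →
        (B.exec (P.mac.forgery (fun n => Coins P.ℓ n × Coins P.ℓ n) P.dhMacKey) n
          (s, f)).1.forged := by
  obtain ⟨c, p, hc⟩ := P.exists_simulator κ
  obtain ⟨q, hq⟩ := P.exists_fresh
  obtain ⟨g, hg⟩ := (P.comp_simInit A).dsize_le
  obtain ⟨d, t, hd⟩ := P.comp_simInit A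
  -- Polynomials for the number of coins, the sizes of the input of the program, of the parts of the
  -- initial state and of the queries, of fresh keys and of new entries, for the size of the state,
  -- and for the overhead of the simulation.
  obtain ⟨C, hC⟩ : ∃ r : Polynomial ℕ, r = P.ℓ + A.coins + 4 * A.time * P.ℓ := ⟨_, rfl⟩
  obtain ⟨G, hG⟩ : ∃ r : Polynomial ℕ, r = 3 + 2 * .X + 2 * C := ⟨_, rfl⟩
  obtain ⟨W, hW⟩ : ∃ r : Polynomial ℕ, r = A.time + g.comp G := ⟨_, rfl⟩
  obtain ⟨F, hF⟩ : ∃ r : Polynomial ℕ, r = q.comp (.X + W) := ⟨_, rfl⟩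
  obtain ⟨D, hD⟩ : ∃ r : Polynomial ℕ, r = 20 + 10 * W + 10 * F + .C P.nMax := ⟨_, rfl⟩
  obtain ⟨S, hS⟩ : ∃ r : Polynomial ℕ, r =
      50 + 2 * .X + 4 * W + (6 * W + 2) * (1 + W * D) := ⟨_, rfl⟩
  obtain ⟨Z, hZ⟩ : ∃ r : Polynomial ℕ, r = S + p.comp (.X + 1 + W + S) := ⟨_, rfl⟩
  have hN : ∀ n, C.eval n = P.ℓ.eval n + A.coins.eval n + 4 * A.time.eval n * P.ℓ.eval n := by
    intro n
    simp [hC]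
  have hin : ∀ n (f : Fin (C.eval n) → Bool),
      dsize (List.replicate n (), List.ofFn f) = G.eval n := by
    intro n f
    rw [dsize_prod, dsize_replicate_unit, dsize_str, List.length_ofFn]
    simp [hG]
    omega
  let O : Polynomial ℕ := .C A.prog.overhead
  refine ⟨⟨.comp .star (.comp (A.prog.simulate c) d.lift), C,
    4 + t.comp G + 2 * (O * (Z + 1) * A.time)⟩, ?_⟩
  -- The run of the simulation, after its initialization.
  have key : ∀ n s f, ∃ x st ms k,
      (A.prog.simulate c).run (P.oracle n)
        (Data.enc (P.simInit A (List.replicate n (), List.ofFn f))) ⟨P.dhMacKey n s, [], False⟩ =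
        ((x, st), ms, k) ∧
      k ≤ A.prog.overhead * (Z.eval n + 1) * A.time.eval n ∧
      ((P.attack κ).Won (A.exec (P.attack κ) n
          ((s, (splitCoins (hN n) f).1, (splitCoins (hN n) f).2.1),
            (splitCoins (hN n) f).2.2)).1 → ms.forged) := by
    intro n s f
    obtain ⟨i1, i2⟩ := P.simInit_spec A (hN n) s f
    have hW' : W.eval n = A.time.eval n + g.eval (G.eval n) := by simp [hW]
    have hS' : S.eval n = stateBound n (W.eval n) (D.eval n) := by simp [hS, stateBound]
    have hsim := Code.simulates (R := P.Related n (W.eval n) (D.eval n) s)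
      (T := A.time.eval n) (Z := Z.eval n) Related.mono
      (fun k σ st ms h hk => (Related.size_le (by omega) k σ st ms h hk).trans (by
        rw [← hS', hZ, Polynomial.eval_add]
        exact Nat.le_add_right _ _)) c
      (hc n (W.eval n) _ (F.eval n) (D.eval n) (Z.eval n) (by
        have := hq n (W.eval n)
        simpa [hF] using this) (by omega) (by simp [hD]) (by
        rw [← hS', hZ]
        simp) s) A.prog
    have hcost := hA n ((s, (splitCoins (hN n) f).1, (splitCoins (hN n) f).2.1),
      (splitCoins (hN n) f).2.2)
    have hst : dsize (P.simInit A (List.replicate n (), List.ofFn f)) ≤ g.eval (G.eval n) := by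
      rw [← hin]
      exact hg _
    have hR : P.Related n (W.eval n) (D.eval n) s 0
        (P.start n (A.time.eval n) (s, (splitCoins (hN n) f).1, (splitCoins (hN n) f).2.1))
        (Data.enc (P.simInit A (List.replicate n (), List.ofFn f)).2)
        ⟨P.dhMacKey n s, [], False⟩ := by
      refine ⟨_, [], rfl, i2, rfl, .inr safe_nil, ?_⟩
      set z := P.simInit A (List.replicate n (), List.ofFn f) with hz
      have e : dsize z = 1 + dsize z.1 + (1 + (1 + dsize z.2.un + (1 + dsize z.2.tape +
        (1 + dsize z.2.caPk + dsize z.2.caSk))) + dsize z.2.2) := rfl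
      have nil : ∀ {α : Type} [Data α] (k M : ℕ), Bounded k M ([] : List α) :=
        fun k M => ⟨Nat.zero_le _, by simp⟩
      refine ⟨rfl, by omega, by omega, by omega, nil _ _, nil _ _, nil _ _, nil _ _, nil _ _,
        nil _ _, ?_⟩
      rintro u ⟨⟩
    unfold Adversary.exec at hcost ⊢
    have e1 : (P.attack κ).start n = P.start n := rfl
    rw [e1, ← i1] at hcost
    rw [e1, ← i1]
    obtain ⟨o1, ⟨st', tr, o2, o3, o4, o5, o6⟩, o7⟩ :=
      hsim 0 (P.simInit A (List.replicate n (), List.ofFn f)).1 _ _ _ hR (by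
        rw [Nat.zero_add]
        exact hcost)
    refine ⟨_, _, _, _, rfl, o7.trans (Nat.mul_le_mul_left _ hcost), fun hwon => ?_⟩
    -- Without a forgery, the guarantee would hold at the end of the run.
    refine o5.resolve_right fun hs => hwon ?_
    exact (congrArg (fun σ : State => Assured σ.trace) o3).mpr hs.assured
  have run : ∀ n s (f : Fin (C.eval n) → Bool), ∃ ms : MACState, ∃ l,
      (Code.comp .star (.comp (A.prog.simulate c) d.lift)).run (P.oracle n)
        (List.replicate n (), List.ofFn f) ⟨P.dhMacKey n s, [], False⟩ = ((), ms, l) ∧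
      l ≤ 4 + t.eval (G.eval n) +
        2 * (A.prog.overhead * (Z.eval n + 1) * A.time.eval n) ∧
      ((P.attack κ).Won (A.exec (P.attack κ) n
          ((s, (splitCoins (hN n) f).1, (splitCoins (hN n) f).2.1),
            (splitCoins (hN n) f).2.2)).1 → ms.forged) := by
    intro n s f
    obtain ⟨x, st, ms, k, h1, h2, h3⟩ := key n s f
    obtain ⟨h4, h5⟩ := hd (List.replicate n (), List.ofFn f)
    have h6 := (A.prog.simulate c).size_le_cost (P.oracle n)
      (Data.enc (P.simInit A (List.replicate n (), List.ofFn f))) ⟨P.dhMacKey n s, [], False⟩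
    rw [h1] at h6
    rw [hin] at h5
    refine ⟨ms, 1 + (1 + (d.exec (Data.enc (List.replicate n (), List.ofFn f))).2.2 + k) +
      (1 + (Ty.prod .unit (Data.ty Sim)).size (x, st) + 1), ?_, ?_, h3⟩
    · have e : d.lift.run (P.oracle n) (List.replicate n (), List.ofFn f)
          ⟨P.dhMacKey n s, [], False⟩ = (Data.enc (P.simInit A (List.replicate n (), List.ofFn f)),
          ⟨P.dhMacKey n s, [], False⟩,
          (d.exec (Data.enc (List.replicate n (), List.ofFn f))).2.2) := by
        rw [← h4]
        exact Code.run_lift _ _ _ _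
      rw [Code.run_comp, Code.run_comp, e, h1]
      rfl
    · simp only at h6
      omega
  refine ⟨fun n ω => ?_, hN, fun n s f hwon => ?_⟩
  · obtain ⟨ms, l, h1, h2, -⟩ := run n ω.1 ω.2
    have e : (Polynomial.eval n (4 + t.comp G + 2 * (O * (Z + 1) * A.time))) =
        4 + t.eval (G.eval n) + 2 * (A.prog.overhead * (Z.eval n + 1) * A.time.eval n) := by
      simp [O]
    rw [e]
    refine le_trans (le_of_eq ?_) h2
    exact congrArg (fun y => y.2.2) h1
  · obtain ⟨ms, l, h1, -, h3⟩ := run n s f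
    exact (congrArg (fun y => y.2.1.forged) h1).mpr (h3 hwon)

/-- The guarantee holds, except with negligible probability, if the MAC is secure. -/
theorem attack_secure (hMAC : P.MACSecure) : (P.attack κ).Secure := by
  intro A hA
  obtain ⟨B, hB, hN, h⟩ := P.exists_reduction κ A hA
  refine (hMAC B hB).mono (fun n => prob_nonneg _ _) fun n => ?_
  refine prob_le_of_bijective (f := fun ω : (Coins P.ℓ n × Coins P.ℓ n) ×
    (Fin (B.coins.eval n) → Bool) => (((ω.1, (splitCoins (hN n) ω.2).1,
      (splitCoins (hN n) ω.2).2.1), (splitCoins (hN n) ω.2).2.2) :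
        P.Seed n (A.time.eval n) × (Fin (A.coins.eval n) → Bool))) ?_ fun ω => h n ω.1 ω.2
  have hb := splitCoins_bijective (hN n)
  constructor
  · rintro ⟨s, f⟩ ⟨s', f'⟩ heq
    simp only [Prod.mk.injEq] at heq
    obtain ⟨⟨rfl, h1, h2⟩, h3⟩ := heq
    rw [hb.1 (Prod.ext h1 (Prod.ext h2 h3))]
  · rintro ⟨⟨s, x, y⟩, z⟩
    obtain ⟨f, hf⟩ := hb.2 (x, y, z)
    exact ⟨(s, f), by simp only [hf]⟩

end Scheme

end Distress

theorem mainTheorem4 (P : Distress.Scheme)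
    (hSignature : P.SignatureSecure)
    (hMAC : P.MACSecure)
    (hNonce : P.NoncesFresh)
    (κ : Distress.Kind) :
    (P.attack κ).Secure :=
  P.attack_secure κ hMAC
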